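/- **Theorem (Reduction of the constrained dynamics).** Let $\tau:E\to M$ and $\tau':E'\to M'$ be Lie algebroids (smooth, finite-dimensional) with anchors $\rho,\rho'$. The prolongation $\mathcal T^EE\to E$ has fibre $\{(b,v)\in E_{\tau(a)}\times T_aE:\rho(b)=T_a\tau(v)\}$ at $a\in E$. It is a Lie algebroid with anchor $\rho^1(a,b,v)=v$ and with the bracket $([\sigma_1,\sigma_2]\circ\tau,[X_1,X_2])$ on projectable sections $(\sigma_i\circ\tau,X_i)$. For $L\in C^\infty(E)$ put $\theta_L=S^*(dL)$, $\omega_L=-d\theta_L$ and $E_L=d_\Delta L-L$, where $b^V_a$ is the velocity at $t=0$ of $t\mapsto a+tb$, $S(a,b,v)=(a,0,b^V_a)$ and $\Delta(a)=(a,0,a^V_a)$. A constrained Lagrangian system $(L,D)$ on $E$ is a function $L\in C^\infty(E)$ with a smooth subbundle $D\subseteq E$. For $a\in D$, let $\mathcal T^D_aD$ be the set of elements $(a,b,v)$ of $\mathcal T^EE$ with $b\in D$ and $v\in T_aD$. An element $(a,a,v)\in\mathcal T^D_aD$ *satisfies the Lagrange–d'Alembert equations* of $(L,D)$ at $a$ if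 there is $\lambda\in D^\circ_{\tau(a)}\subseteq E_{\tau(a)}^*$ such that $$\omega_L\big((a,a,v),(a,b,w)\big)-dE_L(a,b,w)=\lambda(b)\qquad\text{for all }(a,b,w)\in\mathcal T^E_aE .$$ A *solution* is a smooth section $\Gamma$ of $\mathcal T^DD\to D$ of the form $\Gamma(a)=(a,a,X(a))$ whose values satisfy these equations at every $a\in D$. The system is *regular* if it has exactly one solution, denoted $\Gamma_{(L,D)}$. Let $(L,D)$ be a regular constrained Lagrangian system on $E$ and $(L',D')$ a constrained Lagrangian system on $E'$. Let $\Phi:E\to E'$ be an epimorphism of Lie algebroids over $\varphi:M\to M'$, that is, a vector bundle map with $\Phi^*d\theta=d\Phi^*\theta$ for all forms $\theta$ on $E'$ that is fiberwise surjective and whose base map $\varphi$ is a submersion. Suppose that $L=L'\circ\Phi$ and that $\Phi(D)=D'$, meaning that $\varphi$ is surjective and $\Phi(D_x)=D'_{\varphi(x)}$ for all $x\in M$. Write $\mathcal T^\Phi\Phi(a,b,v)=(\Phi(a),\Phi(b),T\Phi(v))$. Then: 1. $(L',D')$ is regular; 2. $\mathcal T^\Phi\Phi\circ\Gamma_{(L,D)}=\Gamma_{(L',D')}\circ\Phi$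 on $D$; 3. if $a(t)$ is a solution of the Lagrange–d'Alembert differential equations for $(L,D)$, then $\Phi(a(t))$ is a solution of the Lagrange–d'Alembert differential equations for $(L',D')$. This holds both for the integral curves in $D$ of $\rho^1(\Gamma_{(L,D)})$ (which go to integral curves in $D'$ of $\rho'^1(\Gamma_{(L',D')})$) and, more generally, for the curves $a(t)$ in $D$ such that $(a(t),a(t),\dot a(t))$ satisfies the Lagrange–d'Alembert equations at $a(t)$ for every $t$. -/

import Mathlib

open Bundle Set Filter
open scoped Manifold ContDiff Topology

noncomputable section

namespace LieAlgd

/-! ### Standing data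

`M` is a smooth manifold modelled on the finite-dimensional space `B`, and `E → M` is a smooth
vector bundle with typical fibre `F`; its total space is `TotalSpace F E`. -/

section Basic

variable {B : Type*} [NormedAddCommGroup B] [NormedSpace ℝ B]
  {M : Type*} [TopologicalSpace M] [ChartedSpace B M]
  {F : Type*} [NormedAddCommGroup F] [NormedSpace ℝ F]
  {E : M → Type*} [TopologicalSpace (TotalSpace F E)]
  [∀ x, AddCommGroup (E x)] [∀ x, Module ℝ (E x)] [∀ x, TopologicalSpace (E x)]
  [FiberBundle F E]

/-- The model with corners of the total space of the bundle. -/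
abbrev totalModel (B F : Type*) [NormedAddCommGroup B] [NormedSpace ℝ B]
    [NormedAddCommGroup F] [NormedSpace ℝ F] : ModelWithCorners ℝ (B × F) (ModelProd B F) :=
  (modelWithCornersSelf ℝ B).prod (modelWithCornersSelf ℝ F)

/-- `v f`: the derivative of the real function `f` along the tangent vector `v` at `x`. -/
def dirDeriv {V H N : Type*} [NormedAddCommGroup V] [NormedSpace ℝ V] [TopologicalSpace H]
    (I : ModelWithCorners ℝ V H) [TopologicalSpace N] [ChartedSpace H N]
    (f : N → ℝ) (x : N) (v : TangentSpace I x) : ℝ :=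
  mfderiv I (modelWithCornersSelf ℝ ℝ) f x v

/-- The module `Sec(E)` of smooth global sections. -/
abbrev Sec (B F : Type*) [NormedAddCommGroup B] [NormedSpace ℝ B]
    [NormedAddCommGroup F] [NormedSpace ℝ F]
    {M : Type*} [TopologicalSpace M] [ChartedSpace B M]
    (E : M → Type*) [TopologicalSpace (TotalSpace F E)]
    [∀ x, AddCommGroup (E x)] [∀ x, Module ℝ (E x)] [∀ x, TopologicalSpace (E x)]
    [FiberBundle F E] :=
  ContMDiffSection (modelWithCornersSelf ℝ B) F ∞ E

/-- The product `f σ` of a smooth function and a smooth section. -/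
def fsmul [VectorBundle ℝ F E] (f : C^∞⟮modelWithCornersSelf ℝ B, M; ℝ⟯) (σ : Sec B F E) :
    Sec B F E :=
  ⟨fun x => f x • σ x, f.contMDiff.smul_section σ.contMDiff⟩

variable (B F E) in
/-- A Lie algebroid structure on `E → M`: an anchor `ρ : E → TM` (a smooth vector bundle map over
the identity) and a real Lie algebra structure on `Sec(E)` with
`[σ, f η] = f [σ, η] + (ρ(σ) f) η`. -/
structure LieAlgebroid [IsManifold (modelWithCornersSelf ℝ B) ∞ M] [VectorBundle ℝ F E] where
  /-- the anchor -/
  anchor : ∀ x, E x →ₗ[ℝ] TangentSpace (modelWithCornersSelf ℝ B) x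
  contMDiff_anchor : ContMDiff (totalModel B F) (modelWithCornersSelf ℝ B).tangent ∞
    (fun a : TotalSpace F E =>
      (⟨a.proj, anchor a.proj a.snd⟩ : TangentBundle (modelWithCornersSelf ℝ B) M))
  /-- the bracket of sections -/
  bracket : Sec B F E → Sec B F E → Sec B F E
  bracket_add : ∀ σ η ζ, bracket σ (η + ζ) = bracket σ η + bracket σ ζ
  add_bracket : ∀ σ η ζ, bracket (σ + η) ζ = bracket σ ζ + bracket η ζ
  bracket_smul : ∀ (c : ℝ) σ η, bracket σ (c • η) = c • bracket σ η
  smul_bracket : ∀ (c : ℝ) σ η, bracket (c • σ) η = c • bracket σ η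
  bracket_self : ∀ σ, bracket σ σ = 0
  jacobi : ∀ σ η ζ,
    bracket σ (bracket η ζ) = bracket (bracket σ η) ζ + bracket η (bracket σ ζ)
  leibniz : ∀ (f : C^∞⟮modelWithCornersSelf ℝ B, M; ℝ⟯) (σ η : Sec B F E) (x : M),
    bracket σ (fsmul f η) x =
      f x • bracket σ η x +
        dirDeriv (modelWithCornersSelf ℝ B) f x (anchor x (σ x)) • η x

variable [IsManifold (modelWithCornersSelf ℝ B) ∞ M] [VectorBundle ℝ F E]

/-! ### Exterior differential -/

/-- A family `θ_x ∈ Λ^p E_x^*` is a smooth `p`-form if it is smooth on smooth sections. -/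
def IsSmoothForm (B F : Type*) [NormedAddCommGroup B] [NormedSpace ℝ B]
    [NormedAddCommGroup F] [NormedSpace ℝ F]
    {M : Type*} [TopologicalSpace M] [ChartedSpace B M]
    {E : M → Type*} [TopologicalSpace (TotalSpace F E)]
    [∀ x, AddCommGroup (E x)] [∀ x, Module ℝ (E x)] [∀ x, TopologicalSpace (E x)]
    [FiberBundle F E] {p : ℕ} (θ : ∀ x, (E x) [⋀^Fin p]→ₗ[ℝ] ℝ) : Prop :=
  ∀ σ : Fin p → Sec B F E,
    ContMDiff (modelWithCornersSelf ℝ B) (modelWithCornersSelf ℝ ℝ) ∞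
      (fun x => θ x (fun i => σ i x))

/-- The value at `x` of `dθ(σ₀, …, σ_p)` for a `p`-form `θ` with `p = q + 1`:
`∑ᵢ (-1)^i ρ(σᵢ)(θ(…, σ̂ᵢ, …)) + ∑_{i<k} (-1)^{i+k} θ([σᵢ, σₖ], …, σ̂ᵢ, …, σ̂ₖ, …)`.
In the second sum `k = j + 1`, and `i < k` means `i ≤ j`. -/
def extDerivForm (A : LieAlgebroid B F E) {q : ℕ} (θ : ∀ x, (E x) [⋀^Fin (q + 1)]→ₗ[ℝ] ℝ)
    (σ : Fin (q + 2) → Sec B F E) (x : M) : ℝ :=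
  (∑ i : Fin (q + 2), (-1 : ℝ) ^ (i : ℕ) *
      dirDeriv (modelWithCornersSelf ℝ B) (fun y => θ y (fun j => σ (i.succAbove j) y)) x
        (A.anchor x (σ i x))) +
  ∑ i : Fin (q + 2), ∑ j : Fin (q + 1),
    if (i : ℕ) ≤ (j : ℕ) then
      (-1 : ℝ) ^ ((i : ℕ) + ((j : ℕ) + 1)) *
        θ x (Fin.cons (A.bracket (σ i) (σ j.succ) x)
          (fun k : Fin q => σ (i.succAbove (j.succAbove k)) x))
    else 0

/-! ### The prolongation `T^E E`

An element of the fibre of `T^E E` over `a ∈ E` is a pair `(b, v) ∈ E_{τ(a)} × T_a E` with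
`ρ(b) = T_a τ (v)`. -/

/-- The space `E_{τ(a)} × T_a E` containing the fibre of the prolongation at `a`. -/
abbrev Pair (B : Type*) [NormedAddCommGroup B] [NormedSpace ℝ B]
    {M : Type*} [TopologicalSpace M] [ChartedSpace B M]
    {F : Type*} [NormedAddCommGroup F] [NormedSpace ℝ F]
    {E : M → Type*} [TopologicalSpace (TotalSpace F E)]
    [∀ x, TopologicalSpace (E x)] [FiberBundle F E] (a : TotalSpace F E) :=
  E a.proj × TangentSpace (totalModel B F) a

/-- The fibre at `a` of the prolongation `T^E E`. -/
def prolongation (A : LieAlgebroid B F E) (a : TotalSpace F E) : Submodule ℝ (Pair B a) where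
  carrier := {z | A.anchor a.proj z.1 =
    mfderiv (totalModel B F) (modelWithCornersSelf ℝ B) (TotalSpace.proj : TotalSpace F E → M)
      a z.2}
  add_mem' := by
    intro z w hz hw
    simp only [mem_ofPred_eq, Prod.fst_add, Prod.snd_add, map_add] at *
    rw [hz, hw]
  zero_mem' := by simp
  smul_mem' := by
    intro c z hz
    simp only [mem_ofPred_eq, Prod.smul_fst, Prod.smul_snd, map_smul] at *
    rw [hz]

/-- The vertical vector `b^V_a ∈ T_a E`: the velocity at `t = 0` of the curve `t ↦ a + t b`.
(The ascription only replaces the base point `a + 0 b` by `a`.) -/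
def vertVector (a : TotalSpace F E) (b : E a.proj) : TangentSpace (totalModel B F) a :=
  (mfderiv (modelWithCornersSelf ℝ ℝ) (totalModel B F)
    (fun t : ℝ => (⟨a.proj, a.snd + t • b⟩ : TotalSpace F E)) 0 (1 : ℝ) : B × F)

/-- The vertical lift `ξ^V(a, b) = (a, 0, b^V_a)`. -/
def vertLift (a : TotalSpace F E) (b : E a.proj) : Pair B a := (0, vertVector a b)

/-- The vertical endomorphism `S(a, b, v) = (a, 0, b^V_a)`. -/
def vertEndo (a : TotalSpace F E) (z : Pair B a) : Pair B a := vertLift a z.1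

/-- The Liouville section `Δ(a) = (a, 0, a^V_a)`. -/
def liouville (a : TotalSpace F E) : Pair B a := vertLift a a.snd

/-- A smooth projectable section `Z(a) = (a, σ(τ(a)), X(a))` of `T^E E`: `σ` is a smooth section
of `E` and `X` a smooth vector field on the manifold `E` that projects to `ρ(σ)`. -/
structure ProjectableSection (A : LieAlgebroid B F E)
    [ContMDiffVectorBundle ∞ F E (modelWithCornersSelf ℝ B)] where
  base : Sec B F E
  field : ∀ a : TotalSpace F E, TangentSpace (totalModel B F) a
  contMDiff_field : ContMDiff (totalModel B F) (totalModel B F).tangent ∞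
    (fun a => (⟨a, field a⟩ : TangentBundle (totalModel B F) (TotalSpace F E)))
  mem_prolongation : ∀ a, ((base a.proj, field a) : Pair B a) ∈ prolongation A a

variable [ContMDiffVectorBundle ∞ F E (modelWithCornersSelf ℝ B)]

/-- The value at `a` of a projectable section. -/
def ProjectableSection.val {A : LieAlgebroid B F E} (Z : ProjectableSection A)
    (a : TotalSpace F E) : Pair B a := (Z.base a.proj, Z.field a)

/-- The value at `a` of the Lie bracket `([σ₁, σ₂] ∘ τ, [X₁, X₂])` of projectable sections. -/
def prolBracket {A : LieAlgebroid B F E} (Z₁ Z₂ : ProjectableSection A) (a : TotalSpace F E) :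
    Pair B a :=
  (A.bracket Z₁.base Z₂.base a.proj,
    VectorField.mlieBracket (totalModel B F) Z₁.field Z₂.field a)

/-- The value at `a` of `dθ(Z₁, Z₂) = ρ¹(Z₁)(θ(Z₂)) - ρ¹(Z₂)(θ(Z₁)) - θ([Z₁, Z₂])` for a
`1`-form `θ` on the Lie algebroid `T^E E`, where `ρ¹(b, v) = v`. -/
def prolExtDeriv {A : LieAlgebroid B F E} (θ : ∀ a : TotalSpace F E, Pair B a → ℝ)
    (Z₁ Z₂ : ProjectableSection A) (a : TotalSpace F E) : ℝ :=
  dirDeriv (totalModel B F) (fun c => θ c (Z₂.val c)) a (Z₁.field a) -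
    dirDeriv (totalModel B F) (fun c => θ c (Z₁.val c)) a (Z₂.field a) -
    θ a (prolBracket Z₁ Z₂ a)

/-! ### Cartan forms and energy of a Lagrangian -/

/-- The differential of a function on `E`, as a `1`-form on `T^E E`: `df(a, b, v) = v f`. -/
def prolDiff (f : TotalSpace F E → ℝ) (a : TotalSpace F E) (z : Pair B a) : ℝ :=
  dirDeriv (totalModel B F) f a z.2

/-- The Cartan `1`-form `θ_L = S^*(dL)`. -/
def cartanOne (L : TotalSpace F E → ℝ) (a : TotalSpace F E) (z : Pair B a) : ℝ :=
  prolDiff L a (vertEndo a z)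

open Classical in
/-- The Cartan `2`-form `ω_L = -dθ_L` at elements `z, w` of the fibre of `T^E E` at `a`: its value
is computed on projectable sections through `z` and `w`. Such sections always exist, and the value
does not depend on them because `dθ_L` is a tensor. (Off the prolongation the value is `0` and is
never used.) -/
def cartanTwo (A : LieAlgebroid B F E) (L : TotalSpace F E → ℝ) (a : TotalSpace F E)
    (z w : Pair B a) : ℝ :=
  if h : ∃ Z : ProjectableSection A × ProjectableSection A, Z.1.val a = z ∧ Z.2.val a = w then
    - prolExtDeriv (cartanOne L) h.choose.1 h.choose.2 a
  else 0

/-- The energy `E_L = d_Δ L - L`. -/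
def energy (B : Type*) [NormedAddCommGroup B] [NormedSpace ℝ B]
    {M : Type*} [TopologicalSpace M] [ChartedSpace B M]
    {F : Type*} [NormedAddCommGroup F] [NormedSpace ℝ F]
    {E : M → Type*} [TopologicalSpace (TotalSpace F E)]
    [∀ x, AddCommGroup (E x)] [∀ x, Module ℝ (E x)] [∀ x, TopologicalSpace (E x)]
    [FiberBundle F E] (L : TotalSpace F E → ℝ) (a : TotalSpace F E) : ℝ :=
  prolDiff L a (liouville (B := B) a) - L a

/-! ### Nonholonomically constrained Lagrangian systems -/

/-- A smooth vector subbundle `D ⊆ E`: near every point it has a smooth local frame. -/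
def IsSmoothSubbundle (B F : Type*) [NormedAddCommGroup B] [NormedSpace ℝ B]
    [NormedAddCommGroup F] [NormedSpace ℝ F]
    {M : Type*} [TopologicalSpace M] [ChartedSpace B M]
    {E : M → Type*} [TopologicalSpace (TotalSpace F E)]
    [∀ x, AddCommGroup (E x)] [∀ x, Module ℝ (E x)] [∀ x, TopologicalSpace (E x)]
    [FiberBundle F E] (D : ∀ x, Submodule ℝ (E x)) : Prop :=
  ∀ x : M, ∃ (U : Set M) (k : ℕ) (s : Fin k → ∀ y, E y), IsOpen U ∧ x ∈ U ∧
    (∀ i, ContMDiffOn (modelWithCornersSelf ℝ B) (totalModel B F) ∞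
      (fun y => (⟨y, s i y⟩ : TotalSpace F E)) U) ∧
    ∀ y ∈ U, LinearIndependent ℝ (fun i => s i y) ∧
      Submodule.span ℝ (Set.range fun i => s i y) = D y

variable (B F E) in
/-- A nonholonomically constrained Lagrangian system `(L, D)`. -/
structure ConstrainedSystem where
  /-- the Lagrangian -/
  L : TotalSpace F E → ℝ
  contMDiff_L : ContMDiff (totalModel B F) (modelWithCornersSelf ℝ ℝ) ∞ L
  /-- the constraint subbundle -/
  D : ∀ x, Submodule ℝ (E x)
  isSmoothSubbundle_D : IsSmoothSubbundle B F D

/-- `D` as a subset of the manifold `E`. -/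
def ConstrainedSystem.space (C : ConstrainedSystem B F E) : Set (TotalSpace F E) :=
  {a | a.snd ∈ C.D a.proj}

/-- `v ∈ T_a D ⊆ T_a E`: the vector `v` is the velocity at `a` of a smooth curve lying in `D`. -/
def ConstrainedSystem.IsTangent (C : ConstrainedSystem B F E) (a : TotalSpace F E)
    (v : TangentSpace (totalModel B F) a) : Prop :=
  ∃ γ : ℝ → TotalSpace F E,
    ContMDiffAt (modelWithCornersSelf ℝ ℝ) (totalModel B F) ∞ γ 0 ∧
    (∀ᶠ t in 𝓝 (0 : ℝ), γ t ∈ C.space) ∧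
    (⟨γ 0, mfderiv (modelWithCornersSelf ℝ ℝ) (totalModel B F) γ 0 (1 : ℝ)⟩ :
      TangentBundle (totalModel B F) (TotalSpace F E)) = ⟨a, v⟩

/-- `z` belongs to the fibre of `T^D D` at `a ∈ D`:
`z = (b, v)` with `b ∈ D`, `v ∈ T_a D` and `ρ(b) = Tτ(v)`. -/
def ConstrainedSystem.MemProlD (C : ConstrainedSystem B F E) (A : LieAlgebroid B F E)
    (a : TotalSpace F E) (z : Pair B a) : Prop :=
  z ∈ prolongation A a ∧ z.1 ∈ C.D a.proj ∧ C.IsTangent a z.2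

/-- `z` satisfies the Lagrange-d'Alembert equations at `a ∈ D`: `z = (a, a, v)` is a SODE element
of `T^D D`, and there is `λ` in the annihilator `D°` with `i_z ω_L - dE_L = λ ∘ Tτ` on the fibre
of `T^E E` at `a`, that is, `(i_z ω_L - dE_L)(b, v) = λ(b)`. -/
structure ConstrainedSystem.SatisfiesLdA (C : ConstrainedSystem B F E) (A : LieAlgebroid B F E)
    (a : TotalSpace F E) (z : Pair B a) : Prop where
  memProlD : C.MemProlD A a z
  sode : z.1 = a.snd
  equation : ∃ lam : E a.proj →ₗ[ℝ] ℝ, (∀ d ∈ C.D a.proj, lam d = 0) ∧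
    ∀ w ∈ prolongation A a,
      cartanTwo A C.L a z w - prolDiff (energy B C.L) a w = lam w.1

/-- `Γ` is a solution of the Lagrange-d'Alembert equations of `(L, D)`: a smooth SODE section of
`T^D D → D` that satisfies them at every point of `D`. Values off `D` are irrelevant. -/
structure ConstrainedSystem.IsSolution (C : ConstrainedSystem B F E) (A : LieAlgebroid B F E)
    (Γ : ∀ a : TotalSpace F E, Pair B a) : Prop where
  contMDiffOn_fst : ContMDiffOn (totalModel B F) (totalModel B F) ∞
    (fun a => (⟨a.proj, (Γ a).1⟩ : TotalSpace F E)) C.space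
  contMDiffOn_snd : ContMDiffOn (totalModel B F) (totalModel B F).tangent ∞
    (fun a => (⟨a, (Γ a).2⟩ : TangentBundle (totalModel B F) (TotalSpace F E))) C.space
  satisfiesLdA : ∀ a ∈ C.space, C.SatisfiesLdA A a (Γ a)

/-- `(L, D)` is regular: the Lagrange-d'Alembert equations have a unique solution (solutions that
agree on `D` are the same). -/
def ConstrainedSystem.IsRegular (C : ConstrainedSystem B F E) (A : LieAlgebroid B F E) : Prop :=
  ∃ Γ : ∀ a : TotalSpace F E, Pair B a, C.IsSolution A Γ ∧
    ∀ Γ₁ : ∀ a : TotalSpace F E, Pair B a, C.IsSolution A Γ₁ → ∀ a ∈ C.space, Γ₁ a = Γ a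

/-- On the set `J` of times, `γ` is a curve in `D` and an integral curve of the vector field
`ρ¹(Γ)`. -/
def ConstrainedSystem.IsIntegralCurve (C : ConstrainedSystem B F E)
    (Γ : ∀ a : TotalSpace F E, Pair B a) (γ : ℝ → TotalSpace F E) (J : Set ℝ) : Prop :=
  (∀ t ∈ J, γ t ∈ C.space) ∧ IsMIntegralCurveOn (I := totalModel B F) γ (fun a => (Γ a).2) J

/-- On the set `J` of times, `γ` is a differentiable curve in `D`, and `(γ(t), γ(t), γ̇(t))`
satisfies the Lagrange-d'Alembert equations of `(L, D)`; in particular `γ` is admissible. -/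
def ConstrainedSystem.IsLdACurve (C : ConstrainedSystem B F E) (A : LieAlgebroid B F E)
    (γ : ℝ → TotalSpace F E) (J : Set ℝ) : Prop :=
  ∀ t ∈ J, γ t ∈ C.space ∧ ∃ v : TangentSpace (totalModel B F) (γ t),
    HasMFDerivWithinAt (modelWithCornersSelf ℝ ℝ) (totalModel B F) γ J t
      ((1 : ℝ →L[ℝ] ℝ).smulRight v) ∧
    C.SatisfiesLdA A (γ t) ((γ t).snd, v)

end Basic

/-! ### Morphisms -/

section Morphisms

variable {B : Type*} [NormedAddCommGroup B] [NormedSpace ℝ B]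
  {M : Type*} [TopologicalSpace M] [ChartedSpace B M]
  {F : Type*} [NormedAddCommGroup F] [NormedSpace ℝ F]
  {E : M → Type*} [TopologicalSpace (TotalSpace F E)]
  [∀ x, AddCommGroup (E x)] [∀ x, Module ℝ (E x)] [∀ x, TopologicalSpace (E x)]
  [FiberBundle F E]
  {B' : Type*} [NormedAddCommGroup B'] [NormedSpace ℝ B']
  {M' : Type*} [TopologicalSpace M'] [ChartedSpace B' M']
  {F' : Type*} [NormedAddCommGroup F'] [NormedSpace ℝ F']
  {E' : M' → Type*} [TopologicalSpace (TotalSpace F' E')]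
  [∀ x, AddCommGroup (E' x)] [∀ x, Module ℝ (E' x)] [∀ x, TopologicalSpace (E' x)]
  [FiberBundle F' E']

/-- The map of total spaces of a fibrewise linear map `Φ` over `φ`. -/
def totalMap (F F' : Type*) {φ : M → M'} (Φ : ∀ x, E x →ₗ[ℝ] E' (φ x)) (a : TotalSpace F E) :
    TotalSpace F' E' :=
  ⟨φ a.proj, Φ a.proj a.snd⟩

/-- The prolongation `T^Φ Φ (a, b, v) = (Φ(a), Φ(b), TΦ(v))`. -/
def prolMap {φ : M → M'} (Φ : ∀ x, E x →ₗ[ℝ] E' (φ x)) (a : TotalSpace F E) (z : Pair B a) :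
    Pair B' (totalMap F F' Φ a) :=
  (Φ a.proj z.1, mfderiv (totalModel B F) (totalModel B' F') (totalMap F F' Φ) a z.2)

variable [IsManifold (modelWithCornersSelf ℝ B) ∞ M] [VectorBundle ℝ F E]
  [IsManifold (modelWithCornersSelf ℝ B') ∞ M'] [VectorBundle ℝ F' E']

/-- `Φ` is a morphism of Lie algebroids over `φ`: it is a smooth vector bundle map and
`Φ^* dθ = d Φ^* θ` for every smooth `p`-form `θ` on `E'`, `p = 0, 1, 2, …`. The identity of
`(p+1)`-forms is expressed by evaluating it at `x` on smooth sections `σᵢ` of `E`, the form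
`dθ` being evaluated at `Φ(σᵢ(x))` by means of smooth sections `σ'ᵢ` of `E'` through these
elements. -/
structure IsMorphism (A : LieAlgebroid B F E) (A' : LieAlgebroid B' F' E')
    (φ : M → M') (Φ : ∀ x, E x →ₗ[ℝ] E' (φ x)) : Prop where
  contMDiff_base :
    ContMDiff (modelWithCornersSelf ℝ B) (modelWithCornersSelf ℝ B') ∞ φ
  contMDiff_total : ContMDiff (totalModel B F) (totalModel B' F') ∞ (totalMap F F' Φ)
  pullback_diff : ∀ f : M' → ℝ,
    ContMDiff (modelWithCornersSelf ℝ B') (modelWithCornersSelf ℝ ℝ) ∞ f →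
    ∀ (x : M) (b : E x),
      dirDeriv (modelWithCornersSelf ℝ B') f (φ x) (A'.anchor (φ x) (Φ x b)) =
        dirDeriv (modelWithCornersSelf ℝ B) (f ∘ φ) x (A.anchor x b)
  pullback_extDeriv : ∀ (q : ℕ) (θ : ∀ x', (E' x') [⋀^Fin (q + 1)]→ₗ[ℝ] ℝ),
    IsSmoothForm B' F' θ →
    ∀ (x : M) (σ : Fin (q + 2) → Sec B F E) (σ' : Fin (q + 2) → Sec B' F' E'),
      (∀ i, σ' i (φ x) = Φ x (σ i x)) →
      extDerivForm A' θ σ' (φ x) =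
        extDerivForm A (fun y => (θ (φ y)).compLinearMap (Φ y)) σ x

/-- `Φ` is an epimorphism of Lie algebroids: a fibrewise surjective morphism whose base map is a
submersion. -/
structure IsEpimorphism (A : LieAlgebroid B F E) (A' : LieAlgebroid B' F' E')
    (φ : M → M') (Φ : ∀ x, E x →ₗ[ℝ] E' (φ x)) : Prop where
  isMorphism : IsMorphism A A' φ Φ
  surjective : ∀ x, Function.Surjective (Φ x)
  isSubmersion :
    Manifold.IsSubmersion (modelWithCornersSelf ℝ B) (modelWithCornersSelf ℝ B') ∞ φ

end Morphisms

end LieAlgd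

end

set_option linter.unusedSectionVars false

noncomputable section

/-! Regularity is a global statement about smooth solutions, and the proof first extracts pointwise
information from it. Let H_a be the Hessian of L at a along the fibre, restricted to D. Two elements
(a,a,v) and (a,a,v') of the prolongation of D differ by the vertical lift of some d in D, and adding
that lift to z changes ω_L(z,·) by -Hess L(d,·). Hence the Lagrange–d'Alembert element at a is
unique where H_a is nondegenerate. Conversely, if H were degenerate on a nonempty relatively open
part of D, its kernel would contain a nonzero smooth field near a point of maximal rank. Cut off by
a bump function and added to the solution, this field would give a second solution. So uniqueness
makes H nondegenerate on a dense subset of D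
(`ConstrainedSystem.IsRegular.exists_isNondegenerateAt`), and density is all that is used.

Because L = L'∘Φ, vectors of D killed by Φ lie in the kernel of H. Thus Φ is injective on D over a
dense set of points of M, and since the ranks of D and D' are locally constant it is injective on
every D_x (`ConstrainedSystem.IsRegular.eq_zero_of_map_eq_zero`). Together with φ being a submersion
this gives smooth local sections of Φ : D → D' through every point of D
(`exists_local_section_totalMap`).

The equations themselves push forward (`ConstrainedSystem.satisfiesLdA_totalMap`): ω_L and E_L are
pulled back from ω_{L'} and E_{L'}, and the multiplier vanishes on ker Φ, so it descends to E'. For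
the solution Γ(a) = (a,a,X(a)), the vectors TΦ(X(a)) therefore solve the equations of (L',D') at
Φ(a). Over the images of nondegenerate points, which are dense in D', they depend only on Φ(a). By
continuity along local sections this holds everywhere (`pushField_eq`), so they define a smooth
solution on D' (`exists_isSolution`). Uniqueness on D' is the same density argument, and the
statements about curves follow by the chain rule. -/

namespace LieAlgd

/-! ### Smooth families of kernel vectors and left inverses -/

section LinearAlgebra

variable {V W : Type*} [NormedAddCommGroup V] [NormedSpace ℝ V] [FiniteDimensional ℝ V]
  [NormedAddCommGroup W] [NormedSpace ℝ W] [FiniteDimensional ℝ W]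

/-- A vector in the kernel of a linear map extends smoothly to kernel vectors of all nearby maps
of no greater rank. -/
theorem exists_kernel_extension (T₀ : V →L[ℝ] W) (u₀ : V) (hu₀ : T₀ u₀ = 0) :
    ∃ (𝒰 : Set (V →L[ℝ] W)) (K : (V →L[ℝ] W) → V), IsOpen 𝒰 ∧ T₀ ∈ 𝒰 ∧ ContDiffOn ℝ ∞ K 𝒰 ∧
      K T₀ = u₀ ∧ ∀ T ∈ 𝒰,
        Module.finrank ℝ T.range ≤ Module.finrank ℝ T₀.range → T (K T) = 0 := by
  set R := T₀.range with hR
  have : CompleteSpace R := FiniteDimensional.complete ℝ R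
  obtain ⟨P, hP⟩ := Submodule.exists_isCompl R
  let p : W →L[ℝ] R := LinearMap.toContinuousLinearMap (R.projectionOnto P hP)
  have hpR : ∀ r : R, p r = r := fun r => Submodule.projectionOnto_apply_left hP r
  obtain ⟨q₀, hq₀⟩ := (T₀ : V →ₗ[ℝ] W).rangeRestrict.exists_rightInverse_of_surjective
    (LinearMap.range_rangeRestrict _)
  let q : R →L[ℝ] V := LinearMap.toContinuousLinearMap q₀
  have hq : ∀ r : R, T₀ (q r) = r := fun r => congrArg Subtype.val (DFunLike.congr_fun hq₀ r)
  -- The compression of T to the range of T₀: the identity at T₀, hence invertible nearby.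
  let Φ : (V →L[ℝ] W) → (R →L[ℝ] R) := fun T => (p.comp T).comp q
  have hΦ : ContDiff ℝ ∞ Φ := (contDiff_const.clm_comp contDiff_id).clm_comp contDiff_const
  have hΦ₀ : Φ T₀ = ContinuousLinearMap.id ℝ R := by
    ext r
    change ((p (T₀ (q r)) : R) : W) = r
    rw [hq, hpR]
  let 𝒰 : Set (V →L[ℝ] W) := Φ ⁻¹' {S | IsUnit S}
  -- The correction term solves p T (u₀ - q r) = 0 for r. It vanishes at T₀ because T₀ u₀ = 0.
  refine ⟨𝒰, fun T => u₀ - q (Ring.inverse (Φ T) (p (T u₀))),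
    (Units.isOpen (R := R →L[ℝ] R)).preimage hΦ.continuous,
    ?_, ?_, ?_, ?_⟩
  · change IsUnit (Φ T₀)
    rw [hΦ₀]
    exact isUnit_one
  · intro T hT
    refine ContDiffAt.contDiffWithinAt ?_
    refine contDiffAt_const.sub (contDiffAt_const.clm_apply (ContDiffAt.clm_apply ?_
      (contDiffAt_const.clm_apply (contDiffAt_id.clm_apply contDiffAt_const))))
    obtain ⟨S, hS⟩ := hT
    have h1 : ContDiffAt ℝ ∞ (Ring.inverse : (R →L[ℝ] R) → _) (Φ T) := by
      rw [← hS]; exact contDiffAt_ringInverse ℝ (R := R →L[ℝ] R) S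
    exact h1.comp T hΦ.contDiffAt
  · simp [hu₀]
  · intro T hT hrank
    have hT' : IsUnit (Φ T) := hT
    set u := u₀ - q (Ring.inverse (Φ T) (p (T u₀))) with hu
    have h1 : p (T u) = 0 := by
      have h2 := DFunLike.congr_fun (Ring.mul_inverse_cancel (Φ T) hT') (p (T u₀))
      have h3 : p (T (q (Ring.inverse (Φ T) (p (T u₀))))) = p (T u₀) := h2
      rw [hu, map_sub, map_sub, h3, sub_self]
    -- Since p T q is invertible, p maps the range of T onto R. The rank bound then makes p
    -- injective on that range, so p (T u) = 0 forces T u = 0.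
    have hsurj : Function.Surjective (p.toLinearMap.domRestrict T.range) := by
      intro r
      refine ⟨⟨T (q (Ring.inverse (Φ T) r)), ⟨_, rfl⟩⟩, ?_⟩
      exact DFunLike.congr_fun (Ring.mul_inverse_cancel (Φ T) hT') r
    have hle := LinearMap.finrank_le_finrank_of_surjective hsurj
    have hinj := (LinearMap.injective_iff_surjective_of_finrank_eq_finrank
      (le_antisymm hrank hle)).2 hsurj
    have h4 : (⟨T u, ⟨u, rfl⟩⟩ : T.range) = 0 := hinj (by
      rw [map_zero]
      exact h1)
    exact congrArg Subtype.val h4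

/-- An injective linear map has a smooth family of left inverses near it. -/
theorem exists_leftInverse_extension (T₀ : V →L[ℝ] W) (hT₀ : Function.Injective T₀) :
    ∃ (𝒰 : Set (V →L[ℝ] W)) (K : (V →L[ℝ] W) → (W →L[ℝ] V)), IsOpen 𝒰 ∧ T₀ ∈ 𝒰 ∧
      ContDiffOn ℝ ∞ K 𝒰 ∧ ∀ T ∈ 𝒰, ∀ v, K T (T v) = v := by
  have : CompleteSpace V := FiniteDimensional.complete ℝ V
  obtain ⟨p₀, hp₀⟩ := (T₀ : V →ₗ[ℝ] W).exists_leftInverse_of_injective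
    (LinearMap.ker_eq_bot.2 hT₀)
  let p : W →L[ℝ] V := LinearMap.toContinuousLinearMap p₀
  let Φ : (V →L[ℝ] W) → (V →L[ℝ] V) := fun T => p.comp T
  have hΦ : ContDiff ℝ ∞ Φ := contDiff_const.clm_comp contDiff_id
  -- A fixed left inverse p of T₀ is renormalised to (p T)⁻¹ p.
  refine ⟨Φ ⁻¹' {S | IsUnit S}, fun T => (Ring.inverse (Φ T)).comp p,
    Units.isOpen.preimage hΦ.continuous, ?_, ?_, ?_⟩
  · change IsUnit (Φ T₀)
    have : Φ T₀ = 1 := by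
      ext v
      exact DFunLike.congr_fun hp₀ v
    rw [this]
    exact isUnit_one
  · intro T hT
    refine ContDiffAt.contDiffWithinAt (ContDiffAt.clm_comp ?_ contDiffAt_const)
    obtain ⟨S, hS⟩ := hT
    have h1 : ContDiffAt ℝ ∞ (Ring.inverse : (V →L[ℝ] V) → _) (Φ T) := by
      rw [← hS]; exact contDiffAt_ringInverse ℝ S
    exact h1.comp T hΦ.contDiffAt
  · intro T hT v
    exact DFunLike.congr_fun (Ring.inverse_mul_cancel (Φ T) hT) v

end LinearAlgebra

/-! ### Coordinates on the total space of a vector bundle -/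

section VectorBundles

variable {B : Type*} [NormedAddCommGroup B] [NormedSpace ℝ B]
  {M : Type*} [TopologicalSpace M] [ChartedSpace B M]
  {F : Type*} [NormedAddCommGroup F] [NormedSpace ℝ F]
  {E : M → Type*} [TopologicalSpace (TotalSpace F E)]
  [∀ x, AddCommGroup (E x)] [∀ x, Module ℝ (E x)] [∀ x, TopologicalSpace (E x)]
  [FiberBundle F E]

/-- Needed twice: for bump functions on the manifold E, and, applied to its tangent bundle, so that
continuous fields agreeing on a dense set are equal. -/
theorem t2Space_totalSpace [T2Space M] : T2Space (TotalSpace F E) := by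
  refine ⟨fun a b hab => ?_⟩
  by_cases h : a.proj = b.proj
  · set e := trivializationAt F E a.proj
    have ha : a ∈ e.source := FiberBundle.mem_trivializationAt_proj_source
    have hb : b ∈ e.source := by rw [e.mem_source, ← h, ← e.mem_source]; exact ha
    have hne : e a ≠ e b := fun h' => hab (e.injOn ha hb h')
    obtain ⟨u, v, hu, hv, hau, hbv, huv⟩ := t2_separation hne
    exact ⟨_, _, e.continuousOn.isOpen_inter_preimage e.open_source hu,
      e.continuousOn.isOpen_inter_preimage e.open_source hv, ⟨ha, hau⟩, ⟨hb, hbv⟩,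
      Set.disjoint_left.2 fun c hc hc' => Set.disjoint_left.1 huv hc.2 hc'.2⟩
  · obtain ⟨u, v, hu, hv, hau, hbv, huv⟩ := t2_separation h
    have hc := FiberBundle.continuous_proj F E
    exact ⟨_, _, hu.preimage hc, hv.preimage hc, hau, hbv, huv.preimage _⟩

/-- The fibre coordinate of the preferred trivialization at `x`. -/
def fibreCoord (F : Type*) [NormedAddCommGroup F] [NormedSpace ℝ F]
    {M : Type*} [TopologicalSpace M]
    {E : M → Type*} [TopologicalSpace (TotalSpace F E)] [∀ x, TopologicalSpace (E x)]
    [FiberBundle F E] (x : M) (a : TotalSpace F E) : F :=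
  (trivializationAt F E x a).2

theorem mem_baseSet (x : M) : x ∈ (trivializationAt F E x).baseSet :=
  FiberBundle.mem_baseSet_trivializationAt' x

variable [VectorBundle ℝ F E]

theorem fibreCoord_add {x y : M} (hy : y ∈ (trivializationAt F E x).baseSet) (b c : E y) :
    fibreCoord F x (⟨y, b + c⟩ : TotalSpace F E) =
      fibreCoord F x (⟨y, b⟩ : TotalSpace F E) + fibreCoord F x (⟨y, c⟩ : TotalSpace F E) :=
  ((trivializationAt F E x).linear ℝ hy).map_add b c

theorem fibreCoord_smul {x y : M} (hy : y ∈ (trivializationAt F E x).baseSet) (r : ℝ) (b : E y) :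
    fibreCoord F x (⟨y, r • b⟩ : TotalSpace F E) =
      r • fibreCoord F x (⟨y, b⟩ : TotalSpace F E) :=
  ((trivializationAt F E x).linear ℝ hy).map_smul r b

/-- The fibre coordinate as a linear equivalence. -/
def fibreEquiv (F : Type*) [NormedAddCommGroup F] [NormedSpace ℝ F]
    {M : Type*} [TopologicalSpace M]
    {E : M → Type*} [TopologicalSpace (TotalSpace F E)] [∀ x, TopologicalSpace (E x)]
    [∀ x, AddCommGroup (E x)] [∀ x, Module ℝ (E x)]
    [FiberBundle F E] [VectorBundle ℝ F E] {x y : M}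
    (hy : y ∈ (trivializationAt F E x).baseSet) : E y ≃ₗ[ℝ] F :=
  (trivializationAt F E x).linearEquivAt ℝ y hy

theorem fibreEquiv_apply {x y : M} (hy : y ∈ (trivializationAt F E x).baseSet) (b : E y) :
    fibreEquiv F hy b = fibreCoord F x (⟨y, b⟩ : TotalSpace F E) := rfl

theorem fibreCoord_sum {x y : M} (hy : y ∈ (trivializationAt F E x).baseSet) {ι : Type*}
    (s : Finset ι) (b : ι → E y) :
    fibreCoord F x (⟨y, ∑ i ∈ s, b i⟩ : TotalSpace F E) =
      ∑ i ∈ s, fibreCoord F x (⟨y, b i⟩ : TotalSpace F E) := by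
  simp only [← fibreEquiv_apply hy, map_sum]

variable [ContMDiffVectorBundle ∞ F E (modelWithCornersSelf ℝ B)]

theorem contMDiffOn_fibreCoord (x : M) :
    ContMDiffOn (totalModel B F) (modelWithCornersSelf ℝ F) ∞ (fibreCoord F x : TotalSpace F E → F)
      (trivializationAt F E x).source :=
  contMDiff_snd.comp_contMDiffOn (trivializationAt F E x).contMDiffOn

theorem contMDiffAt_fibreCoord {x : M} {a : TotalSpace F E}
    (ha : a.proj ∈ (trivializationAt F E x).baseSet) :
    ContMDiffAt (totalModel B F) (modelWithCornersSelf ℝ F) ∞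
      (fibreCoord F x : TotalSpace F E → F) a :=
  (contMDiffOn_fibreCoord x).contMDiffAt
    ((trivializationAt F E x).open_source.mem_nhds ((trivializationAt F E x).mem_source.2 ha))

theorem contMDiffAt_iff_fibreCoord {V H N : Type*} [NormedAddCommGroup V] [NormedSpace ℝ V]
    [TopologicalSpace H] {I : ModelWithCorners ℝ V H} [TopologicalSpace N] [ChartedSpace H N]
    {f : N → TotalSpace F E} {z : N} {x : M}
    (hx : (f z).proj ∈ (trivializationAt F E x).baseSet) :
    ContMDiffAt I (totalModel B F) ∞ f z ↔
      ContMDiffAt I (modelWithCornersSelf ℝ B) ∞ (fun y => (f y).proj) z ∧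
      ContMDiffAt I (modelWithCornersSelf ℝ F) ∞ (fun y => fibreCoord F x (f y)) z :=
  (trivializationAt F E x).contMDiffAt_iff ((trivializationAt F E x).mem_source.2 hx)

theorem extChartAt_total_apply (a c : TotalSpace F E)
    (hc : c.proj ∈ (trivializationAt F E a.proj).baseSet) :
    extChartAt (totalModel B F) a c =
      (extChartAt (modelWithCornersSelf ℝ B) a.proj c.proj, fibreCoord F a.proj c) := by
  rw [FiberBundle.extChartAt]
  have := (trivializationAt F E a.proj).coe_fst' hc
  simp [fibreCoord, this]

variable [IsManifold (modelWithCornersSelf ℝ B) ∞ M]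

theorem mdifferentiableAt_fibreCoord {x : M} {a : TotalSpace F E}
    (ha : a.proj ∈ (trivializationAt F E x).baseSet) :
    MDifferentiableAt (totalModel B F) (modelWithCornersSelf ℝ F)
      (fibreCoord F x : TotalSpace F E → F) a :=
  (contMDiffAt_fibreCoord ha).mdifferentiableAt (by simp)

theorem mdifferentiableAt_proj (a : TotalSpace F E) :
    MDifferentiableAt (totalModel B F) (modelWithCornersSelf ℝ B)
      (TotalSpace.proj : TotalSpace F E → M) a :=
  (contMDiffAt_proj E).mdifferentiableAt (n := ∞) (by simp)

theorem eventually_mem_baseSet {x : M} {a : TotalSpace F E}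
    (ha : a.proj ∈ (trivializationAt F E x).baseSet) :
    ∀ᶠ c in 𝓝 a, c.proj ∈ (trivializationAt F E x).baseSet :=
  (FiberBundle.continuous_proj F E).continuousAt.eventually
    ((trivializationAt F E x).open_baseSet.mem_nhds ha)

theorem mfderiv_extChartAt_total (a : TotalSpace F E) :
    mfderiv (totalModel B F) (modelWithCornersSelf ℝ (B × F)) (extChartAt (totalModel B F) a) a =
      ContinuousLinearMap.id ℝ (B × F) := by
  have : IsManifold (totalModel B F) 1 (TotalSpace F E) := .of_le (n := ∞) (by simp)
  exact mfderiv_extChartAt_self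

/-- A tangent vector of the total space in the preferred chart at its base point. -/
def tangentCoord {a : TotalSpace F E} (v : TangentSpace (totalModel B F) a) : B × F := v

/-- The chart of the total space at a is the trivialization at τ(a) followed by the chart of M at
τ(a), and a chart has identity derivative at its own base point. -/
theorem mfderiv_proj_apply (a : TotalSpace F E) (v : TangentSpace (totalModel B F) a) :
    mfderiv (totalModel B F) (modelWithCornersSelf ℝ B) (TotalSpace.proj : TotalSpace F E → M)
      a v = (tangentCoord v).1 := by
  have h1M : IsManifold (modelWithCornersSelf ℝ B) 1 M := .of_le (n := ∞) (by simp)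
  have h1E : IsManifold (totalModel B F) 1 (TotalSpace F E) := .of_le (n := ∞) (by simp)
  have h1 : mfderiv (totalModel B F) (modelWithCornersSelf ℝ B)
      (fun c => extChartAt (modelWithCornersSelf ℝ B) a.proj (c.proj)) a =
      (mfderiv (modelWithCornersSelf ℝ B) (modelWithCornersSelf ℝ B)
        (extChartAt (modelWithCornersSelf ℝ B) a.proj) a.proj).comp
      (mfderiv (totalModel B F) (modelWithCornersSelf ℝ B)
        (TotalSpace.proj : TotalSpace F E → M) a) :=
    mfderiv_comp a (mdifferentiableAt_extChartAt (mem_chart_source _ _)) (mdifferentiableAt_proj a)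
  have h2 : (fun c : TotalSpace F E => extChartAt (modelWithCornersSelf ℝ B) a.proj (c.proj))
      =ᶠ[𝓝 a] fun c => (extChartAt (totalModel B F) a c).1 := by
    filter_upwards [eventually_mem_baseSet (mem_baseSet (E := E) a.proj)] with c hc
    rw [extChartAt_total_apply a c hc]
  have h3 : HasMFDerivAt (totalModel B F) (modelWithCornersSelf ℝ B)
      (fun c => (extChartAt (totalModel B F) a c).1) a
      ((ContinuousLinearMap.fst ℝ B F).comp (ContinuousLinearMap.id ℝ (B × F))) := by
    have h4 : HasMFDerivAt (totalModel B F) (modelWithCornersSelf ℝ (B × F))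
      (extChartAt (totalModel B F) a) a (ContinuousLinearMap.id ℝ (B × F)) := by
      rw [← mfderiv_extChartAt_total a]
      exact (mdifferentiableAt_extChartAt (mem_chart_source _ _)).hasMFDerivAt
    exact (ContinuousLinearMap.fst ℝ B F).hasMFDerivAt.comp a h4
  rw [h2.mfderiv_eq, h3.mfderiv, mfderiv_extChartAt_self] at h1
  have := DFunLike.congr_fun h1 v
  exact this.symm

theorem mfderiv_fibreCoord_apply (a : TotalSpace F E) (v : TangentSpace (totalModel B F) a) :
    mfderiv (totalModel B F) (modelWithCornersSelf ℝ F) (fibreCoord F a.proj) a v =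
      (tangentCoord v).2 := by
  have h1E : IsManifold (totalModel B F) 1 (TotalSpace F E) := .of_le (n := ∞) (by simp)
  have h2 : (fibreCoord F a.proj : TotalSpace F E → F)
      =ᶠ[𝓝 a] fun c => (extChartAt (totalModel B F) a c).2 := by
    filter_upwards [eventually_mem_baseSet (mem_baseSet (E := E) a.proj)] with c hc
    rw [extChartAt_total_apply a c hc]
  have h3 : HasMFDerivAt (totalModel B F) (modelWithCornersSelf ℝ F)
      (fun c => (extChartAt (totalModel B F) a c).2) a
      ((ContinuousLinearMap.snd ℝ B F).comp (ContinuousLinearMap.id ℝ (B × F))) := by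
    have h4 : HasMFDerivAt (totalModel B F) (modelWithCornersSelf ℝ (B × F))
      (extChartAt (totalModel B F) a) a (ContinuousLinearMap.id ℝ (B × F)) := by
      rw [← mfderiv_extChartAt_total a]
      exact (mdifferentiableAt_extChartAt (mem_chart_source _ _)).hasMFDerivAt
    exact (ContinuousLinearMap.snd ℝ B F).hasMFDerivAt.comp a h4
  rw [h2.mfderiv_eq, h3.mfderiv]
  rfl

/-! ### Vertical vectors -/

/-- The straight line `t ↦ a + t b` in a fibre. -/
def fibreLine (a : TotalSpace F E) (b : E a.proj) (t : ℝ) : TotalSpace F E :=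
  ⟨a.proj, a.snd + t • b⟩

theorem fibreLine_zero (a : TotalSpace F E) (b : E a.proj) : fibreLine a b 0 = a := by
  simp [fibreLine]

theorem fibreCoord_fibreLine {x : M} {a : TotalSpace F E}
    (ha : a.proj ∈ (trivializationAt F E x).baseSet) (b : E a.proj) (t : ℝ) :
    fibreCoord F x (fibreLine a b t) =
      fibreCoord F x a + t • fibreCoord F x (⟨a.proj, b⟩ : TotalSpace F E) := by
  rw [fibreLine, fibreCoord_add ha, fibreCoord_smul ha]

theorem contMDiff_fibreLine (a : TotalSpace F E) (b : E a.proj) :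
    ContMDiff (modelWithCornersSelf ℝ ℝ) (totalModel B F) ∞ (fibreLine a b) := by
  intro t
  rw [contMDiffAt_iff_fibreCoord (x := a.proj) (mem_baseSet _)]
  refine ⟨contMDiffAt_const, ?_⟩
  simp only [fibreCoord_fibreLine (mem_baseSet (E := E) a.proj)]
  exact contMDiffAt_const.add (contMDiffAt_id.smul contMDiffAt_const)

/-- Chain rule along the fibre line. It reduces computations with vertical vectors to derivatives of
one real variable. -/
theorem mfderiv_vertVector {V N : Type*} [NormedAddCommGroup V] [NormedSpace ℝ V]
    {H : Type*} [TopologicalSpace H] {I : ModelWithCorners ℝ V H}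
    [TopologicalSpace N] [ChartedSpace H N]
    {f : TotalSpace F E → N} (a : TotalSpace F E) (b : E a.proj)
    (hf : MDifferentiableAt (totalModel B F) I f a) :
    (mfderiv (totalModel B F) I f a (vertVector a b) : V) =
      (mfderiv (modelWithCornersSelf ℝ ℝ) I
        (fun t => f (fibreLine a b t)) 0 (1 : ℝ) : V) := by
  have hγ := ((contMDiff_fibreLine (B := B) a b) 0).mdifferentiableAt (by simp)
  have h0 : fibreLine a b 0 = a := fibreLine_zero a b
  have hf' : MDifferentiableAt (totalModel B F) I f (fibreLine a b 0) := by
    rwa [h0]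
  have h1 := mfderiv_comp (I' := totalModel B F) (I'' := I) (0 : ℝ) hf' hγ
  -- The line at time 0 equals a only propositionally, so the two derivatives are compared as maps
  -- between model spaces.
  have h2 : ∀ c, c = a → (mfderiv (totalModel B F) I f c : B × F →L[ℝ] V)
      = (mfderiv (totalModel B F) I f a : B × F →L[ℝ] V) := by
    rintro c rfl; rfl
  have h3 := h2 _ h0
  have h4 := DFunLike.congr_fun h1 (1 : ℝ)
  refine Eq.trans ?_ h4.symm
  exact (DFunLike.congr_fun h3.symm _)

theorem mfderiv_real_eq_deriv {V : Type*} [NormedAddCommGroup V] [NormedSpace ℝ V] (g : ℝ → V)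
    (t : ℝ) : (mfderiv (modelWithCornersSelf ℝ ℝ) (modelWithCornersSelf ℝ V) g t (1 : ℝ) : V) =
      deriv g t := by
  rw [mfderiv_eq_fderiv]; rfl

theorem vertVector_eq (a : TotalSpace F E) (b : E a.proj) :
    tangentCoord (B := B) (vertVector a b) =
      (0, fibreCoord F a.proj (⟨a.proj, b⟩ : TotalSpace F E)) := by
  refine Prod.ext ?_ ?_
  · rw [← mfderiv_proj_apply a (vertVector a b)]
    refine (mfderiv_vertVector a b (mdifferentiableAt_proj a)).trans ?_
    have : (fun t => (fibreLine a b t).proj) = fun _ => a.proj := rfl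
    rw [this, mfderiv_const]
    rfl
  · rw [← mfderiv_fibreCoord_apply a (vertVector a b)]
    refine (mfderiv_vertVector a b (mdifferentiableAt_fibreCoord (mem_baseSet a.proj))).trans ?_
    rw [mfderiv_real_eq_deriv]
    simp only [fibreCoord_fibreLine (mem_baseSet (E := E) a.proj)]
    have := ((hasDerivAt_id (0 : ℝ)).smul_const
      (fibreCoord F a.proj (⟨a.proj, b⟩ : TotalSpace F E))).const_add (fibreCoord F a.proj a)
    exact this.deriv.trans (one_smul _ _)

theorem vertVector_smul (a : TotalSpace F E) (r : ℝ) (b : E a.proj) :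
    vertVector (B := B) a (r • b) = r • vertVector a b := by
  refine (vertVector_eq a (r • b)).trans (Eq.trans ?_
    (congrArg (fun v : B × F => r • v) (vertVector_eq a b)).symm)
  rw [fibreCoord_smul (mem_baseSet a.proj), Prod.smul_mk, smul_zero]

theorem vertVector_injective (a : TotalSpace F E) :
    Function.Injective (vertVector (B := B) a) := by
  intro b c h
  have h' := congrArg Prod.snd ((vertVector_eq a b).symm.trans (Eq.trans h (vertVector_eq a c)))
  exact (fibreEquiv F (mem_baseSet a.proj)).injective h'

theorem mfderiv_proj_vertVector (a : TotalSpace F E) (b : E a.proj) :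
    mfderiv (totalModel B F) (modelWithCornersSelf ℝ B) (TotalSpace.proj : TotalSpace F E → M)
      a (vertVector a b) = 0 :=
  (mfderiv_proj_apply (B := B) a _).trans (congrArg Prod.fst (vertVector_eq (B := B) a b))

theorem mfderiv_fibreCoord_vertVector {x : M} (a : TotalSpace F E)
    (ha : a.proj ∈ (trivializationAt F E x).baseSet) (b : E a.proj) :
    mfderiv (totalModel B F) (modelWithCornersSelf ℝ F) (fibreCoord F x)
      a (vertVector a b) = fibreCoord F x (⟨a.proj, b⟩ : TotalSpace F E) := by
  refine (mfderiv_vertVector a b (mdifferentiableAt_fibreCoord ha)).trans ?_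
  rw [mfderiv_real_eq_deriv]
  simp only [fibreCoord_fibreLine ha]
  have := ((hasDerivAt_id (0 : ℝ)).smul_const
    (fibreCoord F x (⟨a.proj, b⟩ : TotalSpace F E))).const_add (fibreCoord F x a)
  exact this.deriv.trans (one_smul _ _)

theorem exists_eq_vertVector {a : TotalSpace F E} (v : TangentSpace (totalModel B F) a)
    (hv : mfderiv (totalModel B F) (modelWithCornersSelf ℝ B)
      (TotalSpace.proj : TotalSpace F E → M) a v = 0) : ∃ b, v = vertVector a b := by
  obtain ⟨b, hb⟩ := (fibreEquiv (E := E) F (mem_baseSet a.proj)).surjective (tangentCoord v).2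
  refine ⟨b, ?_⟩
  rw [mfderiv_proj_apply] at hv
  refine Eq.trans ?_ (vertVector_eq a b).symm
  exact Prod.ext hv hb.symm

theorem mfderiv_proj_surjective (a : TotalSpace F E) :
    Function.Surjective (mfderiv (totalModel B F) (modelWithCornersSelf ℝ B)
      (TotalSpace.proj : TotalSpace F E → M) a) :=
  fun u => ⟨(show B from u, (0 : F)), mfderiv_proj_apply (B := B) a (show B from u, (0 : F))⟩

theorem vertVector_zero (a : TotalSpace F E) : vertVector (B := B) a 0 = 0 := by
  have := vertVector_smul (B := B) a 0 0
  rwa [zero_smul, zero_smul] at this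

/-! ### Vectors tangent to the constraint space -/

theorem mk_tangent_eq_iff {V H N : Type*} [NormedAddCommGroup V] [NormedSpace ℝ V]
    [TopologicalSpace H] {I : ModelWithCorners ℝ V H} [TopologicalSpace N] [ChartedSpace H N]
    {x y : N} {v : TangentSpace I x} {w : TangentSpace I y} :
    ((⟨x, v⟩ : TangentBundle I N) = ⟨y, w⟩) ↔ x = y ∧ (v : V) = (w : V) := by
  constructor
  · intro h
    cases h
    exact ⟨rfl, rfl⟩
  · rintro ⟨rfl, h⟩
    exact congrArg _ h

/-- Reading the velocity in the coordinates preferred at a removes the dependence of its type on γ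
0, so that curves can be modified freely. -/
theorem isTangent_iff {C : ConstrainedSystem B F E} {a : TotalSpace F E}
    {v : TangentSpace (totalModel B F) a} :
    C.IsTangent a v ↔ ∃ γ : ℝ → TotalSpace F E,
      ContMDiffAt (modelWithCornersSelf ℝ ℝ) (totalModel B F) ∞ γ 0 ∧
      (∀ᶠ t in 𝓝 (0 : ℝ), γ t ∈ C.space) ∧ γ 0 = a ∧
      (mfderiv (modelWithCornersSelf ℝ ℝ) (modelWithCornersSelf ℝ B)
        (fun t => (γ t).proj) 0 (1 : ℝ) : B) = (tangentCoord v).1 ∧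
      deriv (fun t => fibreCoord F a.proj (γ t)) 0 = (tangentCoord v).2 := by
  unfold ConstrainedSystem.IsTangent
  refine exists_congr fun γ => and_congr_right fun hγ => and_congr_right fun _ => ?_
  rw [mk_tangent_eq_iff]
  refine and_congr_right fun h0 => ?_
  subst h0
  have hd := hγ.mdifferentiableAt (by simp)
  have h1 := DFunLike.congr_fun (mfderiv_comp (0 : ℝ) (mdifferentiableAt_proj (γ 0)) hd) (1 : ℝ)
  have h2 := DFunLike.congr_fun (mfderiv_comp (0 : ℝ)
    (mdifferentiableAt_fibreCoord (mem_baseSet (γ 0).proj)) hd) (1 : ℝ)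
  have h1' := h1.trans (mfderiv_proj_apply (γ 0) _)
  have h2' := h2.trans (mfderiv_fibreCoord_apply (γ 0) _)
  rw [← mfderiv_real_eq_deriv]
  constructor
  · intro h
    exact ⟨h1'.trans (congrArg Prod.fst h), h2'.trans (congrArg Prod.snd h)⟩
  · rintro ⟨h3, h4⟩
    exact Prod.ext (h1'.symm.trans h3) (h2'.symm.trans h4)

/-- Functions that vanish on `D` have zero derivative along vectors tangent to `D`. -/
theorem ConstrainedSystem.IsTangent.mfderiv_eq_zero {C : ConstrainedSystem B F E}
    {a : TotalSpace F E} {v : TangentSpace (totalModel B F) a} (hv : C.IsTangent a v)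
    {V : Type*} [NormedAddCommGroup V] [NormedSpace ℝ V] {f : TotalSpace F E → V}
    (hf : MDifferentiableAt (totalModel B F) (modelWithCornersSelf ℝ V) f a)
    (h0 : ∀ᶠ c in 𝓝 a, c ∈ C.space → f c = 0) :
    (mfderiv (totalModel B F) (modelWithCornersSelf ℝ V) f a v : V) = 0 := by
  obtain ⟨γ, hγ, hC, h⟩ := hv
  rw [mk_tangent_eq_iff] at h
  obtain ⟨ha, h⟩ := h
  subst ha
  have hd := hγ.mdifferentiableAt (by simp)
  have h1 := DFunLike.congr_fun (mfderiv_comp (0 : ℝ) hf hd) (1 : ℝ)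
  have h2 : (f ∘ γ) =ᶠ[𝓝 0] fun _ => 0 := by
    filter_upwards [hC, hγ.continuousAt.eventually h0] with t h1 h2 using h2 h1
  rw [h2.mfderiv_eq, mfderiv_const] at h1
  refine Eq.trans ?_ h1.symm
  exact congrArg _ h.symm

/-- If γ in D has velocity v and κ is a local section of D through d, then γ + t κ(τ∘γ) stays in D,
and at t = 0 its velocity is v + d^V. The section κ is a constant combination of a local frame. -/
theorem ConstrainedSystem.IsTangent.add_vertVector {C : ConstrainedSystem B F E}
    {a : TotalSpace F E} {v : TangentSpace (totalModel B F) a} (hv : C.IsTangent a v)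
    {d : E a.proj} (hd : d ∈ C.D a.proj) : C.IsTangent a (v + vertVector a d) := by
  rw [isTangent_iff] at hv ⊢
  obtain ⟨γ, hγ, hC, h0, h1, h2⟩ := hv
  obtain ⟨U, k, s, hU, haU, hs, hsp⟩ := C.isSmoothSubbundle_D a.proj
  have hd' : d ∈ Submodule.span ℝ (Set.range fun i => s i a.proj) := by
    rwa [(hsp _ haU).2]
  obtain ⟨u, hu⟩ := (Submodule.mem_span_range_iff_exists_fun ℝ).1 hd'
  let κ : ∀ y, E y := fun y => ∑ i, u i • s i y
  have hκ : ContMDiffAt (modelWithCornersSelf ℝ B) (totalModel B F) ∞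
      (fun y => (⟨y, κ y⟩ : TotalSpace F E)) a.proj :=
    ContMDiffAt.sum_section fun i _ =>
      ContMDiffAt.const_smul_section ((hs i).contMDiffAt (hU.mem_nhds haU))
  have hκD : ∀ y ∈ U, κ y ∈ C.D y := fun y hy => by
    rw [← (hsp y hy).2]
    exact Submodule.sum_mem _ fun i _ => Submodule.smul_mem _ _ (Submodule.subset_span ⟨i, rfl⟩)
  have hb0 : (γ 0).proj ∈ (trivializationAt F E a.proj).baseSet := by
    rw [h0]; exact mem_baseSet _
  have hp : ContMDiffAt (modelWithCornersSelf ℝ ℝ) (modelWithCornersSelf ℝ B) ∞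
      (fun t => (γ t).proj) 0 := (contMDiffAt_iff_fibreCoord hb0).1 hγ |>.1
  have hκγ : ContMDiffAt (modelWithCornersSelf ℝ ℝ) (totalModel B F) ∞
      (fun t => (⟨(γ t).proj, κ (γ t).proj⟩ : TotalSpace F E)) 0 := by
    refine ContMDiffAt.comp (0 : ℝ) (g := fun y => (⟨y, κ y⟩ : TotalSpace F E)) ?_ hp
    rw [h0]; exact hκ
  have hκf := ((contMDiffAt_iff_fibreCoord (x := a.proj) (f := fun t =>
    (⟨(γ t).proj, κ (γ t).proj⟩ : TotalSpace F E)) hb0).1 hκγ).2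
  have hγf := ((contMDiffAt_iff_fibreCoord (x := a.proj) hb0).1 hγ).2
  have hbs : ∀ᶠ t in 𝓝 (0 : ℝ), (γ t).proj ∈ (trivializationAt F E a.proj).baseSet :=
    hp.continuousAt.eventually ((trivializationAt F E a.proj).open_baseSet.mem_nhds hb0)
  have heq : (fun t => fibreCoord F a.proj
      (⟨(γ t).proj, (γ t).snd + t • κ (γ t).proj⟩ : TotalSpace F E)) =ᶠ[𝓝 0]
      fun t => fibreCoord F a.proj (γ t) +
        t • fibreCoord F a.proj (⟨(γ t).proj, κ (γ t).proj⟩ : TotalSpace F E) := by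
    filter_upwards [hbs] with t ht
    rw [fibreCoord_add ht, fibreCoord_smul ht]
  refine ⟨fun t => ⟨(γ t).proj, (γ t).snd + t • κ (γ t).proj⟩, ?_, ?_, ?_, ?_, ?_⟩
  · refine (contMDiffAt_iff_fibreCoord (x := a.proj) (f := fun t =>
      (⟨(γ t).proj, (γ t).snd + t • κ (γ t).proj⟩ : TotalSpace F E)) hb0).2 ⟨hp, ?_⟩
    exact ContMDiffAt.congr_of_eventuallyEq (hγf.add (contMDiffAt_id.smul hκf)) heq
  · have hUn : ∀ᶠ t in 𝓝 (0 : ℝ), (γ t).proj ∈ U :=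
      hp.continuousAt.eventually (hU.mem_nhds (show (γ 0).proj ∈ U by rw [h0]; exact haU))
    filter_upwards [hC, hUn] with t ht hUt
    exact (C.D _).add_mem ht ((C.D _).smul_mem _ (hκD _ hUt))
  · simpa using h0
  · refine h1.trans ?_
    have := congrArg Prod.fst (vertVector_eq (B := B) a d)
    exact ((congrArg (fun w => (tangentCoord v).1 + w) this).trans (add_zero _)).symm
  · rw [heq.deriv_eq]
    have e1 := (hγf.contDiffAt.differentiableAt (by simp)).hasDerivAt
    have e2 := (hκf.contDiffAt.differentiableAt (by simp)).hasDerivAt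
    have e3 := e1.add ((hasDerivAt_id (0 : ℝ)).smul e2)
    refine e3.deriv.trans ?_
    rw [h2]
    have e4 : fibreCoord F a.proj (⟨(γ 0).proj, κ (γ 0).proj⟩ : TotalSpace F E) =
        fibreCoord F a.proj (⟨a.proj, d⟩ : TotalSpace F E) := by
      rw [h0, ← hu]
    have e5 := congrArg Prod.snd (vertVector_eq (B := B) a d)
    have e6 : (tangentCoord v).2 + fibreCoord F a.proj (⟨a.proj, d⟩ : TotalSpace F E) =
        (tangentCoord (v + vertVector a d)).2 :=
      (congrArg (fun w => (tangentCoord v).2 + w) e5).symm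
    refine Eq.trans ?_ e6
    rw [e4, id, zero_smul, zero_add, one_smul]

/-! ### Local sections and fields, and extension to projectable sections -/

/-- A smooth function on a manifold which is `1` near a point and supported in a given
neighbourhood. -/
theorem exists_bump {V H N : Type*} [NormedAddCommGroup V] [NormedSpace ℝ V]
    [FiniteDimensional ℝ V] [TopologicalSpace H] {I : ModelWithCorners ℝ V H}
    [TopologicalSpace N] [ChartedSpace H N] [T2Space N] [IsManifold I ∞ N] {x : N} {U : Set N}
    (hU : U ∈ 𝓝 x) : ∃ f : N → ℝ, ContMDiff I (modelWithCornersSelf ℝ ℝ) ∞ f ∧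
      f =ᶠ[𝓝 x] 1 ∧ tsupport f ⊆ U := by
  obtain ⟨f, -, hf⟩ := (SmoothBumpFunction.nhds_basis_tsupport (I := I) x).mem_iff.1 hU
  exact ⟨f, f.contMDiff, f.eventuallyEq_one, hf⟩

/-- The local section with constant fibre coordinate. -/
def constSection (E : M → Type*) [TopologicalSpace (TotalSpace F E)]
    [∀ x, AddCommGroup (E x)] [∀ x, TopologicalSpace (E x)] [FiberBundle F E]
    (x : M) (w : F) (y : M) : E y :=
  (trivializationAt F E x).symm y w

theorem fibreCoord_constSection {x y : M} (hy : y ∈ (trivializationAt F E x).baseSet) (w : F) :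
    fibreCoord F x (⟨y, constSection E x w y⟩ : TotalSpace F E) = w := by
  unfold fibreCoord constSection
  rw [(trivializationAt F E x).apply_mk_symm hy]

theorem contMDiffOn_constSection (x : M) (w : F) :
    ContMDiffOn (modelWithCornersSelf ℝ B) (totalModel B F) ∞
      (fun y => (⟨y, constSection E x w y⟩ : TotalSpace F E))
      (trivializationAt F E x).baseSet := by
  refine ((trivializationAt F E x).contMDiffOn_section_baseSet_iff).2 ?_
  exact (contMDiffOn_const (c := w)).congr fun y hy => fibreCoord_constSection hy w

theorem eq_of_fibreCoord_eq {x y : M} (hy : y ∈ (trivializationAt F E x).baseSet) {b c : E y}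
    (h : fibreCoord F x (⟨y, b⟩ : TotalSpace F E) = fibreCoord F x (⟨y, c⟩ : TotalSpace F E)) :
    b = c :=
  (fibreEquiv F hy).injective h

theorem chart_total_source (a : TotalSpace F E) :
    (chartAt (ModelProd B F) a).source = TotalSpace.proj ⁻¹'
      ((trivializationAt F E a.proj).baseSet ∩ (chartAt B a.proj).source) := by
  rw [FiberBundle.chartedSpace_chartAt]
  ext c
  simp only [mfld_simps, mem_inter_iff, mem_preimage, Bundle.Trivialization.mem_source]
  refine and_congr_right fun hc => ?_
  rw [(trivializationAt F E a.proj).coe_fst' hc]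

theorem hasMFDerivAt_prodMk_space {V H N W₁ W₂ : Type*} [NormedAddCommGroup V] [NormedSpace ℝ V]
    [TopologicalSpace H] {I : ModelWithCorners ℝ V H} [TopologicalSpace N] [ChartedSpace H N]
    [NormedAddCommGroup W₁] [NormedSpace ℝ W₁] [NormedAddCommGroup W₂] [NormedSpace ℝ W₂]
    {f : N → W₁} {g : N → W₂} {x : N} {f' : TangentSpace I x →L[ℝ] W₁}
    {g' : TangentSpace I x →L[ℝ] W₂} (hf : HasMFDerivAt I (modelWithCornersSelf ℝ W₁) f x f')
    (hg : HasMFDerivAt I (modelWithCornersSelf ℝ W₂) g x g') :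
    HasMFDerivAt I (modelWithCornersSelf ℝ (W₁ × W₂)) (fun y => (f y, g y)) x (f'.prod g') :=
  ⟨hf.1.prodMk hg.1, hf.2.prodMk hg.2⟩

/-- Away from the centre of the chart the derivative is no longer the identity, but it still splits
into a base part and a fibre part. -/
theorem mfderiv_extChartAt_total_apply {a c : TotalSpace F E}
    (hc : c ∈ (chartAt (ModelProd B F) a).source) (v : TangentSpace (totalModel B F) c) :
    (mfderiv (totalModel B F) (modelWithCornersSelf ℝ (B × F)) (extChartAt (totalModel B F) a)
      c v : B × F) =
    (mfderiv (modelWithCornersSelf ℝ B) (modelWithCornersSelf ℝ B)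
        (extChartAt (modelWithCornersSelf ℝ B) a.proj) c.proj
        (mfderiv (totalModel B F) (modelWithCornersSelf ℝ B)
          (TotalSpace.proj : TotalSpace F E → M) c v),
      mfderiv (totalModel B F) (modelWithCornersSelf ℝ F) (fibreCoord F a.proj) c v) := by
  have h1M : IsManifold (modelWithCornersSelf ℝ B) 1 M := .of_le (n := ∞) (by simp)
  have hc' := hc
  rw [chart_total_source] at hc'
  have h1 : HasMFDerivAt (totalModel B F) (modelWithCornersSelf ℝ B)
      (fun c : TotalSpace F E => extChartAt (modelWithCornersSelf ℝ B) a.proj (c.proj)) c _ :=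
    (mdifferentiableAt_extChartAt (I := modelWithCornersSelf ℝ B) hc'.2).hasMFDerivAt.comp c
      (mdifferentiableAt_proj c).hasMFDerivAt
  have h2 := hasMFDerivAt_prodMk_space h1 (mdifferentiableAt_fibreCoord hc'.1).hasMFDerivAt
  have h3 : (extChartAt (totalModel B F) a : TotalSpace F E → B × F) =ᶠ[𝓝 c] fun c =>
      (extChartAt (modelWithCornersSelf ℝ B) a.proj c.proj, fibreCoord F a.proj c) := by
    filter_upwards [eventually_mem_baseSet hc'.1] with c hc
    exact extChartAt_total_apply a c hc
  rw [h3.mfderiv_eq, h2.mfderiv]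
  rfl

/-- The local vector field with constant coordinates in a chart. -/
def chartField {V N : Type*} [NormedAddCommGroup V] [NormedSpace ℝ V]
    {H : Type*} [TopologicalSpace H] (I : ModelWithCorners ℝ V H)
    [TopologicalSpace N] [ChartedSpace H N] [IsManifold I 1 N] (a c : N) (v : V) :
    TangentSpace I c :=
  (trivializationAt V (TangentSpace I) a).symm c v

theorem mfderiv_chartField {V N : Type*} [NormedAddCommGroup V] [NormedSpace ℝ V]
    {H : Type*} [TopologicalSpace H] {I : ModelWithCorners ℝ V H}
    [TopologicalSpace N] [ChartedSpace H N] [IsManifold I 1 N] {a c : N}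
    (hc : c ∈ (chartAt H a).source) (v : V) :
    (mfderiv I (modelWithCornersSelf ℝ V) (extChartAt I a) c (chartField I a c v) : V) = v := by
  rw [← TangentBundle.continuousLinearMapAt_trivializationAt hc]
  have h := (trivializationAt V (TangentSpace I : N → Type _) a).continuousLinearMapAt_symmL
    (R := ℝ) (b := c) hc v
  rw [Bundle.Trivialization.symmL_apply _ hc] at h
  exact h

theorem mfderiv_extChartAt_injective {V N : Type*} [NormedAddCommGroup V] [NormedSpace ℝ V]
    {H : Type*} [TopologicalSpace H] {I : ModelWithCorners ℝ V H}
    [TopologicalSpace N] [ChartedSpace H N] [IsManifold I 1 N] {a c : N}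
    (hc : c ∈ (chartAt H a).source) :
    Function.Injective (mfderiv I (modelWithCornersSelf ℝ V) (extChartAt I a) c) := by
  rw [← extChartAt_source I] at hc
  exact (isInvertible_mfderiv_extChartAt hc).injective

theorem trivializationAt_tangent_snd {V N : Type*} [NormedAddCommGroup V] [NormedSpace ℝ V]
    {H : Type*} [TopologicalSpace H] {I : ModelWithCorners ℝ V H}
    [TopologicalSpace N] [ChartedSpace H N] [IsManifold I 1 N] {a c : N}
    (hc : c ∈ (chartAt H a).source) (v : TangentSpace I c) :
    (trivializationAt V (TangentSpace I) a (⟨c, v⟩ : TangentBundle I N)).2 =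
      (mfderiv I (modelWithCornersSelf ℝ V) (extChartAt I a) c v : V) := by
  rw [← TangentBundle.continuousLinearMapAt_trivializationAt hc]
  exact (Bundle.Trivialization.continuousLinearMapAt_apply_of_mem (R := ℝ) _ hc v).symm

theorem contMDiffOn_tangent_iff {V N : Type*} [NormedAddCommGroup V] [NormedSpace ℝ V]
    {H : Type*} [TopologicalSpace H] {I : ModelWithCorners ℝ V H}
    [TopologicalSpace N] [ChartedSpace H N] [IsManifold I ∞ N] [IsManifold I 1 N] {a : N}
    {X : ∀ c, TangentSpace I c} {U : Set N} (hU : IsOpen U) (hUa : U ⊆ (chartAt H a).source) :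
    ContMDiffOn I I.tangent ∞ (fun c => (⟨c, X c⟩ : TangentBundle I N)) U ↔
      ContMDiffOn I (modelWithCornersSelf ℝ V) ∞
        (fun c => (mfderiv I (modelWithCornersSelf ℝ V) (extChartAt I a) c (X c) : V)) U := by
  rw [(trivializationAt V (TangentSpace I : N → Type _) a).contMDiffOn_section_iff hU hUa]
  exact contMDiffOn_congr fun c hc => trivializationAt_tangent_snd (hUa hc) (X c)

/-- Take a section s with constant fibre coordinate, and a vector field whose chart coordinates are
those of ρ(s) on the base and constant along the fibre. Multiplying both by the same cutoff pulled
back from M keeps the pair projectable. -/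
theorem exists_projectableSection [FiniteDimensional ℝ B] [T2Space M] (A : LieAlgebroid B F E)
    {a : TotalSpace F E} {z : Pair B a} (hz : z ∈ prolongation A a) :
    ∃ Z : ProjectableSection A, Z.val a = z := by
  have h1M : IsManifold (modelWithCornersSelf ℝ B) 1 M := .of_le (n := ∞) (by simp)
  have h1E : IsManifold (totalModel B F) 1 (TotalSpace F E) := .of_le (n := ∞) (by simp)
  set x := a.proj with hx
  set U := (trivializationAt F E x).baseSet ∩ (chartAt B x).source with hUdef
  have hU : IsOpen U := (trivializationAt F E x).open_baseSet.inter (chartAt B x).open_source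
  have hxU : x ∈ U := ⟨mem_baseSet x, mem_chart_source B x⟩
  have hsrc : (chartAt (ModelProd B F) a).source = TotalSpace.proj ⁻¹' U := chart_total_source a
  obtain ⟨f, hf, hf1, hfs⟩ := exists_bump (I := modelWithCornersSelf ℝ B) (hU.mem_nhds hxU)
  set s : ∀ y, E y := constSection E x (fibreCoord F x (⟨x, z.1⟩ : TotalSpace F E)) with hs
  have hsU : ContMDiffOn (modelWithCornersSelf ℝ B) (totalModel B F) ∞
      (fun y => (⟨y, s y⟩ : TotalSpace F E)) U :=
    (contMDiffOn_constSection x _).mono inter_subset_left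
  have hsx : s x = z.1 := eq_of_fibreCoord_eq (mem_baseSet x)
    (fibreCoord_constSection (mem_baseSet x) _)
  let u : M → B := fun y => mfderiv (modelWithCornersSelf ℝ B) (modelWithCornersSelf ℝ B)
    (extChartAt (modelWithCornersSelf ℝ B) x) y (A.anchor y (s y))
  have hu : ContMDiffOn (modelWithCornersSelf ℝ B) (modelWithCornersSelf ℝ B) ∞ u U := by
    refine (contMDiffOn_tangent_iff (X := fun y => A.anchor y (s y)) hU inter_subset_right).1 ?_
    exact A.contMDiff_anchor.comp_contMDiffOn hsU
  let X : ∀ c : TotalSpace F E, TangentSpace (totalModel B F) c := fun c =>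
    chartField (totalModel B F) a c (u c.proj, (tangentCoord z.2).2)
  have hsrcO : IsOpen (chartAt (ModelProd B F) a).source := (chartAt (ModelProd B F) a).open_source
  have hX : ContMDiffOn (totalModel B F) (totalModel B F).tangent ∞
      (fun c => (⟨c, X c⟩ : TangentBundle (totalModel B F) (TotalSpace F E)))
      (chartAt (ModelProd B F) a).source := by
    refine (contMDiffOn_tangent_iff hsrcO Subset.rfl).2 ?_
    refine ContMDiffOn.congr (f := fun c => (u c.proj, (tangentCoord z.2).2)) ?_
      fun c hc => mfderiv_chartField hc _
    refine ContMDiffOn.prodMk_space ?_ contMDiffOn_const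
    exact hu.comp (contMDiff_proj E).contMDiffOn (by rw [hsrc])
  have hXp : ∀ c ∈ (chartAt (ModelProd B F) a).source,
      mfderiv (totalModel B F) (modelWithCornersSelf ℝ B)
        (TotalSpace.proj : TotalSpace F E → M) c (X c) = A.anchor c.proj (s c.proj) := by
    intro c hc
    have h1 := (mfderiv_extChartAt_total_apply hc (X c)).symm.trans (mfderiv_chartField hc _)
    have hc' := hc
    rw [hsrc] at hc'
    exact mfderiv_extChartAt_injective hc'.2 (congrArg Prod.fst h1)
  have hXa : X a = z.2 := by
    refine mfderiv_extChartAt_injective (I := totalModel B F) (mem_chart_source _ a) ?_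
    refine (mfderiv_chartField (mem_chart_source _ a) _).trans ?_
    have e1 : (u a.proj : B) = (tangentCoord z.2).1 := by
      change (mfderiv (modelWithCornersSelf ℝ B) (modelWithCornersSelf ℝ B)
        (extChartAt (modelWithCornersSelf ℝ B) x) x (A.anchor x (s x)) : B) = _
      rw [hsx, mfderiv_extChartAt_self, ← mfderiv_proj_apply]
      exact hz
    rw [e1]
    exact (DFunLike.congr_fun (mfderiv_extChartAt_total a) z.2).symm
  have hts : tsupport (fun c : TotalSpace F E => f c.proj) ⊆
      (chartAt (ModelProd B F) a).source := by
    rw [hsrc]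
    exact (tsupport_comp_subset_preimage f (FiberBundle.continuous_proj F E)).trans
      (preimage_mono hfs)
  refine ⟨⟨⟨fun y => f y • s y, ContMDiffOn.smul_section_of_tsupport hf.contMDiffOn hU hfs hsU⟩,
    fun c => f c.proj • X c, ContMDiffOn.smul_section_of_tsupport
      (hf.comp (contMDiff_proj E)).contMDiffOn hsrcO hts hX, ?_⟩, ?_⟩
  · intro c
    change A.anchor c.proj (f c.proj • s c.proj) = mfderiv (totalModel B F)
      (modelWithCornersSelf ℝ B) (TotalSpace.proj : TotalSpace F E → M) c (f c.proj • X c)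
    rw [map_smul, map_smul]
    by_cases hc : c ∈ (chartAt (ModelProd B F) a).source
    · rw [hXp c hc]
    · have : f c.proj = 0 := image_eq_zero_of_notMem_tsupport
        (f := fun c : TotalSpace F E => f c.proj) fun h => hc (hts h)
      rw [this, zero_smul, zero_smul]
  · refine Prod.ext ?_ ?_
    · change f x • s x = z.1
      rw [hf1.self_of_nhds, Pi.one_apply, one_smul, hsx]
    · change f x • X a = z.2
      rw [hf1.self_of_nhds, Pi.one_apply, one_smul, hXa]

/-! ### Fibre derivative and fibre Hessian of a Lagrangian -/

/-- A function on the total space, read in the chart at `a₀`. -/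
def chartRep (B : Type*) [NormedAddCommGroup B] [NormedSpace ℝ B]
    {M : Type*} [TopologicalSpace M] [ChartedSpace B M]
    {F : Type*} [NormedAddCommGroup F] [NormedSpace ℝ F]
    {E : M → Type*} [TopologicalSpace (TotalSpace F E)]
    [∀ x, TopologicalSpace (E x)] [FiberBundle F E]
    (L : TotalSpace F E → ℝ) (a₀ : TotalSpace F E) : B × F → ℝ :=
  L ∘ (extChartAt (totalModel B F) a₀).symm

/-- The fibre derivative of `L` in the chart at `a₀`. -/
def fibreDeriv (B : Type*) [NormedAddCommGroup B] [NormedSpace ℝ B]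
    {M : Type*} [TopologicalSpace M] [ChartedSpace B M]
    {F : Type*} [NormedAddCommGroup F] [NormedSpace ℝ F]
    {E : M → Type*} [TopologicalSpace (TotalSpace F E)]
    [∀ x, TopologicalSpace (E x)] [FiberBundle F E]
    (L : TotalSpace F E → ℝ) (a₀ c : TotalSpace F E) : F →L[ℝ] ℝ :=
  (fderiv ℝ (chartRep B L a₀) (extChartAt (totalModel B F) a₀ c)).comp
    (ContinuousLinearMap.inr ℝ B F)

/-- The fibre Hessian of `L` in the chart at `a₀`. -/
def fibreHess (B : Type*) [NormedAddCommGroup B] [NormedSpace ℝ B]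
    {M : Type*} [TopologicalSpace M] [ChartedSpace B M]
    {F : Type*} [NormedAddCommGroup F] [NormedSpace ℝ F]
    {E : M → Type*} [TopologicalSpace (TotalSpace F E)]
    [∀ x, TopologicalSpace (E x)] [FiberBundle F E]
    (L : TotalSpace F E → ℝ) (a₀ c : TotalSpace F E) : F →L[ℝ] F →L[ℝ] ℝ :=
  ((ContinuousLinearMap.compL ℝ F (B × F) ℝ).flip (ContinuousLinearMap.inr ℝ B F)).comp
    ((fderiv ℝ (fderiv ℝ (chartRep B L a₀)) (extChartAt (totalModel B F) a₀ c)).comp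
      (ContinuousLinearMap.inr ℝ B F))

/-- The Hessian of `L` along the fibres: `∂²/∂s∂t L(a + s d + t b)` at `s = t = 0`. -/
def vertHess (L : TotalSpace F E → ℝ) (a : TotalSpace F E) (d b : E a.proj) : ℝ :=
  deriv (fun s => deriv (fun t => L (fibreLine (fibreLine a d s) b t)) 0) 0

theorem fibreLine_mem_source {a₀ c : TotalSpace F E}
    (hc : c ∈ (chartAt (ModelProd B F) a₀).source) (b : E c.proj) (t : ℝ) :
    fibreLine c b t ∈ (chartAt (ModelProd B F) a₀).source := by
  rw [chart_total_source] at hc ⊢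
  exact hc

theorem extChartAt_fibreLine {a₀ c : TotalSpace F E}
    (hc : c ∈ (chartAt (ModelProd B F) a₀).source) (b : E c.proj) (t : ℝ) :
    extChartAt (totalModel B F) a₀ (fibreLine c b t) = extChartAt (totalModel B F) a₀ c +
      t • ((0 : B), fibreCoord F a₀.proj (⟨c.proj, b⟩ : TotalSpace F E)) := by
  rw [chart_total_source] at hc
  rw [extChartAt_total_apply _ _ hc.1, extChartAt_total_apply a₀ (fibreLine c b t) hc.1,
    fibreCoord_fibreLine hc.1]
  simp [fibreLine]

theorem chartRep_contDiffAt {L : TotalSpace F E → ℝ}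
    (hL : ContMDiff (totalModel B F) (modelWithCornersSelf ℝ ℝ) ∞ L) {a₀ c : TotalSpace F E}
    (hc : c ∈ (chartAt (ModelProd B F) a₀).source) :
    ContDiffAt ℝ ∞ (chartRep B L a₀) (extChartAt (totalModel B F) a₀ c) := by
  rw [← contMDiffAt_iff_contDiffAt]
  have h : extChartAt (totalModel B F) a₀ c ∈ (extChartAt (totalModel B F) a₀).target :=
    (extChartAt (totalModel B F) a₀).map_source (by rwa [extChartAt_source])
  exact hL.contMDiffAt.comp _
    ((contMDiffOn_extChartAt_symm a₀).contMDiffAt (extChartAt_target_mem_nhds' h))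

theorem contMDiffOn_extChartAt_total (a₀ : TotalSpace F E) :
    ContMDiffOn (totalModel B F) (modelWithCornersSelf ℝ (B × F)) ∞
      (extChartAt (totalModel B F) a₀) (chartAt (ModelProd B F) a₀).source :=
  contMDiffOn_extChartAt

theorem contMDiffOn_fibreDeriv {L : TotalSpace F E → ℝ}
    (hL : ContMDiff (totalModel B F) (modelWithCornersSelf ℝ ℝ) ∞ L) (a₀ : TotalSpace F E) :
    ContMDiffOn (totalModel B F) (modelWithCornersSelf ℝ (F →L[ℝ] ℝ)) ∞ (fibreDeriv B L a₀)
      (chartAt (ModelProd B F) a₀).source := by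
  intro c hc
  have h1 : ContDiffAt ℝ ∞ (fun y : B × F => (fderiv ℝ (chartRep B L a₀) y).comp
      (ContinuousLinearMap.inr ℝ B F)) (extChartAt (totalModel B F) a₀ c) :=
    ((chartRep_contDiffAt hL hc).fderiv_right (m := ∞) (by simp)).clm_comp contDiffAt_const
  exact h1.contMDiffAt.comp_contMDiffWithinAt c (contMDiffOn_extChartAt_total a₀ c hc)

theorem contMDiffOn_fibreHess {L : TotalSpace F E → ℝ}
    (hL : ContMDiff (totalModel B F) (modelWithCornersSelf ℝ ℝ) ∞ L) (a₀ : TotalSpace F E) :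
    ContMDiffOn (totalModel B F) (modelWithCornersSelf ℝ (F →L[ℝ] F →L[ℝ] ℝ)) ∞
      (fibreHess B L a₀) (chartAt (ModelProd B F) a₀).source := by
  intro c hc
  have h1 : ContDiffAt ℝ ∞ (fun y : B × F =>
      ((ContinuousLinearMap.compL ℝ F (B × F) ℝ).flip (ContinuousLinearMap.inr ℝ B F)).comp
      ((fderiv ℝ (fderiv ℝ (chartRep B L a₀)) y).comp (ContinuousLinearMap.inr ℝ B F)))
      (extChartAt (totalModel B F) a₀ c) :=
    contDiffAt_const.clm_comp ((((chartRep_contDiffAt hL hc).fderiv_right (m := ∞)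
      (by simp)).fderiv_right (m := ∞) (by simp)).clm_comp contDiffAt_const)
  exact h1.contMDiffAt.comp_contMDiffWithinAt c (contMDiffOn_extChartAt_total a₀ c hc)

theorem dirDeriv_vertVector {L : TotalSpace F E → ℝ}
    (hL : ContMDiff (totalModel B F) (modelWithCornersSelf ℝ ℝ) ∞ L) (c : TotalSpace F E)
    (b : E c.proj) :
    dirDeriv (totalModel B F) L c (vertVector c b) = deriv (fun t => L (fibreLine c b t)) 0 :=
  (mfderiv_vertVector c b (hL.contMDiffAt.mdifferentiableAt (by simp))).trans
    (mfderiv_real_eq_deriv _ _)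

theorem hasDerivAt_fibreLine {L : TotalSpace F E → ℝ}
    (hL : ContMDiff (totalModel B F) (modelWithCornersSelf ℝ ℝ) ∞ L) {a₀ c : TotalSpace F E}
    (hc : c ∈ (chartAt (ModelProd B F) a₀).source) (b : E c.proj) :
    HasDerivAt (fun t => L (fibreLine c b t))
      (fibreDeriv B L a₀ c (fibreCoord F a₀.proj (⟨c.proj, b⟩ : TotalSpace F E))) 0 := by
  set w : B × F := (0, fibreCoord F a₀.proj (⟨c.proj, b⟩ : TotalSpace F E)) with hw
  have h1 : (fun t => L (fibreLine c b t)) =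
      fun t => chartRep B L a₀ (extChartAt (totalModel B F) a₀ c + t • w) := by
    funext t
    rw [hw, ← extChartAt_fibreLine hc, chartRep, Function.comp_apply,
      (extChartAt (totalModel B F) a₀).left_inv]
    rw [extChartAt_source]
    exact fibreLine_mem_source hc b t
  rw [h1]
  have h2 : HasDerivAt (fun t : ℝ => extChartAt (totalModel B F) a₀ c + t • w) w 0 := by
    simpa using ((hasDerivAt_id (0 : ℝ)).smul_const w).const_add
      (extChartAt (totalModel B F) a₀ c)
  have h3 : HasFDerivAt (chartRep B L a₀)
      (fderiv ℝ (chartRep B L a₀) (extChartAt (totalModel B F) a₀ c))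
      (extChartAt (totalModel B F) a₀ c + (0 : ℝ) • w) := by
    rw [zero_smul, add_zero]
    exact ((chartRep_contDiffAt hL hc).differentiableAt (by simp)).hasFDerivAt
  exact h3.comp_hasDerivAt (0 : ℝ) h2

theorem dirDeriv_vertVector_eq_fibreDeriv {L : TotalSpace F E → ℝ}
    (hL : ContMDiff (totalModel B F) (modelWithCornersSelf ℝ ℝ) ∞ L) {a₀ c : TotalSpace F E}
    (hc : c ∈ (chartAt (ModelProd B F) a₀).source) (b : E c.proj) :
    dirDeriv (totalModel B F) L c (vertVector c b) =
      fibreDeriv B L a₀ c (fibreCoord F a₀.proj (⟨c.proj, b⟩ : TotalSpace F E)) :=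
  (dirDeriv_vertVector hL c b).trans (hasDerivAt_fibreLine hL hc b).deriv

theorem hasDerivAt_fibreDeriv_fibreLine {L : TotalSpace F E → ℝ}
    (hL : ContMDiff (totalModel B F) (modelWithCornersSelf ℝ ℝ) ∞ L) {a₀ c : TotalSpace F E}
    (hc : c ∈ (chartAt (ModelProd B F) a₀).source) (d : E c.proj) :
    HasDerivAt (fun s => fibreDeriv B L a₀ (fibreLine c d s))
      (fibreHess B L a₀ c (fibreCoord F a₀.proj (⟨c.proj, d⟩ : TotalSpace F E))) 0 := by
  set w : B × F := (0, fibreCoord F a₀.proj (⟨c.proj, d⟩ : TotalSpace F E)) with hw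
  have h1 : (fun s => fibreDeriv B L a₀ (fibreLine c d s)) = fun s : ℝ =>
      (ContinuousLinearMap.compL ℝ F (B × F) ℝ).flip (ContinuousLinearMap.inr ℝ B F)
        (fderiv ℝ (chartRep B L a₀) (extChartAt (totalModel B F) a₀ c + s • w)) := by
    funext s
    rw [fibreDeriv, extChartAt_fibreLine hc]
    rfl
  rw [h1]
  have h2 : HasDerivAt (fun t : ℝ => extChartAt (totalModel B F) a₀ c + t • w) w 0 := by
    simpa using ((hasDerivAt_id (0 : ℝ)).smul_const w).const_add
      (extChartAt (totalModel B F) a₀ c)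
  have h3 : HasFDerivAt (fderiv ℝ (chartRep B L a₀))
      (fderiv ℝ (fderiv ℝ (chartRep B L a₀)) (extChartAt (totalModel B F) a₀ c))
      (extChartAt (totalModel B F) a₀ c + (0 : ℝ) • w) := by
    rw [zero_smul, add_zero]
    exact (((chartRep_contDiffAt hL hc).fderiv_right (m := ∞) (by simp)).differentiableAt
      (by simp)).hasFDerivAt
  exact (((ContinuousLinearMap.compL ℝ F (B × F) ℝ).flip
    (ContinuousLinearMap.inr ℝ B F)).hasFDerivAt.comp_hasDerivAt (0 : ℝ)
      (h3.comp_hasDerivAt (0 : ℝ) h2))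

theorem mfderiv_fibreDeriv_vertVector {L : TotalSpace F E → ℝ}
    (hL : ContMDiff (totalModel B F) (modelWithCornersSelf ℝ ℝ) ∞ L) {a₀ c : TotalSpace F E}
    (hc : c ∈ (chartAt (ModelProd B F) a₀).source) (d : E c.proj) :
    (mfderiv (totalModel B F) (modelWithCornersSelf ℝ (F →L[ℝ] ℝ)) (fibreDeriv B L a₀) c
      (vertVector c d) : F →L[ℝ] ℝ) =
      fibreHess B L a₀ c (fibreCoord F a₀.proj (⟨c.proj, d⟩ : TotalSpace F E)) := by
  have h := ((contMDiffOn_fibreDeriv hL a₀).contMDiffAt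
    ((chartAt (ModelProd B F) a₀).open_source.mem_nhds hc)).mdifferentiableAt (by simp)
  exact (mfderiv_vertVector c d h).trans ((mfderiv_real_eq_deriv _ _).trans
    (hasDerivAt_fibreDeriv_fibreLine hL hc d).deriv)

/-- Links the two descriptions of the Hessian: the one by lines is intrinsic and behaves well under
bundle maps, the one in a chart is visibly bilinear and smooth in the base point. -/
theorem vertHess_eq {L : TotalSpace F E → ℝ}
    (hL : ContMDiff (totalModel B F) (modelWithCornersSelf ℝ ℝ) ∞ L) {a₀ c : TotalSpace F E}
    (hc : c ∈ (chartAt (ModelProd B F) a₀).source) (d b : E c.proj) :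
    vertHess L c d b =
      fibreHess B L a₀ c (fibreCoord F a₀.proj (⟨c.proj, d⟩ : TotalSpace F E))
        (fibreCoord F a₀.proj (⟨c.proj, b⟩ : TotalSpace F E)) := by
  have h1 : (fun s => deriv (fun t => L (fibreLine (fibreLine c d s) b t)) 0) = fun s =>
      fibreDeriv B L a₀ (fibreLine c d s)
        (fibreCoord F a₀.proj (⟨c.proj, b⟩ : TotalSpace F E)) := by
    funext s
    exact (hasDerivAt_fibreLine hL (fibreLine_mem_source hc d s) b).deriv
  rw [vertHess, h1]
  have h2 := (hasDerivAt_fibreDeriv_fibreLine hL hc d).clm_apply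
    (hasDerivAt_const (0 : ℝ) (fibreCoord F a₀.proj (⟨c.proj, b⟩ : TotalSpace F E)))
  simpa using h2.deriv

theorem vertHess_zero_left {L : TotalSpace F E → ℝ}
    (hL : ContMDiff (totalModel B F) (modelWithCornersSelf ℝ ℝ) ∞ L) (c : TotalSpace F E)
    (b : E c.proj) : vertHess L c 0 b = 0 := by
  rw [vertHess_eq hL (mem_chart_source (ModelProd B F) c),
    ← fibreEquiv_apply (mem_baseSet c.proj), map_zero, map_zero]
  rfl

/-! ### Coordinate one-forms and their differentials -/

/-- The `1`-form `f · (p ∘ e)`, where `e` is the fibre coordinate at `x₀`. -/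
def coordForm (E : M → Type*) [TopologicalSpace (TotalSpace F E)]
    [∀ x, AddCommGroup (E x)] [∀ x, Module ℝ (E x)] [∀ x, TopologicalSpace (E x)]
    [FiberBundle F E] [VectorBundle ℝ F E] (x₀ : M) (f : M → ℝ) (p : F →L[ℝ] ℝ) (y : M) :
    (E y) [⋀^Fin 1]→ₗ[ℝ] ℝ :=
  AlternatingMap.ofSubsingleton ℝ (E y) ℝ (0 : Fin 1)
    (f y • (p : F →ₗ[ℝ] ℝ).comp ((trivializationAt F E x₀).linearMapAt ℝ y))

theorem coordForm_apply {x₀ y : M} (hy : y ∈ (trivializationAt F E x₀).baseSet) (f : M → ℝ)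
    (p : F →L[ℝ] ℝ) (b : Fin 1 → E y) :
    coordForm E x₀ f p y b = f y * p (fibreCoord F x₀ (⟨y, b 0⟩ : TotalSpace F E)) := by
  change f y • p ((trivializationAt F E x₀).linearMapAt ℝ y (b 0)) = _
  rw [Bundle.Trivialization.linearMapAt_apply, if_pos hy]
  rfl

/-- The cutoff turns a form with constant coefficients in one trivialization into a global smooth
form, to which the morphism condition can be applied. -/
theorem isSmoothForm_coordForm {x₀ : M} {f : M → ℝ}
    (hf : ContMDiff (modelWithCornersSelf ℝ B) (modelWithCornersSelf ℝ ℝ) ∞ f)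
    (hfs : tsupport f ⊆ (trivializationAt F E x₀).baseSet) (p : F →L[ℝ] ℝ) :
    IsSmoothForm B F (coordForm E x₀ f p) := by
  intro σ y
  by_cases hy : y ∈ (trivializationAt F E x₀).baseSet
  · have h1 : (fun x => coordForm E x₀ f p x fun i => σ i x) =ᶠ[𝓝 y] fun x =>
        f x * p (fibreCoord F x₀ (⟨x, σ 0 x⟩ : TotalSpace F E)) := by
      filter_upwards [(trivializationAt F E x₀).open_baseSet.mem_nhds hy] with x hx
      rw [coordForm_apply hx]
    refine ContMDiffAt.congr_of_eventuallyEq ?_ h1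
    refine hf.contMDiffAt.mul (p.contMDiff.contMDiffAt.comp y ?_)
    exact ContMDiffAt.comp (g := (fibreCoord F x₀ : TotalSpace F E → F))
      (f := fun x => (⟨x, σ 0 x⟩ : TotalSpace F E)) y (contMDiffAt_fibreCoord hy)
      (σ 0).contMDiff.contMDiffAt
  · have h1 : (fun x => coordForm E x₀ f p x fun i => σ i x) =ᶠ[𝓝 y] fun _ => 0 := by
      have h2 : f =ᶠ[𝓝 y] 0 := notMem_tsupport_iff_eventuallyEq.1 fun h => hy (hfs h)
      filter_upwards [h2] with x hx
      change f x • p ((trivializationAt F E x₀).linearMapAt ℝ x (σ 0 x)) = 0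
      rw [hx, Pi.zero_apply, zero_smul]
    exact contMDiffAt_const.congr_of_eventuallyEq h1

theorem extDerivForm_one (A : LieAlgebroid B F E) (θ : ∀ x, (E x) [⋀^Fin 1]→ₗ[ℝ] ℝ)
    (σ₁ σ₂ : Sec B F E) (x : M) :
    extDerivForm A θ ![σ₁, σ₂] x =
      dirDeriv (modelWithCornersSelf ℝ B) (fun y => θ y fun _ => σ₂ y) x (A.anchor x (σ₁ x)) -
      dirDeriv (modelWithCornersSelf ℝ B) (fun y => θ y fun _ => σ₁ y) x (A.anchor x (σ₂ x)) -
      θ x (fun _ => A.bracket σ₁ σ₂ x) := by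
  have hf : ∀ (y : M) (i : Fin 2) (τ : Sec B F E), ![σ₁, σ₂] (i.succAbove (0 : Fin 1)) = τ →
      θ y (fun j : Fin 1 => (![σ₁, σ₂] (i.succAbove j)) y) = θ y (fun _ => τ y) := by
    intro y i τ h
    congr 1
    funext j
    rw [Subsingleton.elim j 0, h]
  have hg : ∀ (b : E x) (g : Fin 0 → E x), θ x (Fin.cons b g : Fin 1 → E x) = θ x fun _ => b := by
    intro b g
    congr 1
    funext j
    rw [Subsingleton.elim (α := Fin 1) j 0]
    rfl
  unfold extDerivForm
  rw [Fin.sum_univ_two, Fin.sum_univ_two, Fin.sum_univ_one, Fin.sum_univ_one]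
  have e1 : (fun y => θ y (fun j : Fin 1 => (![σ₁, σ₂] (Fin.succAbove 0 j)) y)) =
      fun y => θ y (fun _ => σ₂ y) := funext fun y => hf y 0 σ₂ rfl
  have e2 : (fun y => θ y (fun j : Fin 1 => (![σ₁, σ₂] (Fin.succAbove 1 j)) y)) =
      fun y => θ y (fun _ => σ₁ y) := funext fun y => hf y 1 σ₁ rfl
  rw [e1, e2, hg, hg, if_pos (show ((0 : Fin 2) : ℕ) ≤ ((0 : Fin 1) : ℕ) from le_rfl),
    if_neg (show ¬ ((1 : Fin 2) : ℕ) ≤ ((0 : Fin 1) : ℕ) by decide)]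
  change (-1 : ℝ) ^ 0 * dirDeriv (modelWithCornersSelf ℝ B) (fun y => θ y (fun _ => σ₂ y)) x
    (A.anchor x (σ₁ x)) + (-1 : ℝ) ^ 1 * dirDeriv (modelWithCornersSelf ℝ B)
    (fun y => θ y (fun _ => σ₁ y)) x (A.anchor x (σ₂ x)) +
    ((-1 : ℝ) ^ (0 + (0 + 1)) * θ x (fun _ => A.bracket σ₁ σ₂ x) + 0) = _
  ring

end VectorBundles

/-! ### The Cartan one-form under a bundle map -/

section BundleMaps

variable {B : Type*} [NormedAddCommGroup B] [NormedSpace ℝ B]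
  {M : Type*} [TopologicalSpace M] [ChartedSpace B M]
  {F : Type*} [NormedAddCommGroup F] [NormedSpace ℝ F]
  {E : M → Type*} [TopologicalSpace (TotalSpace F E)]
  [∀ x, AddCommGroup (E x)] [∀ x, Module ℝ (E x)] [∀ x, TopologicalSpace (E x)]
  [FiberBundle F E]
  {B' : Type*} [NormedAddCommGroup B'] [NormedSpace ℝ B']
  {M' : Type*} [TopologicalSpace M'] [ChartedSpace B' M']
  {F' : Type*} [NormedAddCommGroup F'] [NormedSpace ℝ F']
  {E' : M' → Type*} [TopologicalSpace (TotalSpace F' E')]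
  [∀ x, AddCommGroup (E' x)] [∀ x, Module ℝ (E' x)] [∀ x, TopologicalSpace (E' x)]
  [FiberBundle F' E']
  [IsManifold (modelWithCornersSelf ℝ B) ∞ M] [VectorBundle ℝ F E]
  [ContMDiffVectorBundle ∞ F E (modelWithCornersSelf ℝ B)]
  [IsManifold (modelWithCornersSelf ℝ B') ∞ M'] [VectorBundle ℝ F' E']
  [ContMDiffVectorBundle ∞ F' E' (modelWithCornersSelf ℝ B')]

/-- The derivative at `a` of the fibre derivative of `L` along a tangent vector. -/
def fibreDerivDir (L : TotalSpace F E → ℝ) (a : TotalSpace F E)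
    (v : TangentSpace (totalModel B F) a) : F →L[ℝ] ℝ :=
  mfderiv (totalModel B F) (modelWithCornersSelf ℝ (F →L[ℝ] ℝ)) (fibreDeriv B L a) a v

theorem totalMap_fibreLine {φ : M → M'} (Φ : ∀ x, E x →ₗ[ℝ] E' (φ x)) (a : TotalSpace F E)
    (b : E a.proj) (t : ℝ) :
    totalMap F F' Φ (fibreLine a b t) = fibreLine (totalMap F F' Φ a) (Φ a.proj b) t := by
  refine congrArg (TotalSpace.mk (φ a.proj)) ?_
  change Φ a.proj (a.snd + t • b) = _
  rw [map_add, map_smul]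
  rfl

/-- Φ is linear on fibres and therefore carries the plane a + s d + t b to the corresponding plane
through Φ(a). -/
theorem vertHess_totalMap {φ : M → M'} (Φ : ∀ x, E x →ₗ[ℝ] E' (φ x))
    (L' : TotalSpace F' E' → ℝ) (a : TotalSpace F E) (d b : E a.proj) :
    vertHess (fun c => L' (totalMap F F' Φ c)) a d b =
      vertHess L' (totalMap F F' Φ a) (Φ a.proj d) (Φ a.proj b) := by
  unfold vertHess
  congr 1
  funext s
  congr 1
  funext t
  have h1 := totalMap_fibreLine (F' := F') Φ (fibreLine a d s) b t
  refine congrArg L' (h1.trans (congrArg (TotalSpace.mk (φ a.proj)) ?_))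
  change Φ a.proj (a.snd + s • d) + t • Φ a.proj b =
    Φ a.proj a.snd + s • Φ a.proj d + t • Φ a.proj b
  rw [map_add, map_smul]

/-- `ω_L` on the prolongation is computed by any pair of projectable sections up to the choice made
in its definition. -/
theorem exists_cartanTwo_eq [FiniteDimensional ℝ B] [T2Space M] (A : LieAlgebroid B F E)
    (L : TotalSpace F E → ℝ) {a : TotalSpace F E} {z w : Pair B a}
    (hz : z ∈ prolongation A a) (hw : w ∈ prolongation A a) :
    ∃ Z W : ProjectableSection A, Z.val a = z ∧ W.val a = w ∧
      cartanTwo A L a z w = - prolExtDeriv (cartanOne L) Z W a := by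
  obtain ⟨Z, hZ⟩ := exists_projectableSection A hz
  obtain ⟨W, hW⟩ := exists_projectableSection A hw
  have h : ∃ Z : ProjectableSection A × ProjectableSection A, Z.1.val a = z ∧ Z.2.val a = w :=
    ⟨(Z, W), hZ, hW⟩
  refine ⟨h.choose.1, h.choose.2, h.choose_spec.1, h.choose_spec.2, ?_⟩
  unfold cartanTwo
  rw [dif_pos h]

section
variable {φ : M → M'} {Φ : ∀ x, E x →ₗ[ℝ] E' (φ x)} {L' : TotalSpace F' E' → ℝ}

theorem dirDeriv_vertVector_totalMap
    (hΦ : ContMDiff (totalModel B F) (totalModel B' F') ∞ (totalMap F F' Φ))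
    (hL' : ContMDiff (totalModel B' F') (modelWithCornersSelf ℝ ℝ) ∞ L')
    (c : TotalSpace F E) (b : E c.proj) :
    dirDeriv (totalModel B F) (fun c => L' (totalMap F F' Φ c)) c (vertVector c b) =
      dirDeriv (totalModel B' F') L' (totalMap F F' Φ c)
        (vertVector (totalMap F F' Φ c) (Φ c.proj b)) := by
  refine (dirDeriv_vertVector (L := fun c => L' (totalMap F F' Φ c)) (hL'.comp hΦ) c b).trans
    (Eq.trans ?_ (dirDeriv_vertVector hL' (totalMap F F' Φ c) (Φ c.proj b)).symm)
  simp only [totalMap_fibreLine]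

/-- Product rule: near a, θ_L on the section is the momentum K(c), the fibre derivative of L' at
Φ(c), applied to the fibre coordinate h of Φ∘σ. Differentiating h with the momentum frozen at Φ(a)
gives the first term, differentiating the momentum gives the second. -/
theorem dirDeriv_cartanOne
    (hΦ : ContMDiff (totalModel B F) (totalModel B' F') ∞ (totalMap F F' Φ))
    (hφ : ContMDiff (modelWithCornersSelf ℝ B) (modelWithCornersSelf ℝ B') ∞ φ)
    (hL' : ContMDiff (totalModel B' F') (modelWithCornersSelf ℝ ℝ) ∞ L')
    (a : TotalSpace F E) {f : M' → ℝ} (hf : f =ᶠ[𝓝 (φ a.proj)] 1) (σ : Sec B F E)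
    (X : ∀ c : TotalSpace F E, TangentSpace (totalModel B F) c)
    (v : TangentSpace (totalModel B F) a) (u : TangentSpace (modelWithCornersSelf ℝ B) a.proj)
    (hu : u = mfderiv (totalModel B F) (modelWithCornersSelf ℝ B)
      (TotalSpace.proj : TotalSpace F E → M) a v) :
    dirDeriv (totalModel B F) (fun c => cartanOne (B := B) (fun c => L' (totalMap F F' Φ c)) c
      (σ c.proj, X c)) a v =
    dirDeriv (modelWithCornersSelf ℝ B) (fun y => coordForm E' (φ a.proj) f
      (fibreDeriv B' L' (totalMap F F' Φ a) (totalMap F F' Φ a)) (φ y) fun _ => Φ y (σ y))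
      a.proj u +
    fibreDerivDir L' (totalMap F F' Φ a)
      (mfderiv (totalModel B F) (totalModel B' F') (totalMap F F' Φ) a v)
      (fibreCoord F' (φ a.proj) (⟨φ a.proj, Φ a.proj (σ a.proj)⟩ : TotalSpace F' E')) := by
  set a' := totalMap F F' Φ a with ha'
  set K : TotalSpace F E → F' →L[ℝ] ℝ := fun c => fibreDeriv B' L' a' (totalMap F F' Φ c) with hK
  set h : M → F' := fun y =>
    fibreCoord F' (φ a.proj) (⟨φ y, Φ y (σ y)⟩ : TotalSpace F' E') with hh
  have hsrc : (chartAt (ModelProd B' F') a').source ∈ 𝓝 a' :=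
    (chartAt (ModelProd B' F') a').open_source.mem_nhds (mem_chart_source _ _)
  have hΦa := (hΦ a).mdifferentiableAt (by simp : (∞ : WithTop ℕ∞) ≠ 0)
  have hsec : ContMDiff (modelWithCornersSelf ℝ B) (totalModel B' F') ∞
      (fun y => (⟨φ y, Φ y (σ y)⟩ : TotalSpace F' E')) := hΦ.comp σ.contMDiff
  have hhd : MDifferentiableAt (modelWithCornersSelf ℝ B) (modelWithCornersSelf ℝ F') h a.proj :=
    ((contMDiffAt_fibreCoord (E := E') (a := ⟨φ a.proj, Φ a.proj (σ a.proj)⟩)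
      (mem_baseSet (φ a.proj))).comp a.proj (hsec a.proj)).mdifferentiableAt (by simp)
  have hKd : MDifferentiableAt (totalModel B' F') (modelWithCornersSelf ℝ (F' →L[ℝ] ℝ))
      (fibreDeriv B' L' a') a' :=
    ((contMDiffOn_fibreDeriv hL' a').contMDiffAt hsrc).mdifferentiableAt (by simp)
  have hK' : HasMFDerivAt (totalModel B F) (modelWithCornersSelf ℝ (F' →L[ℝ] ℝ)) K a
      ((mfderiv (totalModel B' F') (modelWithCornersSelf ℝ (F' →L[ℝ] ℝ)) (fibreDeriv B' L' a')
        a').comp (mfderiv (totalModel B F) (totalModel B' F') (totalMap F F' Φ) a)) :=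
    hKd.hasMFDerivAt.comp a hΦa.hasMFDerivAt
  have hg' : HasMFDerivAt (totalModel B F) (modelWithCornersSelf ℝ F')
      (fun c : TotalSpace F E => h c.proj) a
      ((mfderiv (modelWithCornersSelf ℝ B) (modelWithCornersSelf ℝ F') h a.proj).comp
        (mfderiv (totalModel B F) (modelWithCornersSelf ℝ B)
          (TotalSpace.proj : TotalSpace F E → M) a)) :=
    hhd.hasMFDerivAt.comp a (mdifferentiableAt_proj a).hasMFDerivAt
  have hev : (fun c : TotalSpace F E => cartanOne (B := B) (fun c => L' (totalMap F F' Φ c)) c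
      (σ c.proj, X c)) =ᶠ[𝓝 a] fun c => K c (h c.proj) := by
    filter_upwards [hΦ.continuous.continuousAt.eventually hsrc] with c hc
    exact (dirDeriv_vertVector_totalMap hΦ hL' c (σ c.proj)).trans
      (dirDeriv_vertVector_eq_fibreDeriv hL' hc _)
  have hprod : HasMFDerivAt (totalModel B F) (modelWithCornersSelf ℝ ℝ)
      (fun c => K c (h c.proj)) a _ :=
    ((isBoundedBilinearMap_apply (𝕜 := ℝ) (E := F') (F := ℝ)).hasFDerivAt
      (K a, h a.proj)).hasMFDerivAt.comp a (hasMFDerivAt_prodMk_space hK' hg')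
  have hev2 : (fun y => coordForm E' (φ a.proj) f (fibreDeriv B' L' a' a') (φ y)
      fun _ => Φ y (σ y)) =ᶠ[𝓝 a.proj] fun y => K a (h y) := by
    filter_upwards [hφ.continuous.continuousAt.eventually hf,
      hφ.continuous.continuousAt.eventually
        ((trivializationAt F' E' (φ a.proj)).open_baseSet.mem_nhds (mem_baseSet _))] with y h1 h2
    rw [coordForm_apply h2, h1, Pi.one_apply, one_mul]
  have hlin : HasMFDerivAt (modelWithCornersSelf ℝ B) (modelWithCornersSelf ℝ ℝ)
      (fun y => K a (h y)) a.proj _ :=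
    (K a).hasMFDerivAt.comp a.proj hhd.hasMFDerivAt
  unfold dirDeriv
  rw [hev.mfderiv_eq, hev2.mfderiv_eq, hprod.mfderiv, hlin.mfderiv, hu]
  rfl
end

/-! ### The prolongation of a morphism -/

section

variable {φ : M → M'} {Φ : ∀ x, E x →ₗ[ℝ] E' (φ x)} {L' : TotalSpace F' E' → ℝ}

theorem dirDeriv_eq_of_eventuallyEq {V H N : Type*} [NormedAddCommGroup V] [NormedSpace ℝ V]
    [TopologicalSpace H] {I : ModelWithCorners ℝ V H} [TopologicalSpace N] [ChartedSpace H N]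
    {f g : N → ℝ} {x : N} (h : f =ᶠ[𝓝 x] g) (v : TangentSpace I x) :
    dirDeriv I f x v = dirDeriv I g x v := by
  unfold dirDeriv
  rw [h.mfderiv_eq, h.self_of_nhds]

/-- Tangent vectors are separated by smooth functions. -/
theorem eq_of_dirDeriv_eq [FiniteDimensional ℝ B] [T2Space M] {x : M}
    {u w : TangentSpace (modelWithCornersSelf ℝ B) x}
    (h : ∀ f : M → ℝ, ContMDiff (modelWithCornersSelf ℝ B) (modelWithCornersSelf ℝ ℝ) ∞ f →
      dirDeriv (modelWithCornersSelf ℝ B) f x u = dirDeriv (modelWithCornersSelf ℝ B) f x w) :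
    u = w := by
  have h1M : IsManifold (modelWithCornersSelf ℝ B) 1 M := .of_le (n := ∞) (by simp)
  have key : ∀ ℓ : B →L[ℝ] ℝ, ℓ u = ℓ w := by
    intro ℓ
    let f : SmoothBumpFunction (modelWithCornersSelf ℝ B) x := Classical.choice inferInstance
    have hf : ContMDiff (modelWithCornersSelf ℝ B) (modelWithCornersSelf ℝ ℝ) ∞
        (fun y => f y • ℓ (extChartAt (modelWithCornersSelf ℝ B) x y)) :=
      f.contMDiff_smul (ℓ.contMDiff.comp_contMDiffOn contMDiffOn_extChartAt)
    have hev : (fun y => f y • ℓ (extChartAt (modelWithCornersSelf ℝ B) x y)) =ᶠ[𝓝 x]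
        fun y => ℓ (extChartAt (modelWithCornersSelf ℝ B) x y) := by
      filter_upwards [f.eventuallyEq_one] with y hy
      rw [hy, Pi.one_apply, one_smul]
    have hd : HasMFDerivAt (modelWithCornersSelf ℝ B) (modelWithCornersSelf ℝ ℝ)
        (fun y => ℓ (extChartAt (modelWithCornersSelf ℝ B) x y)) x _ :=
      ℓ.hasMFDerivAt.comp x (mdifferentiableAt_extChartAt
        (I := modelWithCornersSelf ℝ B) (mem_chart_source B x)).hasMFDerivAt
    have h1 := h _ hf
    rw [dirDeriv_eq_of_eventuallyEq hev, dirDeriv_eq_of_eventuallyEq hev] at h1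
    unfold dirDeriv at h1
    rw [hd.mfderiv, mfderiv_extChartAt_self] at h1
    exact h1
  exact (SeparatingDual.eq_iff_forall_dual_eq (R := ℝ) (V := B)).2 key

/-- The degree-zero morphism condition says that both sides act alike on all smooth functions, and
these separate tangent vectors. -/
theorem IsMorphism.anchor_apply [FiniteDimensional ℝ B'] [T2Space M'] {A : LieAlgebroid B F E}
    {A' : LieAlgebroid B' F' E'} (h : IsMorphism A A' φ Φ) (x : M) (b : E x) :
    A'.anchor (φ x) (Φ x b) =
      mfderiv (modelWithCornersSelf ℝ B) (modelWithCornersSelf ℝ B') φ x (A.anchor x b) := by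
  refine eq_of_dirDeriv_eq fun f hf => (h.pullback_diff f hf x b).trans ?_
  unfold dirDeriv
  rw [mfderiv_comp (I' := modelWithCornersSelf ℝ B') x
    (hf.contMDiffAt.mdifferentiableAt (by simp))
    (h.contMDiff_base.contMDiffAt.mdifferentiableAt (by simp))]
  rfl

theorem mfderiv_proj_totalMap
    (hΦ : ContMDiff (totalModel B F) (totalModel B' F') ∞ (totalMap F F' Φ))
    (hφ : ContMDiff (modelWithCornersSelf ℝ B) (modelWithCornersSelf ℝ B') ∞ φ)
    (a : TotalSpace F E) (v : TangentSpace (totalModel B F) a) :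
    mfderiv (totalModel B' F') (modelWithCornersSelf ℝ B')
      (TotalSpace.proj : TotalSpace F' E' → M') (totalMap F F' Φ a)
      (mfderiv (totalModel B F) (totalModel B' F') (totalMap F F' Φ) a v) =
    mfderiv (modelWithCornersSelf ℝ B) (modelWithCornersSelf ℝ B') φ a.proj
      (mfderiv (totalModel B F) (modelWithCornersSelf ℝ B)
        (TotalSpace.proj : TotalSpace F E → M) a v) := by
  have h1 := mfderiv_comp a (mdifferentiableAt_proj (totalMap F F' Φ a))
    (hΦ.contMDiffAt.mdifferentiableAt (x := a) (by simp))
  have h2 := mfderiv_comp a (hφ.contMDiffAt.mdifferentiableAt (by simp))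
    (mdifferentiableAt_proj (B := B) a)
  exact DFunLike.congr_fun (h1.symm.trans h2) v

theorem mfderiv_totalMap_vertVector
    (hΦ : ContMDiff (totalModel B F) (totalModel B' F') ∞ (totalMap F F' Φ))
    (a : TotalSpace F E) (d : E a.proj) :
    mfderiv (totalModel B F) (totalModel B' F') (totalMap F F' Φ) a (vertVector a d) =
      vertVector (totalMap F F' Φ a) (Φ a.proj d) := by
  refine (mfderiv_vertVector a d (hΦ.contMDiffAt.mdifferentiableAt (by simp))).trans ?_
  have h : (fun t => totalMap F F' Φ (fibreLine a d t)) =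
      fibreLine (totalMap F F' Φ a) (Φ a.proj d) := funext (totalMap_fibreLine Φ a d)
  exact congrArg (fun g : ℝ → TotalSpace F' E' => (mfderiv (modelWithCornersSelf ℝ ℝ)
    (totalModel B' F') g 0 (1 : ℝ) : B' × F')) h

theorem prolMap_add_vertLift
    (hΦ : ContMDiff (totalModel B F) (totalModel B' F') ∞ (totalMap F F' Φ))
    (a : TotalSpace F E) (z : Pair B a) (d : E a.proj) :
    prolMap (F' := F') (B' := B') Φ a (z + vertLift a d) =
      prolMap Φ a z + vertLift (totalMap F F' Φ a) (Φ a.proj d) := by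
  refine Prod.ext ?_ ?_
  · exact ((Φ a.proj).map_add z.1 0).trans (congrArg _ (map_zero _))
  · exact (map_add _ z.2 (vertVector a d)).trans
      (congrArg _ (mfderiv_totalMap_vertVector hΦ a d))

theorem vertLift_mem_prolongation (A : LieAlgebroid B F E) (a : TotalSpace F E) (d : E a.proj) :
    vertLift a d ∈ prolongation A a := by
  change A.anchor a.proj 0 = mfderiv (totalModel B F) (modelWithCornersSelf ℝ B)
    (TotalSpace.proj : TotalSpace F E → M) a (vertVector a d)
  rw [map_zero, mfderiv_proj_vertVector]

theorem exists_mem_prolongation (A : LieAlgebroid B F E) (a : TotalSpace F E) (b : E a.proj) :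
    ∃ v, ((b, v) : Pair B a) ∈ prolongation A a := by
  obtain ⟨v, hv⟩ := mfderiv_proj_surjective a (A.anchor a.proj b)
  exact ⟨v, hv.symm⟩

section
variable {A : LieAlgebroid B F E} {A' : LieAlgebroid B' F' E'}
  [FiniteDimensional ℝ B'] [T2Space M']

theorem IsMorphism.prolMap_mem (h : IsMorphism A A' φ Φ) {a : TotalSpace F E} {z : Pair B a}
    (hz : z ∈ prolongation A a) : prolMap Φ a z ∈ prolongation A' (totalMap F F' Φ a) := by
  refine (h.anchor_apply a.proj z.1).trans ?_
  refine Eq.trans ?_ (mfderiv_proj_totalMap h.contMDiff_total h.contMDiff_base a z.2).symm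
  exact congrArg _ hz

/-- Start from any element over b. The image of its vector component has the same base projection as
that of w', so they differ by a vertical vector, which lifts because Φ is onto on fibres. The
freedom to prescribe b is what lets multipliers descend. -/
theorem IsEpimorphism.exists_prolMap_eq (h : IsEpimorphism A A' φ Φ) {a : TotalSpace F E}
    {w' : Pair B' (totalMap F F' Φ a)} (hw' : w' ∈ prolongation A' (totalMap F F' Φ a))
    {b : E a.proj} (hb : Φ a.proj b = w'.1) :
    ∃ w ∈ prolongation A a, w.1 = b ∧ prolMap Φ a w = w' := by
  obtain ⟨v, hv⟩ := exists_mem_prolongation A a b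
  have h1 := h.isMorphism.prolMap_mem hv
  have h2 : mfderiv (totalModel B' F') (modelWithCornersSelf ℝ B')
      (TotalSpace.proj : TotalSpace F' E' → M') (totalMap F F' Φ a)
      (w'.2 - (prolMap Φ a ((b, v) : Pair B a)).2) = 0 := by
    have h3 : A'.anchor (φ a.proj) (Φ a.proj b) = _ := h1
    have h4 : A'.anchor (φ a.proj) w'.1 = _ := hw'
    rw [map_sub, sub_eq_zero]
    refine h4.symm.trans (Eq.trans ?_ h3)
    rw [hb]
  obtain ⟨c', hc'⟩ := exists_eq_vertVector _ h2
  obtain ⟨c, hc⟩ := h.surjective a.proj c'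
  refine ⟨(b, v) + vertLift a c, Submodule.add_mem _ hv (vertLift_mem_prolongation A a c),
    add_zero b, ?_⟩
  rw [prolMap_add_vertLift h.isMorphism.contMDiff_total]
  refine Prod.ext ?_ ?_
  · exact (add_zero (Φ a.proj b)).trans hb
  · have h5 : (vertLift (B := B') (totalMap F F' Φ a) (Φ a.proj c)).2 =
        w'.2 - (prolMap Φ a ((b, v) : Pair B a)).2 := by
      rw [hc']
      exact congrArg (fun e => vertVector (B := B') (totalMap F F' Φ a) e) hc
    exact (congrArg (fun u => (prolMap Φ a ((b, v) : Pair B a)).2 + u) h5).trans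
      (add_sub_cancel _ _)

end

end

/-! ### The Cartan two-form under a morphism -/

section

variable {φ : M → M'} {Φ : ∀ x, E x →ₗ[ℝ] E' (φ x)} {L' : TotalSpace F' E' → ℝ}
  {A : LieAlgebroid B F E} {A' : LieAlgebroid B' F' E'}

/-- In coordinates θ_L = ⟨p, e⟩, so dθ_L = ⟨p, de⟩ + ⟨dp ∧ e⟩. The first term is the differential of
a form pulled back from E' with p frozen at Φ(a), and the second involves only the values of the
arguments at a. -/
theorem prolExtDeriv_cartanOne
    (hΦ : ContMDiff (totalModel B F) (totalModel B' F') ∞ (totalMap F F' Φ))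
    (hφ : ContMDiff (modelWithCornersSelf ℝ B) (modelWithCornersSelf ℝ B') ∞ φ)
    (hL' : ContMDiff (totalModel B' F') (modelWithCornersSelf ℝ ℝ) ∞ L')
    (a : TotalSpace F E) {f : M' → ℝ} (hf : f =ᶠ[𝓝 (φ a.proj)] 1) (Z W : ProjectableSection A) :
    prolExtDeriv (cartanOne fun c => L' (totalMap F F' Φ c)) Z W a =
      extDerivForm A (q := 0) (fun y => (coordForm E' (φ a.proj) f
        (fibreDeriv B' L' (totalMap F F' Φ a) (totalMap F F' Φ a)) (φ y)).compLinearMap (Φ y))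
        ![Z.base, W.base] a.proj +
      (fibreDerivDir (B := B') L' (totalMap F F' Φ a)
          (prolMap (B' := B') (F' := F') Φ a (Z.val a)).2
        (fibreCoord F' (φ a.proj) (⟨φ a.proj, Φ a.proj (W.base a.proj)⟩ : TotalSpace F' E')) -
      fibreDerivDir (B := B') L' (totalMap F F' Φ a) (prolMap (B' := B') (F' := F') Φ a (W.val a)).2
        (fibreCoord F' (φ a.proj) (⟨φ a.proj, Φ a.proj (Z.base a.proj)⟩ : TotalSpace F' E'))) := by
  have h1 := dirDeriv_cartanOne hΦ hφ hL' a hf W.base W.field (Z.field a) _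
    (Z.mem_prolongation a)
  have h2 := dirDeriv_cartanOne hΦ hφ hL' a hf Z.base Z.field (W.field a) _
    (W.mem_prolongation a)
  have h3 : cartanOne (fun c => L' (totalMap F F' Φ c)) a (prolBracket Z W a) =
      coordForm E' (φ a.proj) f (fibreDeriv B' L' (totalMap F F' Φ a) (totalMap F F' Φ a))
        (φ a.proj) fun _ => Φ a.proj (A.bracket Z.base W.base a.proj) := by
    rw [coordForm_apply (mem_baseSet _), hf.self_of_nhds, Pi.one_apply, one_mul]
    exact (dirDeriv_vertVector_totalMap hΦ hL' a _).trans
      (dirDeriv_vertVector_eq_fibreDeriv hL' (mem_chart_source _ _) _)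
  rw [extDerivForm_one]
  refine (congrArg₂ (· - ·) (congrArg₂ (· - ·) h1 h2) h3).trans ?_
  change _ = (dirDeriv (modelWithCornersSelf ℝ B) (fun y => coordForm E' (φ a.proj) f
      (fibreDeriv B' L' (totalMap F F' Φ a) (totalMap F F' Φ a)) (φ y) fun _ => Φ y (W.base y))
      a.proj _ - dirDeriv (modelWithCornersSelf ℝ B) (fun y => coordForm E' (φ a.proj) f
      (fibreDeriv B' L' (totalMap F F' Φ a) (totalMap F F' Φ a)) (φ y) fun _ => Φ y (Z.base y))
      a.proj _ - (coordForm E' (φ a.proj) f (fibreDeriv B' L' (totalMap F F' Φ a)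
        (totalMap F F' Φ a)) (φ a.proj) fun _ => Φ a.proj (A.bracket Z.base W.base a.proj))) + _
  dsimp only [prolMap, ProjectableSection.val]
  ring

theorem exists_cartanTwo_totalMap [FiniteDimensional ℝ B] [T2Space M]
    (hΦ : ContMDiff (totalModel B F) (totalModel B' F') ∞ (totalMap F F' Φ))
    (hφ : ContMDiff (modelWithCornersSelf ℝ B) (modelWithCornersSelf ℝ B') ∞ φ)
    (hL' : ContMDiff (totalModel B' F') (modelWithCornersSelf ℝ ℝ) ∞ L')
    {a : TotalSpace F E} {f : M' → ℝ} (hf : f =ᶠ[𝓝 (φ a.proj)] 1) {z w : Pair B a}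
    (hz : z ∈ prolongation A a) (hw : w ∈ prolongation A a) :
    ∃ σ τ : Sec B F E, σ a.proj = z.1 ∧ τ a.proj = w.1 ∧
      cartanTwo A (fun c => L' (totalMap F F' Φ c)) a z w =
      - (extDerivForm A (q := 0) (fun y => (coordForm E' (φ a.proj) f
        (fibreDeriv B' L' (totalMap F F' Φ a) (totalMap F F' Φ a)) (φ y)).compLinearMap (Φ y))
        ![σ, τ] a.proj +
      (fibreDerivDir (B := B') L' (totalMap F F' Φ a) (prolMap (B' := B') (F' := F') Φ a z).2
        (fibreCoord F' (φ a.proj) (⟨φ a.proj, Φ a.proj w.1⟩ : TotalSpace F' E')) -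
      fibreDerivDir (B := B') L' (totalMap F F' Φ a) (prolMap (B' := B') (F' := F') Φ a w).2
        (fibreCoord F' (φ a.proj) (⟨φ a.proj, Φ a.proj z.1⟩ : TotalSpace F' E')))) := by
  obtain ⟨Z, W, rfl, rfl, h⟩ := exists_cartanTwo_eq A (fun c => L' (totalMap F F' Φ c)) hz hw
  exact ⟨Z.base, W.base, rfl, rfl, h.trans (congrArg Neg.neg
    (prolExtDeriv_cartanOne hΦ hφ hL' a hf Z W))⟩

/-- The preceding formula for the identity map, whose derivative disappears from the correction
terms. -/
theorem exists_cartanTwo [FiniteDimensional ℝ B'] [T2Space M']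
    (hL' : ContMDiff (totalModel B' F') (modelWithCornersSelf ℝ ℝ) ∞ L')
    {a : TotalSpace F' E'} {f : M' → ℝ} (hf : f =ᶠ[𝓝 a.proj] 1) {z w : Pair B' a}
    (hz : z ∈ prolongation A' a) (hw : w ∈ prolongation A' a) :
    ∃ σ τ : Sec B' F' E', σ a.proj = z.1 ∧ τ a.proj = w.1 ∧
      cartanTwo A' L' a z w =
      - (extDerivForm A' (q := 0) (coordForm E' a.proj f (fibreDeriv B' L' a a)) ![σ, τ] a.proj +
      (fibreDerivDir (B := B') L' a z.2 (fibreCoord F' a.proj (⟨a.proj, w.1⟩ : TotalSpace F' E')) -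
      fibreDerivDir (B := B') L' a w.2
        (fibreCoord F' a.proj (⟨a.proj, z.1⟩ : TotalSpace F' E')))) := by
  obtain ⟨σ, τ, h1, h2, h3⟩ := exists_cartanTwo_totalMap (E := E') (E' := E') (φ := id)
    (Φ := fun x => LinearMap.id) contMDiff_id contMDiff_id hL' (a := a) hf hz hw
  refine ⟨σ, τ, h1, h2, h3.trans ?_⟩
  have h4 : ∀ v : Pair B' a, (prolMap (E := E') (E' := E') (φ := id)
      (F' := F') (B' := B') (fun x => LinearMap.id) a v).2 = v.2 := fun v =>
    DFunLike.congr_fun (mfderiv_id (I := totalModel B' F') (x := a)) v.2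
  exact congrArg Neg.neg (congrArg₂ (· + ·) rfl (congrArg₂ (· - ·)
    (congrArg (fun v => fibreDerivDir (B := B') L' a v _) (h4 z))
    (congrArg (fun v => fibreDerivDir (B := B') L' a v _) (h4 w))))

/-- Once the contributions of the frozen form cancel, only explicit pointwise terms remain. The
morphism condition allows arbitrary sections through the given values, so it also absorbs the choice
of sections in the definition of ω_L, and tensoriality needs no separate proof. -/
theorem IsMorphism.cartanTwo_sub [FiniteDimensional ℝ B] [T2Space M]
    [FiniteDimensional ℝ B'] [T2Space M'] (h : IsMorphism A A' φ Φ)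
    (hL' : ContMDiff (totalModel B' F') (modelWithCornersSelf ℝ ℝ) ∞ L')
    {a : TotalSpace F E} {z w : Pair B a}
    (hz : z ∈ prolongation A a) (hw : w ∈ prolongation A a)
    {z' w' : Pair B' (totalMap F F' Φ a)} (hz' : z' ∈ prolongation A' (totalMap F F' Φ a))
    (hw' : w' ∈ prolongation A' (totalMap F F' Φ a)) (hzz : z'.1 = Φ a.proj z.1)
    (hww : w'.1 = Φ a.proj w.1) :
    cartanTwo A' L' (totalMap F F' Φ a) z' w' -
      cartanTwo A (fun c => L' (totalMap F F' Φ c)) a z w =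
    (fibreDerivDir (B := B') L' (totalMap F F' Φ a) (prolMap (B' := B') (F' := F') Φ a z).2
        (fibreCoord F' (φ a.proj) (⟨φ a.proj, w'.1⟩ : TotalSpace F' E')) -
      fibreDerivDir (B := B') L' (totalMap F F' Φ a) (prolMap (B' := B') (F' := F') Φ a w).2
        (fibreCoord F' (φ a.proj) (⟨φ a.proj, z'.1⟩ : TotalSpace F' E'))) -
    (fibreDerivDir (B := B') L' (totalMap F F' Φ a) z'.2
        (fibreCoord F' (φ a.proj) (⟨φ a.proj, w'.1⟩ : TotalSpace F' E')) -
      fibreDerivDir (B := B') L' (totalMap F F' Φ a) w'.2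
        (fibreCoord F' (φ a.proj) (⟨φ a.proj, z'.1⟩ : TotalSpace F' E'))) := by
  obtain ⟨f, hfs, hf, hft⟩ := exists_bump (I := modelWithCornersSelf ℝ B')
    ((trivializationAt F' E' (φ a.proj)).open_baseSet.mem_nhds (mem_baseSet (φ a.proj)))
  obtain ⟨σ, τ, h1, h2, h3⟩ :=
    exists_cartanTwo_totalMap h.contMDiff_total h.contMDiff_base hL' hf hz hw
  obtain ⟨σ', τ', h1', h2', h3'⟩ := exists_cartanTwo hL' (a := totalMap F F' Φ a) hf hz' hw'
  -- The morphism condition on one-forms, evaluated on whichever sections the two definitions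
  -- selected.
  have h4 := h.pullback_extDeriv 0 _ (isSmoothForm_coordForm hfs hft
    (fibreDeriv B' L' (totalMap F F' Φ a) (totalMap F F' Φ a))) a.proj ![σ, τ] ![σ', τ'] (by
      intro i
      fin_cases i
      · exact h1'.trans (hzz.trans (congrArg (Φ a.proj) h1.symm))
      · exact h2'.trans (hww.trans (congrArg (Φ a.proj) h2.symm)))
  rw [← hzz, ← hww] at h3
  have h5 : ∀ p q r s t u : ℝ, p = r → - (p + q) - (- (r + s)) = s - q := by
    intro p q r s t u h; rw [h]; ring
  exact (congrArg₂ (· - ·) h3' h3).trans (h5 _ _ _ _ 0 0 h4)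

theorem IsMorphism.cartanTwo_prolMap [FiniteDimensional ℝ B] [T2Space M]
    [FiniteDimensional ℝ B'] [T2Space M'] (h : IsMorphism A A' φ Φ)
    (hL' : ContMDiff (totalModel B' F') (modelWithCornersSelf ℝ ℝ) ∞ L')
    {a : TotalSpace F E} {z w : Pair B a}
    (hz : z ∈ prolongation A a) (hw : w ∈ prolongation A a) :
    cartanTwo A' L' (totalMap F F' Φ a) (prolMap Φ a z) (prolMap Φ a w) =
      cartanTwo A (fun c => L' (totalMap F F' Φ c)) a z w :=
  sub_eq_zero.1 ((h.cartanTwo_sub hL' hz hw (h.prolMap_mem hz) (h.prolMap_mem hw) rfl rfl).trans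
    (sub_self _))

theorem fibreDerivDir_add_vertVector
    (hL' : ContMDiff (totalModel B' F') (modelWithCornersSelf ℝ ℝ) ∞ L') (a : TotalSpace F' E')
    (v : TangentSpace (totalModel B' F') a) (d b : E' a.proj) :
    fibreDerivDir (B := B') L' a (v + vertVector a d)
        (fibreCoord F' a.proj (⟨a.proj, b⟩ : TotalSpace F' E')) =
      fibreDerivDir (B := B') L' a v (fibreCoord F' a.proj (⟨a.proj, b⟩ : TotalSpace F' E')) +
        vertHess L' a d b := by
  have h1 : fibreDerivDir (B := B') L' a (v + vertVector a d) = fibreDerivDir (B := B') L' a v +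
      fibreHess B' L' a a (fibreCoord F' a.proj (⟨a.proj, d⟩ : TotalSpace F' E')) :=
    ((mfderiv (totalModel B' F') (modelWithCornersSelf ℝ (F' →L[ℝ] ℝ))
      (fibreDeriv B' L' a) a).map_add v (vertVector a d)).trans
      (congrArg (fun x => fibreDerivDir (B := B') L' a v + x)
      (mfderiv_fibreDeriv_vertVector hL' (mem_chart_source _ a) d))
  rw [h1, vertHess_eq hL' (mem_chart_source (ModelProd B' F') a)]
  rfl

/-- Compare z' and z' plus the vertical lift with the same pair z, w upstairs. Subtracting leaves
only the derivative of the momentum along d^V, which is the fibre Hessian. The pair upstairs is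
merely a witness making `IsMorphism.cartanTwo_sub` applicable. -/
theorem IsMorphism.cartanTwo_add_vertLift [FiniteDimensional ℝ B] [T2Space M]
    [FiniteDimensional ℝ B'] [T2Space M'] (h : IsMorphism A A' φ Φ)
    (hL' : ContMDiff (totalModel B' F') (modelWithCornersSelf ℝ ℝ) ∞ L')
    {a : TotalSpace F E} {z w : Pair B a}
    (hz : z ∈ prolongation A a) (hw : w ∈ prolongation A a)
    {z' w' : Pair B' (totalMap F F' Φ a)} (hz' : z' ∈ prolongation A' (totalMap F F' Φ a))
    (hw' : w' ∈ prolongation A' (totalMap F F' Φ a)) (hzz : z'.1 = Φ a.proj z.1)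
    (hww : w'.1 = Φ a.proj w.1) (d : E' (φ a.proj)) :
    cartanTwo A' L' (totalMap F F' Φ a) (z' + vertLift (totalMap F F' Φ a) d) w' =
      cartanTwo A' L' (totalMap F F' Φ a) z' w' - vertHess L' (totalMap F F' Φ a) d w'.1 := by
  have h1 := h.cartanTwo_sub hL' hz hw hz' hw' hzz hww
  have hz1 : (z' + vertLift (totalMap F F' Φ a) d).1 = z'.1 := add_zero z'.1
  have h2 := h.cartanTwo_sub hL' hz hw (Submodule.add_mem _ hz'
    (vertLift_mem_prolongation A' (totalMap F F' Φ a) d)) hw' (hz1.trans hzz) hww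
  have h3 : fibreDerivDir (B := B') L' (totalMap F F' Φ a) (z' + vertLift (totalMap F F' Φ a) d).2
      (fibreCoord F' (φ a.proj) (⟨φ a.proj, w'.1⟩ : TotalSpace F' E')) = _ :=
    fibreDerivDir_add_vertVector hL' (totalMap F F' Φ a) z'.2 d w'.1
  rw [hz1] at h2
  rw [h3] at h2
  change _ = _ - (fibreDerivDir (B := B') L' (totalMap F F' Φ a) z'.2
      (fibreCoord F' (φ a.proj) (⟨φ a.proj, w'.1⟩ : TotalSpace F' E')) + _ - _) at h2
  linarith

end

/-! ### Push-forward of the Lagrange–d'Alembert equations -/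

section

variable {φ : M → M'} {Φ : ∀ x, E x →ₗ[ℝ] E' (φ x)} {L' : TotalSpace F' E' → ℝ}
  {A : LieAlgebroid B F E} {A' : LieAlgebroid B' F' E'}

theorem energy_totalMap
    (hΦ : ContMDiff (totalModel B F) (totalModel B' F') ∞ (totalMap F F' Φ))
    (hL' : ContMDiff (totalModel B' F') (modelWithCornersSelf ℝ ℝ) ∞ L') (a : TotalSpace F E) :
    energy B (fun c => L' (totalMap F F' Φ c)) a = energy B' L' (totalMap F F' Φ a) :=
  congrArg₂ (· - ·) (dirDeriv_vertVector_totalMap hΦ hL' a a.snd) rfl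

theorem mdifferentiableAt_energy
    (hL' : ContMDiff (totalModel B' F') (modelWithCornersSelf ℝ ℝ) ∞ L') (a : TotalSpace F' E') :
    MDifferentiableAt (totalModel B' F') (modelWithCornersSelf ℝ ℝ) (energy B' L') a := by
  have hsrc : (chartAt (ModelProd B' F') a).source ∈ 𝓝 a :=
    (chartAt (ModelProd B' F') a).open_source.mem_nhds (mem_chart_source _ _)
  have hev : energy B' L' =ᶠ[𝓝 a] fun c =>
      fibreDeriv B' L' a c (fibreCoord F' a.proj c) - L' c := by
    filter_upwards [hsrc] with c hc
    exact congrArg (fun r => r - L' c) (dirDeriv_vertVector_eq_fibreDeriv hL' hc c.snd)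
  refine MDifferentiableAt.congr_of_eventuallyEq ?_ hev
  have h1 := ((contMDiffOn_fibreDeriv hL' a).contMDiffAt hsrc).clm_apply
    (contMDiffAt_fibreCoord (E := E') (mem_baseSet a.proj))
  exact (h1.sub hL'.contMDiffAt).mdifferentiableAt (by simp)

theorem prolDiff_energy_prolMap
    (hΦ : ContMDiff (totalModel B F) (totalModel B' F') ∞ (totalMap F F' Φ))
    (hL' : ContMDiff (totalModel B' F') (modelWithCornersSelf ℝ ℝ) ∞ L') (a : TotalSpace F E)
    (w : Pair B a) :
    prolDiff (energy B' L') (totalMap F F' Φ a) (prolMap (B' := B') Φ a w) =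
      prolDiff (energy B fun c => L' (totalMap F F' Φ c)) a w := by
  have h1 : (energy B fun c => L' (totalMap F F' Φ c)) = energy B' L' ∘ totalMap F F' Φ :=
    funext (energy_totalMap hΦ hL')
  unfold prolDiff dirDeriv
  rw [h1, mfderiv_comp (I' := totalModel B' F') a (mdifferentiableAt_energy hL' _)
    (hΦ.contMDiffAt.mdifferentiableAt (by simp))]
  rfl

section
variable {C : ConstrainedSystem B F E} {C' : ConstrainedSystem B' F' E'}

theorem totalMap_mem_space (hD : ∀ x, (C.D x).map (Φ x) = C'.D (φ x)) {a : TotalSpace F E}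
    (ha : a ∈ C.space) : totalMap F F' Φ a ∈ C'.space :=
  (hD a.proj).le (Submodule.mem_map_of_mem ha)

theorem ConstrainedSystem.IsTangent.totalMap
    (hΦ : ContMDiff (totalModel B F) (totalModel B' F') ∞ (totalMap F F' Φ))
    (hD : ∀ x, (C.D x).map (Φ x) = C'.D (φ x)) {a : TotalSpace F E}
    {v : TangentSpace (totalModel B F) a} (hv : C.IsTangent a v) :
    C'.IsTangent (LieAlgd.totalMap F F' Φ a)
      (mfderiv (totalModel B F) (totalModel B' F') (LieAlgd.totalMap F F' Φ) a v) := by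
  obtain ⟨γ, h1, h2, h3⟩ := hv
  refine ⟨LieAlgd.totalMap F F' Φ ∘ γ, hΦ.contMDiffAt.comp _ h1,
    h2.mono fun t ht => totalMap_mem_space hD ht, ?_⟩
  have h4 := congrArg (tangentMap (totalModel B F) (totalModel B' F')
    (LieAlgd.totalMap F F' Φ)) h3
  refine Eq.trans ?_ h4
  rw [mfderiv_comp (I' := totalModel B F) 0 (hΦ.contMDiffAt.mdifferentiableAt (by simp))
    (h1.mdifferentiableAt (by simp))]
  rfl

/-- The left side of the equation depends on w only through its image under the prolonged map, hence
λ vanishes on ker Φ. The multiplier downstairs is λ composed with a linear right inverse of Φ. -/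
theorem ConstrainedSystem.satisfiesLdA_totalMap [FiniteDimensional ℝ B] [T2Space M]
    [FiniteDimensional ℝ B'] [T2Space M'] (h : IsEpimorphism A A' φ Φ)
    (hL : ∀ a, C.L a = C'.L (totalMap F F' Φ a)) (hD : ∀ x, (C.D x).map (Φ x) = C'.D (φ x))
    {a : TotalSpace F E} {z : Pair B a} (hz : C.SatisfiesLdA A a z) :
    C'.SatisfiesLdA A' (totalMap F F' Φ a) (prolMap Φ a z) := by
  obtain ⟨⟨hz1, hz2, hz3⟩, hz4, lam, hlam, heq⟩ := hz
  have hΦ := h.isMorphism.contMDiff_total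
  have hLf : C.L = fun c => C'.L (totalMap F F' Φ c) := funext hL
  have heq' : ∀ w ∈ prolongation A a, cartanTwo A' C'.L (totalMap F F' Φ a)
      (prolMap (B' := B') (F' := F') Φ a z) (prolMap Φ a w) -
        prolDiff (energy B' C'.L) (totalMap F F' Φ a) (prolMap (B' := B') Φ a w) =
      lam w.1 := by
    intro w hw
    rw [h.isMorphism.cartanTwo_prolMap C'.contMDiff_L hz1 hw,
      prolDiff_energy_prolMap hΦ C'.contMDiff_L, ← hLf]
    exact heq w hw
  have hker : ∀ b, Φ a.proj b = 0 → lam b = 0 := by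
    intro b hb
    obtain ⟨w, hw, hw1, hw2⟩ := h.exists_prolMap_eq (w' := (0 : Pair B' (totalMap F F' Φ a)))
      (Submodule.zero_mem (prolongation A' (totalMap F F' Φ a))) hb
    -- The comparison element w₀ has the same image 0 and first component 0. It replaces an
    -- evaluation of ω_{L'} at 0, so linearity of ω_{L'} is not invoked.
    obtain ⟨w₀, hw₀, hw₀1, hw₀2⟩ := h.exists_prolMap_eq
      (w' := (0 : Pair B' (totalMap F F' Φ a)))
      (Submodule.zero_mem (prolongation A' (totalMap F F' Φ a))) (map_zero (Φ a.proj))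
    have e1 := heq' w hw
    have e2 := heq' w₀ hw₀
    rw [hw2, hw1] at e1
    rw [hw₀2, hw₀1, map_zero] at e2
    exact e1.symm.trans e2
  obtain ⟨R, hR⟩ := (Φ a.proj).exists_rightInverse_of_surjective
    (LinearMap.range_eq_top.2 (h.surjective a.proj))
  have hR' : ∀ b, Φ a.proj (R b) = b := fun b => LinearMap.congr_fun hR b
  refine ⟨⟨h.isMorphism.prolMap_mem hz1, (hD a.proj).le (Submodule.mem_map_of_mem hz2),
    hz3.totalMap hΦ hD⟩, congrArg (Φ a.proj) hz4, lam.comp R, ?_, ?_⟩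
  · intro d' hd'
    obtain ⟨d, hd, rfl⟩ := (hD a.proj).ge hd'
    have h1 := hker (R (Φ a.proj d) - d) (by rw [map_sub, hR', sub_self])
    rw [map_sub, hlam d hd, sub_zero] at h1
    exact h1
  · intro w' hw'
    obtain ⟨w, hw, hw1, rfl⟩ := h.exists_prolMap_eq hw' (hR' w'.1)
    exact (heq' w hw).trans (congrArg lam hw1)

/-- `vertHess L a d` as a linear form. -/
theorem exists_linearMap_vertHess (a : TotalSpace F' E') (d : E' a.proj)
    (hL' : ContMDiff (totalModel B' F') (modelWithCornersSelf ℝ ℝ) ∞ L') :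
    ∃ μ : E' a.proj →ₗ[ℝ] ℝ, ∀ b, μ b = vertHess L' a d b :=
  ⟨(fibreHess B' L' a a (fibreCoord F' a.proj
      (⟨a.proj, d⟩ : TotalSpace F' E'))).toLinearMap.comp
      (fibreEquiv F' (E := E') (mem_baseSet a.proj)).toLinearMap,
    fun b => (vertHess_eq hL' (mem_chart_source _ a) d b).symm⟩

/-- The change of ω_L(z,·) is -Hess L(d,·), which annihilates D by assumption and is absorbed into
the multiplier. The formula for that change is obtained by passing to E', since L = L'∘Φ. -/
theorem ConstrainedSystem.SatisfiesLdA.add_vertLift [FiniteDimensional ℝ B] [T2Space M]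
    [FiniteDimensional ℝ B'] [T2Space M'] (h : IsMorphism A A' φ Φ)
    (hL : ∀ a, C.L a = C'.L (totalMap F F' Φ a))
    {a : TotalSpace F E} {z : Pair B a} (hz : C.SatisfiesLdA A a z) {d : E a.proj}
    (hd : d ∈ C.D a.proj) (hdD : ∀ b ∈ C.D a.proj, vertHess C.L a d b = 0) :
    C.SatisfiesLdA A a (z + vertLift a d) := by
  obtain ⟨⟨hz1, hz2, hz3⟩, hz4, lam, hlam, heq⟩ := hz
  have hfst : (z + vertLift a d).1 = z.1 := add_zero z.1
  have hLf : C.L = fun c => C'.L (totalMap F F' Φ c) := funext hL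
  have hmem := Submodule.add_mem _ hz1 (vertLift_mem_prolongation A a d)
  obtain ⟨μ, hμ⟩ := exists_linearMap_vertHess a d C.contMDiff_L
  refine ⟨⟨hmem, ?_, hz3.add_vertVector hd⟩, hfst.trans hz4, lam - μ, ?_, ?_⟩
  · rw [hfst]
    exact hz2
  · intro b hb
    rw [LinearMap.sub_apply, hlam b hb, hμ, hdD b hb, sub_zero]
  · intro w hw
    have h1 := h.cartanTwo_prolMap C'.contMDiff_L hmem hw
    have h2 := h.cartanTwo_prolMap C'.contMDiff_L hz1 hw
    have h3 := h.cartanTwo_add_vertLift C'.contMDiff_L hz1 hw (h.prolMap_mem hz1)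
      (h.prolMap_mem hw) rfl rfl (Φ a.proj d)
    rw [← prolMap_add_vertLift h.contMDiff_total, h1, h2] at h3
    have h4 := vertHess_totalMap Φ C'.L a d w.1
    rw [← hLf] at h3 h4
    have h5 : cartanTwo A C.L a (z + vertLift a d) w =
        cartanTwo A C.L a z w - vertHess C.L a d w.1 :=
      h3.trans (congrArg (fun r => cartanTwo A C.L a z w - r) h4.symm)
    rw [h5, LinearMap.sub_apply, hμ, ← heq w hw]
    ring

end

end

/-! ### Frames of the constraint subbundle and pointwise uniqueness -/

/-- The linear map with prescribed images of the standard basis vectors. -/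
def columnsMap (k : ℕ) (V : Type*) [NormedAddCommGroup V] [NormedSpace ℝ V] :
    (Fin k → V) →L[ℝ] ((Fin k → ℝ) →L[ℝ] V) :=
  ∑ i, (ContinuousLinearMap.smulRightL ℝ (Fin k → ℝ) V
    (ContinuousLinearMap.proj i : (Fin k → ℝ) →L[ℝ] ℝ)).comp (ContinuousLinearMap.proj i)

theorem columnsMap_apply {k : ℕ} {V : Type*} [NormedAddCommGroup V] [NormedSpace ℝ V]
    (w : Fin k → V) (u : Fin k → ℝ) : columnsMap k V w u = ∑ i, u i • w i := by
  simp [columnsMap]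

/-- A smooth subbundle is locally the injective image of a smooth family `S` of linear maps with a
smooth family `R` of left inverses. -/
theorem IsSmoothSubbundle.exists_frame [FiniteDimensional ℝ F] {D : ∀ x, Submodule ℝ (E x)}
    (hD : IsSmoothSubbundle B F D) (x : M) :
    ∃ (U : Set M) (k : ℕ) (S : M → (Fin k → ℝ) →L[ℝ] F) (R : M → F →L[ℝ] (Fin k → ℝ)),
      IsOpen U ∧ x ∈ U ∧ U ⊆ (trivializationAt F E x).baseSet ∧
      ContMDiffOn (modelWithCornersSelf ℝ B) (modelWithCornersSelf ℝ ((Fin k → ℝ) →L[ℝ] F)) ∞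
        S U ∧
      ContMDiffOn (modelWithCornersSelf ℝ B) (modelWithCornersSelf ℝ (F →L[ℝ] (Fin k → ℝ))) ∞
        R U ∧
      ∀ y ∈ U, Module.finrank ℝ (D y) = k ∧ (∀ u, R y (S y u) = u) ∧
        ∀ b : E y, b ∈ D y ↔ ∃ u, S y u = fibreCoord F x (⟨y, b⟩ : TotalSpace F E) := by
  obtain ⟨U, k, s, hU, hxU, hs, hfr⟩ := hD x
  set U₁ := U ∩ (trivializationAt F E x).baseSet with hU₁
  have hU₁o : IsOpen U₁ := hU.inter (trivializationAt F E x).open_baseSet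
  let S : M → (Fin k → ℝ) →L[ℝ] F := fun y =>
    columnsMap k F fun i => fibreCoord F x (⟨y, s i y⟩ : TotalSpace F E)
  have hSc : ContMDiffOn (modelWithCornersSelf ℝ B)
      (modelWithCornersSelf ℝ ((Fin k → ℝ) →L[ℝ] F)) ∞ S U₁ := by
    refine (columnsMap k F).contMDiff.comp_contMDiffOn (contMDiffOn_pi_space.2 fun i => ?_)
    intro y hy
    exact ContMDiffAt.comp_contMDiffWithinAt (g := (fibreCoord F x : TotalSpace F E → F))
      (f := fun y => (⟨y, s i y⟩ : TotalSpace F E)) y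
      (contMDiffAt_fibreCoord (a := ⟨y, s i y⟩) hy.2) ((hs i y hy.1).mono inter_subset_left)
  have hS : ∀ y ∈ U₁, ∀ u,
      S y u = fibreCoord F x (⟨y, ∑ i, u i • s i y⟩ : TotalSpace F E) := by
    intro y hy u
    rw [fibreCoord_sum hy.2]
    refine (columnsMap_apply _ u).trans
      (Finset.sum_congr rfl fun i _ => (fibreCoord_smul hy.2 _ _).symm)
  have hinj : Function.Injective (S x) := by
    intro u v huv
    rw [hS x ⟨hxU, mem_baseSet x⟩, hS x ⟨hxU, mem_baseSet x⟩] at huv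
    have h1 := eq_of_fibreCoord_eq (mem_baseSet x) huv
    exact linearIndependent_iff_injective_fintypeLinearCombination.1 (hfr x hxU).1 h1
  obtain ⟨𝒰, K, h𝒰, hx𝒰, hK, hKinv⟩ := exists_leftInverse_extension (S x) hinj
  refine ⟨U₁ ∩ S ⁻¹' 𝒰, k, S, K ∘ S, hSc.continuousOn.isOpen_inter_preimage hU₁o h𝒰,
    ⟨⟨hxU, mem_baseSet x⟩, hx𝒰⟩, fun y hy => hy.1.2, hSc.mono inter_subset_left,
    hK.contMDiffOn.comp (hSc.mono inter_subset_left) fun y hy => hy.2, ?_⟩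
  rintro y ⟨hy, hy𝒰⟩
  refine ⟨?_, hKinv _ hy𝒰, fun b => ?_⟩
  · rw [← (hfr y hy.1).2, finrank_span_eq_card (hfr y hy.1).1, Fintype.card_fin]
  · rw [← (hfr y hy.1).2, Submodule.mem_span_range_iff_exists_fun]
    refine exists_congr fun u => ⟨fun h => (hS y hy u).trans (by rw [h]), fun h => ?_⟩
    exact eq_of_fibreCoord_eq hy.2 ((hS y hy u).symm.trans h)

/-- With a frame S and its left inverse R, the function (1 - S R) of the fibre coordinate vanishes
on D, so its derivative vanishes along v and w. Along d^V that derivative is (1 - S R) d, and its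
vanishing means d lies in D. -/
theorem ConstrainedSystem.IsTangent.mem_of_eq_add [FiniteDimensional ℝ F]
    {C : ConstrainedSystem B F E} {a : TotalSpace F E} {v w : TangentSpace (totalModel B F) a}
    (hv : C.IsTangent a v) (hw : C.IsTangent a w) {d : E a.proj} (h : v = w + vertVector a d) :
    d ∈ C.D a.proj := by
  obtain ⟨U, k, S, R, hU, hxU, hUb, hS, hR, hfr⟩ := C.isSmoothSubbundle_D.exists_frame a.proj
  set q : TotalSpace F E → F := fun c => fibreCoord F a.proj c -
    (S c.proj).comp (R c.proj) (fibreCoord F a.proj c) with hq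
  have hfc := contMDiffAt_fibreCoord (B := B) (E := E) (F := F) (a := a) (mem_baseSet a.proj)
  have hproj : ContMDiffAt (totalModel B F) (modelWithCornersSelf ℝ B) ∞
      (TotalSpace.proj : TotalSpace F E → M) a := (Bundle.contMDiff_proj E).contMDiffAt
  have hSa := (hS.contMDiffAt (hU.mem_nhds hxU)).comp a hproj
  have hRa := (hR.contMDiffAt (hU.mem_nhds hxU)).comp a hproj
  have hqd : MDifferentiableAt (totalModel B F) (modelWithCornersSelf ℝ F) q a :=
    (hfc.sub ((hSa.clm_comp hRa).clm_apply hfc)).mdifferentiableAt (by simp)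
  have h0 : ∀ᶠ c in 𝓝 a, c ∈ C.space → q c = 0 := by
    filter_upwards [hproj.continuousAt.eventually (hU.mem_nhds hxU)] with c hc hcD
    obtain ⟨u, hu⟩ := ((hfr c.proj hc).2.2 c.snd).1 hcD
    have hu' : S c.proj u = fibreCoord F a.proj c := hu
    change fibreCoord F a.proj c - S c.proj (R c.proj (fibreCoord F a.proj c)) = 0
    rw [← hu', (hfr c.proj hc).2.1, sub_self]
  have h1 := hv.mfderiv_eq_zero hqd h0
  have h2 := hw.mfderiv_eq_zero hqd h0
  have h3 : (mfderiv (totalModel B F) (modelWithCornersSelf ℝ F) q a v : F) =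
      mfderiv (totalModel B F) (modelWithCornersSelf ℝ F) q a w +
        mfderiv (totalModel B F) (modelWithCornersSelf ℝ F) q a (vertVector a d) :=
    (congrArg (mfderiv (totalModel B F) (modelWithCornersSelf ℝ F) q a) h).trans
      ((mfderiv (totalModel B F) (modelWithCornersSelf ℝ F) q a).map_add w (vertVector a d))
  have h4 : (mfderiv (totalModel B F) (modelWithCornersSelf ℝ F) q a (vertVector a d) : F) =
      fibreCoord F a.proj (⟨a.proj, d⟩ : TotalSpace F E) - S a.proj (R a.proj
        (fibreCoord F a.proj (⟨a.proj, d⟩ : TotalSpace F E))) := by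
    refine (mfderiv_vertVector a d hqd).trans ((mfderiv_real_eq_deriv _ _).trans ?_)
    set P : F →L[ℝ] F := ContinuousLinearMap.id ℝ F - (S a.proj).comp (R a.proj) with hP
    have h5 : (fun t => q (fibreLine a d t)) = fun t : ℝ => P (fibreCoord F a.proj a +
        t • fibreCoord F a.proj (⟨a.proj, d⟩ : TotalSpace F E)) := by
      funext t
      rw [← fibreCoord_fibreLine (mem_baseSet a.proj)]
      rfl
    rw [h5]
    have h6 : HasDerivAt (fun t : ℝ => fibreCoord F a.proj a +
        t • fibreCoord F a.proj (⟨a.proj, d⟩ : TotalSpace F E))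
        (fibreCoord F a.proj (⟨a.proj, d⟩ : TotalSpace F E)) 0 := by
      simpa using ((hasDerivAt_id (0 : ℝ)).smul_const
        (fibreCoord F a.proj (⟨a.proj, d⟩ : TotalSpace F E))).const_add (fibreCoord F a.proj a)
    exact (P.hasFDerivAt.comp_hasDerivAt (0 : ℝ) h6).deriv
  rw [h1, h2, zero_add, h4] at h3
  exact ((hfr a.proj hxU).2.2 d).2 ⟨_, (sub_eq_zero.1 h3.symm).symm⟩

/-- The Hessian of the Lagrangian along the fibres is nondegenerate on the constraint space. -/
def ConstrainedSystem.IsNondegenerateAt (C : ConstrainedSystem B F E) (a : TotalSpace F E) :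
    Prop :=
  ∀ d ∈ C.D a.proj, (∀ b ∈ C.D a.proj, vertHess C.L a d b = 0) → d = 0

section
variable {φ : M → M'} {Φ : ∀ x, E x →ₗ[ℝ] E' (φ x)}
  {A : LieAlgebroid B F E} {A' : LieAlgebroid B' F' E'} {C' : ConstrainedSystem B' F' E'}

/-- Both elements are of second order, so they differ by d^V with d in D'. Subtracting the equations
on vectors of D', where the multipliers vanish, shows that d is in the kernel of the constrained
Hessian. -/
theorem ConstrainedSystem.SatisfiesLdA.eq_of_isNondegenerateAt [FiniteDimensional ℝ B] [T2Space M]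
    [FiniteDimensional ℝ B'] [T2Space M'] [FiniteDimensional ℝ F'] (h : IsEpimorphism A A' φ Φ)
    {a : TotalSpace F E} {z₁ z₂ : Pair B' (totalMap F F' Φ a)}
    (h₁ : C'.SatisfiesLdA A' (totalMap F F' Φ a) z₁)
    (h₂ : C'.SatisfiesLdA A' (totalMap F F' Φ a) z₂)
    (ha : C'.IsNondegenerateAt (totalMap F F' Φ a)) : z₁ = z₂ := by
  obtain ⟨⟨hm₁, -, ht₁⟩, hs₁, l₁, hl₁, he₁⟩ := h₁
  obtain ⟨⟨hm₂, hD₂, ht₂⟩, hs₂, l₂, hl₂, he₂⟩ := h₂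
  have hfst : z₁.1 = z₂.1 := hs₁.trans hs₂.symm
  have hm₁' : A'.anchor (φ a.proj) z₁.1 = _ := hm₁
  have hm₂' : A'.anchor (φ a.proj) z₂.1 = _ := hm₂
  rw [hfst] at hm₁'
  have hvert : mfderiv (totalModel B' F') (modelWithCornersSelf ℝ B')
      (TotalSpace.proj : TotalSpace F' E' → M') (totalMap F F' Φ a) (z₁.2 - z₂.2) = 0 := by
    rw [map_sub, sub_eq_zero]
    exact hm₁'.symm.trans hm₂'
  obtain ⟨d, hd⟩ := exists_eq_vertVector _ hvert
  have hadd : z₁.2 = z₂.2 + vertVector (totalMap F F' Φ a) d :=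
    (add_sub_cancel z₂.2 z₁.2).symm.trans (congrArg (fun v => z₂.2 + v) hd)
  have hz : z₁ = z₂ + vertLift (totalMap F F' Φ a) d :=
    Prod.ext (hfst.trans (add_zero z₂.1).symm) hadd
  have hdD := ht₁.mem_of_eq_add ht₂ hadd
  have hd0 : d = 0 := by
    refine ha d hdD fun b hb => ?_
    obtain ⟨c, hc⟩ := h.surjective a.proj z₂.1
    obtain ⟨z, hzm, hz1, -⟩ := h.exists_prolMap_eq hm₂ hc
    obtain ⟨v, hv⟩ := exists_mem_prolongation A' (totalMap F F' Φ a) b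
    obtain ⟨e, he⟩ := h.surjective a.proj b
    obtain ⟨w, hwm, hw1, -⟩ := h.exists_prolMap_eq hv he
    have e1 := he₁ _ hv
    have e2 := he₂ _ hv
    rw [hz] at e1
    have e3 := h.isMorphism.cartanTwo_add_vertLift C'.contMDiff_L hzm hwm hm₂ hv
      (by rw [hz1, hc]) (by rw [hw1, he]) d
    have e4 : (cartanTwo A' C'.L (totalMap F F' Φ a) z₂ (b, v) -
        vertHess C'.L (totalMap F F' Φ a) d b) -
        prolDiff (energy B' C'.L) (totalMap F F' Φ a) (b, v) = 0 :=
      (congrArg (fun r => r - prolDiff (energy B' C'.L) (totalMap F F' Φ a) (b, v)) e3.symm).trans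
        (e1.trans (hl₁ b hb))
    have e5 := e2.trans (hl₂ b hb)
    linarith
  rw [hz, hd0]
  exact Prod.ext (add_zero z₂.1)
    ((congrArg (fun v => z₂.2 + v) (vertVector_zero (totalMap F F' Φ a))).trans (add_zero z₂.2))

end

/-! ### Regularity makes the constrained Hessian nondegenerate on a dense set -/

set_option synthInstance.maxHeartbeats 60000 in
/-- If the constrained fibre Hessian degenerates on a nonempty open part of the constraint space,
then some smooth vertical field tangent to it lies in the kernel of the Hessian everywhere and does
not vanish identically. -/
theorem ConstrainedSystem.exists_vertical_kernel_field [FiniteDimensional ℝ B]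
    [FiniteDimensional ℝ F] [T2Space M] (C : ConstrainedSystem B F E) {a₀ : TotalSpace F E}
    (ha₀ : a₀ ∈ C.space) {O : Set (TotalSpace F E)} (hO : O ∈ 𝓝 a₀)
    (hdeg : ∀ a ∈ O, a ∈ C.space → ¬ C.IsNondegenerateAt a) :
    ∃ δ : ∀ c : TotalSpace F E, E c.proj,
      ContMDiff (totalModel B F) (totalModel B F).tangent ∞
        (fun c => (⟨c, vertVector c (δ c)⟩ : TangentBundle (totalModel B F) (TotalSpace F E))) ∧
      (∀ c ∈ C.space, δ c ∈ C.D c.proj ∧ ∀ b ∈ C.D c.proj, vertHess C.L c (δ c) b = 0) ∧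
      ∃ a ∈ C.space, δ a ≠ 0 := by
  have hT2 : T2Space (TotalSpace F E) := t2Space_totalSpace
  have h1M : IsManifold (totalModel B F) 1 (TotalSpace F E) := .of_le (n := ∞) (by simp)
  obtain ⟨U, k, S, R, hU, hxU, hUb, hS, hR, hfr⟩ := C.isSmoothSubbundle_D.exists_frame a₀.proj
  have hproj : ContMDiff (totalModel B F) (modelWithCornersSelf ℝ B) ∞
      (TotalSpace.proj : TotalSpace F E → M) := Bundle.contMDiff_proj E
  set W : Set (TotalSpace F E) :=
    (interior O ∩ (chartAt (ModelProd B F) a₀).source) ∩ TotalSpace.proj ⁻¹' U with hW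
  have hWo : IsOpen W := (isOpen_interior.inter (chartAt (ModelProd B F) a₀).open_source).inter
    (hU.preimage hproj.continuous)
  have ha₀W : a₀ ∈ W := ⟨⟨mem_interior_iff_mem_nhds.2 hO, mem_chart_source _ _⟩, hxU⟩
  -- The constrained Hessian expressed in the frame S, as a smooth family of maps from ℝ^k to its
  -- dual.
  let T : TotalSpace F E → (Fin k → ℝ) →L[ℝ] (Fin k → ℝ) →L[ℝ] ℝ := fun c =>
    ((ContinuousLinearMap.compL ℝ (Fin k → ℝ) F ℝ).flip (S c.proj)).comp
      ((fibreHess B C.L a₀ c).comp (S c.proj))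
  have hSW : ContMDiffOn (totalModel B F) (modelWithCornersSelf ℝ ((Fin k → ℝ) →L[ℝ] F)) ∞
      (fun c : TotalSpace F E => S c.proj) W :=
    hS.comp hproj.contMDiffOn fun c hc => hc.2
  have hTW : ContMDiffOn (totalModel B F)
      (modelWithCornersSelf ℝ ((Fin k → ℝ) →L[ℝ] (Fin k → ℝ) →L[ℝ] ℝ)) ∞ T W :=
    ContMDiffOn.clm_comp (hSW.clm_precomp (F₃ := ℝ))
      (((contMDiffOn_fibreHess C.contMDiff_L a₀).mono fun c hc => hc.1.2).clm_comp hSW)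
  have hT : ∀ c ∈ W, ∀ (d b : E c.proj) u v,
      S c.proj u = fibreCoord F a₀.proj (⟨c.proj, d⟩ : TotalSpace F E) →
      S c.proj v = fibreCoord F a₀.proj (⟨c.proj, b⟩ : TotalSpace F E) →
      vertHess C.L c d b = T c u v := by
    intro c hc d b u v hu hv
    rw [vertHess_eq C.contMDiff_L hc.1.2, ← hu, ← hv]
    rfl
  -- The rank is at most k, so it attains a maximum on the part of D in W. At such a point kernel
  -- vectors extend smoothly within D.
  obtain ⟨n, ⟨a₁, ha₁W, ha₁C, hn⟩, hmax⟩ : ∃ n, (∃ c ∈ W, c ∈ C.space ∧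
      Module.finrank ℝ (T c).range = n) ∧ ∀ c ∈ W, c ∈ C.space →
      Module.finrank ℝ (T c).range ≤ n := by
    have hb : ∀ m ∈ {m | ∃ c ∈ W, c ∈ C.space ∧ Module.finrank ℝ (T c).range = m}, m ≤ k := by
      rintro m ⟨c, -, -, rfl⟩
      refine (LinearMap.finrank_range_le (T c).toLinearMap).trans ?_
      simp
    have hne : {m | ∃ c ∈ W, c ∈ C.space ∧ Module.finrank ℝ (T c).range = m}.Nonempty :=
      ⟨_, a₀, ha₀W, ha₀, rfl⟩
    exact ⟨_, Nat.sSup_mem hne ⟨k, hb⟩, fun c h1 h2 => le_csSup ⟨k, hb⟩ ⟨c, h1, h2, rfl⟩⟩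
  obtain ⟨u₀, hu₀, hTu₀⟩ : ∃ u₀, u₀ ≠ 0 ∧ T a₁ u₀ = 0 := by
    have h1 := hdeg a₁ (interior_subset ha₁W.1.1) ha₁C
    unfold ConstrainedSystem.IsNondegenerateAt at h1
    push Not at h1
    obtain ⟨d, hd, hdb, hd0⟩ := h1
    obtain ⟨u, hu⟩ := ((hfr _ ha₁W.2).2.2 d).1 hd
    refine ⟨u, ?_, ?_⟩
    · rintro rfl
      refine hd0 (eq_of_fibreCoord_eq (hUb ha₁W.2) ?_)
      rw [← hu, map_zero, ← fibreEquiv_apply (hUb ha₁W.2), map_zero]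
    · ext1 v
      set b : E a₁.proj := (fibreEquiv F (hUb ha₁W.2)).symm (S a₁.proj v) with hbdef
      have hv : S a₁.proj v = fibreCoord F a₀.proj (⟨a₁.proj, b⟩ : TotalSpace F E) :=
        ((fibreEquiv F (hUb ha₁W.2)).apply_symm_apply _).symm
      rw [← hT a₁ ha₁W d b u v hu hv]
      exact hdb b (((hfr _ ha₁W.2).2.2 b).2 ⟨v, hv⟩)
  obtain ⟨𝒰, K, h𝒰, ha₁𝒰, hK, hKu₀, hker⟩ := exists_kernel_extension (T a₁) u₀ hTu₀
  set W₂ := W ∩ T ⁻¹' 𝒰 with hW₂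
  have hW₂o : IsOpen W₂ := hTW.continuousOn.isOpen_inter_preimage hWo h𝒰
  -- The extended kernel vector, moved back from frame coordinates to the fibre. It is defined off D
  -- too, but lies in the kernel only on D, where the rank bound holds.
  let κ : ∀ c : TotalSpace F E, E c.proj := fun c =>
    constSection E a₀.proj (S c.proj (K (T c))) c.proj
  have hκ : ∀ c ∈ W₂, S c.proj (K (T c)) =
      fibreCoord F a₀.proj (⟨c.proj, κ c⟩ : TotalSpace F E) := fun c hc =>
    (fibreCoord_constSection (hUb hc.1.2) _).symm
  have hκs : ContMDiffOn (totalModel B F) (totalModel B F).tangent ∞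
      (fun c => (⟨c, vertVector c (κ c)⟩ : TangentBundle (totalModel B F) (TotalSpace F E)))
      W₂ := by
    rw [contMDiffOn_tangent_iff (a := a₀) hW₂o fun c hc => hc.1.1.2]
    have h1 : ContMDiffOn (totalModel B F) (modelWithCornersSelf ℝ F) ∞
        (fun c => S c.proj (K (T c))) W₂ :=
      (hSW.mono inter_subset_left).clm_apply
        (hK.contMDiffOn.comp (hTW.mono inter_subset_left) fun c hc => hc.2)
    refine ((ContinuousLinearMap.inr ℝ B F).contMDiff.comp_contMDiffOn h1).congr fun c hc => ?_
    refine (mfderiv_extChartAt_total_apply hc.1.1.2 _).trans ?_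
    refine Prod.ext ?_ ?_
    · exact (congrArg (mfderiv (modelWithCornersSelf ℝ B) (modelWithCornersSelf ℝ B)
        (extChartAt (modelWithCornersSelf ℝ B) a₀.proj) c.proj)
        (mfderiv_proj_vertVector c (κ c))).trans (map_zero _)
    · exact (mfderiv_fibreCoord_vertVector c (hUb hc.1.2) (κ c)).trans (hκ c hc).symm
  obtain ⟨f, hf, hf1, hft⟩ := exists_bump (I := totalModel B F)
    (hW₂o.mem_nhds (⟨ha₁W, ha₁𝒰⟩ : a₁ ∈ W₂))
  refine ⟨fun c => f c • κ c, ?_, ?_, a₁, ha₁C, ?_⟩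
  · have h1 := ContMDiffOn.smul_section_of_tsupport (V := TangentSpace (totalModel B F))
      (s := fun c => vertVector c (κ c)) hf.contMDiffOn hW₂o hft hκs
    refine h1.congr fun c => ?_
    exact congrArg (fun v => (⟨c, v⟩ : TangentBundle (totalModel B F) (TotalSpace F E)))
      (vertVector_smul c (f c) (κ c))
  · intro c hc
    by_cases hcW : c ∈ W₂
    · have hκD : κ c ∈ C.D c.proj := ((hfr _ hcW.1.2).2.2 _).2 ⟨_, hκ c hcW⟩
      refine ⟨Submodule.smul_mem _ _ hκD, fun b hb => ?_⟩
      obtain ⟨v, hv⟩ := ((hfr _ hcW.1.2).2.2 b).1 hb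
      have hfκ : S c.proj (f c • K (T c)) =
          fibreCoord F a₀.proj (⟨c.proj, f c • κ c⟩ : TotalSpace F E) := by
        rw [fibreCoord_smul (hUb hcW.1.2), map_smul, hκ c hcW]
      rw [hT c hcW.1 _ b _ v hfκ hv, map_smul, hker _ hcW.2 ((hmax c hcW.1 hc).trans hn.ge),
        smul_zero]
      rfl
    · have hf0 : f c = 0 := image_eq_zero_of_notMem_tsupport fun h => hcW (hft h)
      simp only [hf0, zero_smul]
      exact ⟨Submodule.zero_mem _, fun b _ => vertHess_zero_left C.contMDiff_L c b⟩
  · have h1 : f a₁ = 1 := hf1.self_of_nhds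
    simp only [h1, one_smul]
    intro h2
    have h3 := hκ a₁ ⟨ha₁W, ha₁𝒰⟩
    rw [h2, ← fibreEquiv_apply (hUb ha₁W.2), map_zero, hKu₀] at h3
    have h4 := (hfr _ ha₁W.2).2.1 u₀
    rw [h3, map_zero] at h4
    exact hu₀ h4.symm

section
variable {φ : M → M'} {Φ : ∀ x, E x →ₗ[ℝ] E' (φ x)}
  {A : LieAlgebroid B F E} {A' : LieAlgebroid B' F' E'}
  {C : ConstrainedSystem B F E} {C' : ConstrainedSystem B' F' E'}

/-- The constrained fibre Hessian of a regular system is nondegenerate on a dense set. -/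
theorem ConstrainedSystem.IsRegular.exists_isNondegenerateAt [FiniteDimensional ℝ B]
    [FiniteDimensional ℝ F] [T2Space M] [FiniteDimensional ℝ B'] [T2Space M']
    (h : IsMorphism A A' φ Φ) (hL : ∀ a, C.L a = C'.L (totalMap F F' Φ a))
    (hreg : C.IsRegular A) {a₀ : TotalSpace F E} (ha₀ : a₀ ∈ C.space)
    {O : Set (TotalSpace F E)} (hO : O ∈ 𝓝 a₀) :
    ∃ a ∈ O, a ∈ C.space ∧ C.IsNondegenerateAt a := by
  by_contra! hdeg
  obtain ⟨δ, hδ, hδC, a₁, ha₁, hne⟩ := C.exists_vertical_kernel_field ha₀ hO hdeg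
  have h1M : IsManifold (totalModel B F) 1 (TotalSpace F E) := .of_le (n := ∞) (by simp)
  obtain ⟨Γ, hΓ, huniq⟩ := hreg
  have hfst : ∀ c, (Γ c + vertLift c (δ c)).1 = (Γ c).1 := fun c => add_zero (Γ c).1
  -- A second solution, different from Γ at a₁.
  have hsol : C.IsSolution A fun c => Γ c + vertLift c (δ c) := by
    refine ⟨?_, ?_, fun c hc => (hΓ.satisfiesLdA c hc).add_vertLift h hL (hδC c hc).1
      (hδC c hc).2⟩
    · simpa only [hfst] using hΓ.contMDiffOn_fst
    · exact ContMDiffOn.add_section (V := TangentSpace (totalModel B F))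
        (s := fun c => (Γ c).2) (t := fun c => vertVector c (δ c)) hΓ.contMDiffOn_snd
        hδ.contMDiffOn
  have h1 := huniq _ hsol a₁ ha₁
  have h2 : (Γ a₁).2 + vertVector a₁ (δ a₁) = (Γ a₁).2 := congrArg Prod.snd h1
  have h3 : vertVector (B := B) a₁ (δ a₁) = 0 := add_eq_left.1 h2
  exact hne (vertVector_injective a₁ (h3.trans (vertVector_zero a₁).symm))

end

/-! ### Local sections of the reduction map on D -/

/-- A submersion has smooth local sections through every point. -/
theorem exists_local_section {φ : M → M'}
    (hφ : Manifold.IsSubmersion (modelWithCornersSelf ℝ B) (modelWithCornersSelf ℝ B') ∞ φ)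
    (x : M) : ∃ (N : Set M') (ψ : M' → M), IsOpen N ∧ φ x ∈ N ∧ ψ (φ x) = x ∧
      ContMDiffOn (modelWithCornersSelf ℝ B') (modelWithCornersSelf ℝ B) ∞ ψ N ∧
      ∀ y ∈ N, φ (ψ y) = y := by
  obtain ⟨G, _, _, hG⟩ := hφ
  have h := hG x
  set e := h.domChart with he
  set e' := h.codChart with he'
  set L := h.equiv with hLdef
  have hx : x ∈ e.source := h.mem_domChart_source
  have hsrc : ∀ y ∈ e.source, φ y ∈ e'.source := fun y hy => h.source_subset_preimage_source hy
  have hcharts : ∀ w ∈ e.target, e' (φ (e.symm w)) = (L w).1 := by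
    intro w hw
    have hw' : w ∈ (h.domChart.extend (modelWithCornersSelf ℝ B)).target := by
      simpa [OpenPartialHomeomorph.extend] using hw
    exact h.writtenInCharts hw'
  -- In adapted charts φ is a linear projection. The section keeps the complementary coordinate at
  -- its value for x.
  set g : M' → B := fun y => L.symm (e' y, (L (e x)).2) with hg
  have hgc : ContMDiffOn (modelWithCornersSelf ℝ B') (modelWithCornersSelf ℝ B) ∞ g e'.source := by
    have h1 : ContMDiff (modelWithCornersSelf ℝ B') (modelWithCornersSelf ℝ B) ∞
        fun w : B' => L.symm (w, (L (e x)).2) :=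
      (L.symm.contDiff.comp (contDiff_id.prodMk contDiff_const)).contMDiff
    exact h1.comp_contMDiffOn (contMDiffOn_of_mem_maximalAtlas h.codChart_mem_maximalAtlas)
  have hgx : g (φ x) = e x := by
    have h1 := hcharts (e x) (e.map_source hx)
    rw [e.left_inv hx] at h1
    change L.symm (e' (φ x), (L (e x)).2) = e x
    rw [h1, Prod.mk.eta, L.symm_apply_apply]
  refine ⟨e'.source ∩ g ⁻¹' e.target, e.symm ∘ g,
    hgc.continuousOn.isOpen_inter_preimage e'.open_source e.open_target,
    ⟨hsrc x hx, ?_⟩, ?_, ?_, ?_⟩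
  · rw [mem_preimage, hgx]
    exact e.map_source hx
  · rw [Function.comp_apply, hgx, e.left_inv hx]
  · exact (contMDiffOn_symm_of_mem_maximalAtlas h.domChart_mem_maximalAtlas).comp
      (hgc.mono inter_subset_left) fun y hy => hy.2
  · rintro y ⟨hy, hgy⟩
    refine e'.injOn (hsrc _ (e.map_target hgy)) hy ?_
    refine (hcharts (g y) hgy).trans ?_
    change (L (L.symm (e' y, (L (e x)).2))).1 = e' y
    rw [L.apply_symm_apply]

theorem finrank_map_eq_iff {V W : Type*} [AddCommGroup V] [Module ℝ V] [FiniteDimensional ℝ V]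
    [AddCommGroup W] [Module ℝ W] (f : V →ₗ[ℝ] W) (p : Submodule ℝ V) :
    Module.finrank ℝ (p.map f) = Module.finrank ℝ p ↔ ∀ d ∈ p, f d = 0 → d = 0 := by
  have h1 := (f.domRestrict p).finrank_range_add_finrank_ker
  rw [LinearMap.range_domRestrict] at h1
  have h2 : Module.finrank ℝ (LinearMap.ker (f.domRestrict p)) = 0 ↔
      ∀ d ∈ p, f d = 0 → d = 0 := by
    rw [Submodule.finrank_eq_zero, LinearMap.ker_eq_bot']
    exact ⟨fun h d hd hfd => congrArg Subtype.val (h ⟨d, hd⟩ hfd),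
      fun h d hd => Subtype.ext (h d d.2 hd)⟩
  rw [← h2]
  omega

section
variable {φ : M → M'} {Φ : ∀ x, E x →ₗ[ℝ] E' (φ x)}
  {A : LieAlgebroid B F E} {A' : LieAlgebroid B' F' E'}
  {C : ConstrainedSystem B F E} {C' : ConstrainedSystem B' F' E'}

/-- L is constant along ker Φ, so a vector of D killed by Φ lies in the kernel of the constrained
Hessian. -/
theorem ConstrainedSystem.IsNondegenerateAt.eq_zero (hL : ∀ a, C.L a = C'.L (totalMap F F' Φ a))
    {a : TotalSpace F E} (ha : C.IsNondegenerateAt a) {d : E a.proj} (hd : d ∈ C.D a.proj)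
    (h0 : Φ a.proj d = 0) : d = 0 := by
  refine ha d hd fun b _ => ?_
  have h1 := vertHess_totalMap Φ C'.L a d b
  rw [h0, ← (funext hL : C.L = fun c => C'.L (totalMap F F' Φ c))] at h1
  exact h1.trans (vertHess_zero_left C'.contMDiff_L (totalMap F F' Φ a) _)

theorem ConstrainedSystem.IsNondegenerateAt.totalMap
    (hL : ∀ a, C.L a = C'.L (LieAlgd.totalMap F F' Φ a))
    (hD : ∀ x, (C.D x).map (Φ x) = C'.D (φ x)) {a : TotalSpace F E}
    (ha : C.IsNondegenerateAt a) : C'.IsNondegenerateAt (LieAlgd.totalMap F F' Φ a) := by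
  intro d' hd' h0
  obtain ⟨d, hd, rfl⟩ := (hD a.proj).ge hd'
  have h1 : d = 0 := by
    refine ha d hd fun b hb => ?_
    have h1 := vertHess_totalMap Φ C'.L a d b
    rw [← (funext hL : C.L = fun c => C'.L (LieAlgd.totalMap F F' Φ c))] at h1
    exact h1.trans (h0 _ ((hD a.proj).le (Submodule.mem_map_of_mem hb)))
  rw [h1]
  exact map_zero _

/-- Near x the ranks of D and of D'∘φ are constant. They agree at a nearby nondegenerate point,
where Φ is injective on D, hence also at x, where equality of ranks gives injectivity back. -/
theorem ConstrainedSystem.IsRegular.eq_zero_of_map_eq_zero [FiniteDimensional ℝ B]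
    [FiniteDimensional ℝ F] [T2Space M] [FiniteDimensional ℝ B'] [T2Space M']
    [FiniteDimensional ℝ F']
    (h : IsMorphism A A' φ Φ) (hL : ∀ a, C.L a = C'.L (totalMap F F' Φ a))
    (hD : ∀ x, (C.D x).map (Φ x) = C'.D (φ x)) (hreg : C.IsRegular A) {x : M} {d : E x}
    (hd : d ∈ C.D x) (h0 : Φ x d = 0) : d = 0 := by
  obtain ⟨U, k, _, _, hU, hxU, -, -, -, hfr⟩ := C.isSmoothSubbundle_D.exists_frame x
  obtain ⟨U', k', _, _, hU', hxU', -, -, -, hfr'⟩ := C'.isSmoothSubbundle_D.exists_frame (φ x)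
  have hO : TotalSpace.proj ⁻¹' (U ∩ φ ⁻¹' U') ∈ 𝓝 (⟨x, 0⟩ : TotalSpace F E) :=
    ((hU.inter (hU'.preimage h.contMDiff_base.continuous)).preimage
      (FiberBundle.continuous_proj F E)).mem_nhds ⟨hxU, hxU'⟩
  obtain ⟨a, ha, haC, hnd⟩ := hreg.exists_isNondegenerateAt h hL
    (Submodule.zero_mem _ : (⟨x, 0⟩ : TotalSpace F E) ∈ C.space) hO
  have hfin : ∀ y, FiniteDimensional ℝ (E y) := fun y =>
    (fibreEquiv F (mem_baseSet y)).symm.finiteDimensional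
  have h1 := (finrank_map_eq_iff (Φ a.proj) (C.D a.proj)).2 fun e he => hnd.eq_zero hL he
  rw [hD, (hfr' _ ha.2).1, (hfr _ ha.1).1] at h1
  refine (finrank_map_eq_iff (Φ x) (C.D x)).1 ?_ d hd h0
  rw [hD, (hfr' _ hxU').1, (hfr _ hxU).1, h1]

theorem exists_totalMap_eq (hφ : Function.Surjective φ)
    (hD : ∀ x, (C.D x).map (Φ x) = C'.D (φ x)) {c : TotalSpace F' E'} (hc : c ∈ C'.space) :
    ∃ a ∈ C.space, totalMap F F' Φ a = c := by
  obtain ⟨y, c⟩ := c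
  obtain ⟨x, rfl⟩ := hφ y
  obtain ⟨b, hb, rfl⟩ := (hD x).ge hc
  exact ⟨⟨x, b⟩, hb, rfl⟩

theorem exists_mem_totalMap_eq (hD : ∀ x, (C.D x).map (Φ x) = C'.D (φ x))
    {c : TotalSpace F' E'} (hc : c ∈ C'.space) {x : M} (hx : φ x = c.proj) :
    ∃ b ∈ C.D x, totalMap F F' Φ ⟨x, b⟩ = c := by
  obtain ⟨y, c⟩ := c
  obtain rfl : φ x = y := hx
  obtain ⟨b, hb, rfl⟩ := (hD x).ge hc
  exact ⟨b, hb, rfl⟩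

theorem contMDiffOn_lift {V H N : Type*} [NormedAddCommGroup V] [NormedSpace ℝ V]
    [TopologicalSpace H] {I : ModelWithCorners ℝ V H} [TopologicalSpace N] [ChartedSpace H N]
    {f : N → M} {w : N → F} {O : Set N} {x : M} (hO : IsOpen O)
    (hf : ContMDiffOn I (modelWithCornersSelf ℝ B) ∞ f O)
    (hfO : ∀ y ∈ O, f y ∈ (trivializationAt F E x).baseSet)
    (hw : ContMDiffOn I (modelWithCornersSelf ℝ F) ∞ w O) :
    ContMDiffOn I (totalModel B F) ∞
      (fun y => (⟨f y, constSection E x (w y) (f y)⟩ : TotalSpace F E)) O := by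
  intro y hy
  refine ContMDiffAt.contMDiffWithinAt ((contMDiffAt_iff_fibreCoord (hfO y hy)).2
    ⟨hf.contMDiffAt (hO.mem_nhds hy), ?_⟩)
  refine (hw.contMDiffAt (hO.mem_nhds hy)).congr_of_eventuallyEq ?_
  filter_upwards [hO.mem_nhds hy] with t ht
  exact fibreCoord_constSection (hfO t ht) (w t)

/-- Local sections of `totalMap Φ` that map `D'` to `D`. -/
theorem exists_local_section_totalMap [FiniteDimensional ℝ F] [FiniteDimensional ℝ F']
    (hΦ : IsEpimorphism A A' φ Φ) (hD : ∀ x, (C.D x).map (Φ x) = C'.D (φ x))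
    (hinj : ∀ (x : M), ∀ d ∈ C.D x, Φ x d = 0 → d = 0) {a : TotalSpace F E} (ha : a ∈ C.space) :
    ∃ (N : Set (TotalSpace F' E')) (s : TotalSpace F' E' → TotalSpace F E), IsOpen N ∧
      totalMap F F' Φ a ∈ N ∧ s (totalMap F F' Φ a) = a ∧
      ContMDiffOn (totalModel B' F') (totalModel B F) ∞ s N ∧
      ∀ c ∈ N, c ∈ C'.space → s c ∈ C.space ∧ totalMap F F' Φ (s c) = c := by
  obtain ⟨U, k, S, R, hU, hxU, hUb, hS, -, hfr⟩ := C.isSmoothSubbundle_D.exists_frame a.proj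
  obtain ⟨N₀, ψ, hN₀, hxN₀, hψx, hψ, hφψ⟩ := exists_local_section hΦ.isSubmersion a.proj
  set N₁ := (N₀ ∩ (trivializationAt F' E' (φ a.proj)).baseSet) ∩ ψ ⁻¹' U with hN₁
  have hN₁o : IsOpen N₁ := (hψ.continuousOn.mono inter_subset_left).isOpen_inter_preimage
    (hN₀.inter (trivializationAt F' E' (φ a.proj)).open_baseSet) hU
  have hxN₁ : φ a.proj ∈ N₁ := ⟨⟨hxN₀, mem_baseSet _⟩, by rw [mem_preimage, hψx]; exact hxU⟩
  have hψ₁ : ContMDiffOn (modelWithCornersSelf ℝ B') (modelWithCornersSelf ℝ B) ∞ ψ N₁ :=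
    hψ.mono fun y hy => hy.1.1
  have hSψ := hS.comp hψ₁ fun y hy => hy.2
  -- The frame of D along ψ pushed forward by Φ. It is a frame of D', and injectivity of Φ on D
  -- supplies smooth left inverses for it.
  let S' : M' → (Fin k → ℝ) →L[ℝ] F' := fun y => columnsMap k F' fun i =>
    fibreCoord F' (φ a.proj) (totalMap F F' Φ
      (⟨ψ y, constSection E a.proj (S (ψ y) (Pi.single i 1)) (ψ y)⟩ : TotalSpace F E))
  have hbase : ∀ y ∈ N₁, φ (ψ y) ∈ (trivializationAt F' E' (φ a.proj)).baseSet := by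
    intro y hy
    rw [hφψ y hy.1.1]
    exact hy.1.2
  have hS' : ContMDiffOn (modelWithCornersSelf ℝ B')
      (modelWithCornersSelf ℝ ((Fin k → ℝ) →L[ℝ] F')) ∞ S' N₁ := by
    refine (columnsMap k F').contMDiff.comp_contMDiffOn (contMDiffOn_pi_space.2 fun i => ?_)
    have h1 : ContMDiffOn (modelWithCornersSelf ℝ B') (totalModel B F) ∞ (fun y =>
        (⟨ψ y, constSection E a.proj (S (ψ y) (Pi.single i 1)) (ψ y)⟩ : TotalSpace F E)) N₁ := by
      refine contMDiffOn_lift hN₁o hψ₁ (fun y hy => hUb hy.2) ?_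
      exact hSψ.clm_apply contMDiffOn_const
    intro y hy
    exact ContMDiffAt.comp_contMDiffWithinAt (g := (fibreCoord F' (φ a.proj) :
      TotalSpace F' E' → F')) y (contMDiffAt_fibreCoord (hbase y hy))
      (hΦ.isMorphism.contMDiff_total.contMDiffAt.comp_contMDiffWithinAt y (h1 y hy))
  have hS'eq : ∀ y ∈ N₁, ∀ u, ∀ b : E (ψ y),
      S (ψ y) u = fibreCoord F a.proj (⟨ψ y, b⟩ : TotalSpace F E) →
      S' y u = fibreCoord F' (φ a.proj) (totalMap F F' Φ (⟨ψ y, b⟩ : TotalSpace F E)) := by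
    intro y hy u b hb
    have h1 : b = ∑ i, u i • constSection E a.proj (S (ψ y) (Pi.single i 1)) (ψ y) := by
      refine eq_of_fibreCoord_eq (hUb hy.2) ?_
      rw [← hb, fibreCoord_sum (hUb hy.2)]
      simp only [fibreCoord_smul (hUb hy.2), fibreCoord_constSection (hUb hy.2)]
      conv_lhs => rw [pi_eq_sum_univ' u]
      rw [map_sum]
      simp only [map_smul]
    rw [h1]
    refine (columnsMap_apply _ u).trans ?_
    have h2 : totalMap F F' Φ (⟨ψ y, ∑ i, u i • constSection E a.proj
        (S (ψ y) (Pi.single i 1)) (ψ y)⟩ : TotalSpace F E) = ⟨φ (ψ y), ∑ i, u i •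
        Φ (ψ y) (constSection E a.proj (S (ψ y) (Pi.single i 1)) (ψ y))⟩ := by
      refine congrArg (TotalSpace.mk (φ (ψ y))) ?_
      change Φ (ψ y) (∑ i, u i • constSection E a.proj (S (ψ y) (Pi.single i 1)) (ψ y)) = _
      simp only [map_sum, map_smul]
    rw [h2, fibreCoord_sum (hbase y hy)]
    simp only [fibreCoord_smul (hbase y hy)]
    rfl
  have hS'inj : Function.Injective (S' (φ a.proj)) := by
    refine (injective_iff_map_eq_zero _).2 fun u hu => ?_
    have hy := hxN₁.2
    have h1 := hS'eq _ hxN₁ u ((fibreEquiv F (hUb hy)).symm (S (ψ (φ a.proj)) u))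
      ((fibreEquiv F (hUb hy)).apply_symm_apply _).symm
    have h2 : (fibreEquiv F (hUb hy)).symm (S (ψ (φ a.proj)) u) = 0 := by
      refine hinj _ _ (((hfr _ hy).2.2 _).2
        ⟨u, ((fibreEquiv F (hUb hy)).apply_symm_apply _).symm⟩) ?_
      refine eq_of_fibreCoord_eq (hbase _ hxN₁) ?_
      refine (h1.symm.trans hu).trans ?_
      rw [← fibreEquiv_apply (hbase _ hxN₁), map_zero]
    rw [LinearEquiv.map_eq_zero_iff] at h2
    have h3 := (hfr _ hy).2.1 u
    rw [h2, map_zero] at h3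
    exact h3.symm
  obtain ⟨𝒰, K, h𝒰, hx𝒰, hK, hKinv⟩ := exists_leftInverse_extension (S' (φ a.proj)) hS'inj
  set N₂ := N₁ ∩ S' ⁻¹' 𝒰 with hN₂
  have hN₂o : IsOpen N₂ := hS'.continuousOn.isOpen_inter_preimage hN₁o h𝒰
  have hproj : ContMDiff (totalModel B' F') (modelWithCornersSelf ℝ B') ∞
      (TotalSpace.proj : TotalSpace F' E' → M') := Bundle.contMDiff_proj E'
  set N : Set (TotalSpace F' E') := TotalSpace.proj ⁻¹' N₂ with hN
  have hNo : IsOpen N := hN₂o.preimage hproj.continuous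
  let w : TotalSpace F' E' → F := fun c =>
    S (ψ c.proj) (K (S' c.proj) (fibreCoord F' (φ a.proj) c))
  let s : TotalSpace F' E' → TotalSpace F E := fun c =>
    ⟨ψ c.proj, constSection E a.proj (w c) (ψ c.proj)⟩
  have hw : ContMDiffOn (totalModel B' F') (modelWithCornersSelf ℝ F) ∞ w N := by
    have h1 : ContMDiffOn (totalModel B' F') (modelWithCornersSelf ℝ ((Fin k → ℝ) →L[ℝ] F)) ∞
        (fun c : TotalSpace F' E' => S (ψ c.proj)) N :=
      hSψ.comp hproj.contMDiffOn fun c hc => hc.1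
    have h2 : ContMDiffOn (totalModel B' F')
        (modelWithCornersSelf ℝ (F' →L[ℝ] (Fin k → ℝ))) ∞
        (fun c : TotalSpace F' E' => K (S' c.proj)) N :=
      hK.contMDiffOn.comp (hS'.comp hproj.contMDiffOn fun c hc => hc.1) fun c hc => hc.2
    exact h1.clm_apply (h2.clm_apply fun c hc =>
      (contMDiffAt_fibreCoord hc.1.1.2).contMDiffWithinAt)
  have hs : ContMDiffOn (totalModel B' F') (totalModel B F) ∞ s N :=
    contMDiffOn_lift hNo (hψ₁.comp hproj.contMDiffOn fun c hc => hc.1)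
      (fun c hc => hUb hc.1.2) hw
  -- Over a point of D', s returns the unique preimage in D above ψ of the base point, because the
  -- frame coordinates are recovered by the left inverse.
  have hkey : ∀ c ∈ N, ∀ b ∈ C.D (ψ c.proj), totalMap F F' Φ (⟨ψ c.proj, b⟩ : TotalSpace F E) = c →
      s c = ⟨ψ c.proj, b⟩ := by
    intro c hc b hb hbc
    obtain ⟨u, hu⟩ := ((hfr _ hc.1.2).2.2 b).1 hb
    have h1 := hS'eq _ hc.1 u b hu
    rw [hbc] at h1
    refine congrArg (TotalSpace.mk (ψ c.proj)) (eq_of_fibreCoord_eq (hUb hc.1.2) ?_)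
    rw [fibreCoord_constSection (hUb hc.1.2)]
    change S (ψ c.proj) (K (S' c.proj) (fibreCoord F' (φ a.proj) c)) = _
    rw [← h1, hKinv _ hc.2, hu]
  refine ⟨N, s, hNo, ⟨hxN₁, hx𝒰⟩, ?_, hs, fun c hc hcC => ?_⟩
  · have h1 : ∀ z, z = a.proj → ∃ b : E z, (⟨z, b⟩ : TotalSpace F E) = a := by
      rintro _ rfl
      exact ⟨a.snd, rfl⟩
    obtain ⟨b, hb⟩ := h1 _ hψx
    have hbD : (⟨ψ (φ a.proj), b⟩ : TotalSpace F E) ∈ C.space :=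
      (congrArg (fun z => z ∈ C.space) hb).mpr ha
    exact (hkey (totalMap F F' Φ a) ⟨hxN₁, hx𝒰⟩ b hbD (congrArg (totalMap F F' Φ) hb)).trans hb
  · obtain ⟨b, hb, hbc⟩ := exists_mem_totalMap_eq hD hcC (hφψ c.proj hc.1.1.1)
    rw [hkey c hc b hb hbc]
    exact ⟨hb, hbc⟩

end

/-! ### Descent of the solution to D' -/

section

variable {φ : M → M'} {Φ : ∀ x, E x →ₗ[ℝ] E' (φ x)}
  {A : LieAlgebroid B F E} {A' : LieAlgebroid B' F' E'}
  {C : ConstrainedSystem B F E} {C' : ConstrainedSystem B' F' E'}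

/-- Moves the equation along an equality of base points. The first component is forced by the
second-order condition, and the vector is kept in model coordinates. -/
theorem ConstrainedSystem.SatisfiesLdA.transport {c e : TotalSpace F' E'} {z : Pair B' e}
    (hz : C'.SatisfiesLdA A' e z) (h : e = c) :
    C'.SatisfiesLdA A' c (c.snd, (tangentCoord z.2 : B' × F')) := by
  subst h
  have h1 : z = (e.snd, (tangentCoord z.2 : B' × F')) := Prod.ext hz.sode rfl
  exact h1 ▸ hz

/-- The field `TΦ ∘ X` along `Φ`, where `Γ(a) = (a, a, X(a))`. -/
def pushField (Φ : ∀ x, E x →ₗ[ℝ] E' (φ x)) (Γ : ∀ a : TotalSpace F E, Pair B a)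
    (a : TotalSpace F E) : TangentBundle (totalModel B' F') (TotalSpace F' E') :=
  tangentMap (totalModel B F) (totalModel B' F') (totalMap F F' Φ) ⟨a, (Γ a).2⟩

section
variable [FiniteDimensional ℝ B] [T2Space M] [FiniteDimensional ℝ F]
  [FiniteDimensional ℝ B'] [T2Space M'] [FiniteDimensional ℝ F']

/-- Nondegenerate points are dense in D, Φ sends them to nondegenerate points, and Φ maps D
continuously onto D'. -/
theorem subset_closure_isNondegenerateAt (h : IsMorphism A A' φ Φ) (hreg : C.IsRegular A)
    (hL : ∀ a, C.L a = C'.L (totalMap F F' Φ a)) (hφ : Function.Surjective φ)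
    (hD : ∀ x, (C.D x).map (Φ x) = C'.D (φ x)) {N : Set (TotalSpace F' E')} (hN : IsOpen N) :
    N ∩ C'.space ⊆ closure (N ∩ C'.space ∩ {c | C'.IsNondegenerateAt c}) := by
  rintro c ⟨hcN, hc⟩
  rw [mem_closure_iff_nhds]
  intro O hO
  obtain ⟨a₀, ha₀, rfl⟩ := exists_totalMap_eq hφ hD hc
  obtain ⟨a, ha, haC, hnd⟩ := hreg.exists_isNondegenerateAt h hL ha₀
    (h.contMDiff_total.continuous.continuousAt.preimage_mem_nhds
      (inter_mem hO (hN.mem_nhds hcN)))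
  exact ⟨totalMap F F' Φ a, ha.1, ⟨ha.2, totalMap_mem_space hD haC⟩, hnd.totalMap hL hD⟩

theorem eqOn_of_isNondegenerateAt (h : IsMorphism A A' φ Φ) (hreg : C.IsRegular A)
    (hL : ∀ a, C.L a = C'.L (totalMap F F' Φ a)) (hφ : Function.Surjective φ)
    (hD : ∀ x, (C.D x).map (Φ x) = C'.D (φ x)) {N : Set (TotalSpace F' E')} (hN : IsOpen N)
    {f g : TotalSpace F' E' → TangentBundle (totalModel B' F') (TotalSpace F' E')}
    (hf : ContinuousOn f (N ∩ C'.space)) (hg : ContinuousOn g (N ∩ C'.space))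
    (hfg : ∀ c ∈ N ∩ C'.space, C'.IsNondegenerateAt c → f c = g c) :
    EqOn f g (N ∩ C'.space) := by
  have h1 : T2Space (TotalSpace F' E') := t2Space_totalSpace
  have h1M : IsManifold (totalModel B' F') 1 (TotalSpace F' E') := .of_le (n := ∞) (by simp)
  have h2 : T2Space (TangentBundle (totalModel B' F') (TotalSpace F' E')) :=
    t2Space_totalSpace (F := B' × F') (E := TangentSpace (totalModel B' F'))
  exact Set.EqOn.of_subset_closure (fun c hc => hfg c hc.1 hc.2) hf hg inter_subset_left
    (subset_closure_isNondegenerateAt h hreg hL hφ hD hN)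

/-- Solutions agree at nondegenerate points by pointwise uniqueness, and elsewhere on D' by
continuity in the Hausdorff tangent bundle. Nondegeneracy everywhere is not required. -/
theorem ConstrainedSystem.IsSolution.eq_on_space (h : IsEpimorphism A A' φ Φ)
    (hreg : C.IsRegular A)
    (hL : ∀ a, C.L a = C'.L (totalMap F F' Φ a)) (hφ : Function.Surjective φ)
    (hD : ∀ x, (C.D x).map (Φ x) = C'.D (φ x))
    {Γ₁ Γ₂ : ∀ a : TotalSpace F' E', Pair B' a} (h₁ : C'.IsSolution A' Γ₁)
    (h₂ : C'.IsSolution A' Γ₂) {c : TotalSpace F' E'} (hc : c ∈ C'.space) : Γ₁ c = Γ₂ c := by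
  have h3 := eqOn_of_isNondegenerateAt h.isMorphism hreg hL hφ hD isOpen_univ
    (h₁.contMDiffOn_snd.continuousOn.mono inter_subset_right)
    (h₂.contMDiffOn_snd.continuousOn.mono inter_subset_right) (by
      rintro c ⟨-, hc⟩ hnd
      have h4 : Γ₁ c = Γ₂ c := by
        have h5 := h₁.satisfiesLdA c hc
        have h6 := h₂.satisfiesLdA c hc
        obtain ⟨a, -, rfl⟩ := exists_totalMap_eq hφ hD hc
        exact h5.eq_of_isNondegenerateAt h h6 hnd
      rw [h4]) ⟨mem_univ c, hc⟩
  refine Prod.ext ((h₁.satisfiesLdA c hc).sode.trans (h₂.satisfiesLdA c hc).sode.symm) ?_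
  exact (mk_tangent_eq_iff.1 h3).2

theorem pushField_eq_of_isNondegenerateAt (h : IsEpimorphism A A' φ Φ)
    (hL : ∀ a, C.L a = C'.L (totalMap F F' Φ a)) (hD : ∀ x, (C.D x).map (Φ x) = C'.D (φ x))
    {Γ : ∀ a : TotalSpace F E, Pair B a} (hΓ : C.IsSolution A Γ) {a b : TotalSpace F E}
    (ha : a ∈ C.space) (hb : b ∈ C.space) (hab : totalMap F F' Φ b = totalMap F F' Φ a)
    (hnd : C'.IsNondegenerateAt (totalMap F F' Φ a)) :
    pushField (F' := F') (B' := B') Φ Γ a = pushField Φ Γ b := by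
  have h1 := ConstrainedSystem.satisfiesLdA_totalMap h hL hD (hΓ.satisfiesLdA a ha)
  have h2 := (ConstrainedSystem.satisfiesLdA_totalMap h hL hD (hΓ.satisfiesLdA b hb)).transport hab
  exact mk_tangent_eq_iff.2 ⟨hab.symm, congrArg Prod.snd (h1.eq_of_isNondegenerateAt h h2 hnd)⟩

theorem ConstrainedSystem.IsSolution.contMDiffOn_pushField
    (hΦ : ContMDiff (totalModel B F) (totalModel B' F') ∞ (totalMap F F' Φ))
    {Γ : ∀ a : TotalSpace F E, Pair B a} (hΓ : C.IsSolution A Γ) :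
    ContMDiffOn (totalModel B F) (totalModel B' F').tangent ∞
      (pushField (F' := F') (B' := B') Φ Γ) C.space := by
  have h1M : IsManifold (totalModel B F) 1 (TotalSpace F E) := .of_le (n := ∞) (by simp)
  have h1M' : IsManifold (totalModel B' F') 1 (TotalSpace F' E') := .of_le (n := ∞) (by simp)
  exact (hΦ.contMDiff_tangentMap (m := ∞) (by simp)).comp_contMDiffOn hΓ.contMDiffOn_snd

/-- Choose local sections through a and through b. Composed with the pushed field they give two
continuous fields on D' near the common image, equal at nondegenerate points and therefore at that
image. -/
theorem pushField_eq (h : IsEpimorphism A A' φ Φ) (hreg : C.IsRegular A)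
    (hL : ∀ a, C.L a = C'.L (totalMap F F' Φ a)) (hφ : Function.Surjective φ)
    (hD : ∀ x, (C.D x).map (Φ x) = C'.D (φ x))
    {Γ : ∀ a : TotalSpace F E, Pair B a} (hΓ : C.IsSolution A Γ) {a b : TotalSpace F E}
    (ha : a ∈ C.space) (hb : b ∈ C.space) (hab : totalMap F F' Φ a = totalMap F F' Φ b) :
    pushField (F' := F') (B' := B') Φ Γ a = pushField Φ Γ b := by
  have hinj : ∀ (x : M), ∀ d ∈ C.D x, Φ x d = 0 → d = 0 := fun x d =>
    hreg.eq_zero_of_map_eq_zero h.isMorphism hL hD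
  obtain ⟨N, s, hN, haN, hsa, hs, hsN⟩ := exists_local_section_totalMap h hD hinj ha
  obtain ⟨N₁, s₁, hN₁, hbN₁, hsb, hs₁, hsN₁⟩ := exists_local_section_totalMap h hD hinj hb
  have hG := (hΓ.contMDiffOn_pushField h.isMorphism.contMDiff_total).continuousOn
  have h1 := eqOn_of_isNondegenerateAt h.isMorphism hreg hL hφ hD (hN.inter hN₁)
    (f := pushField Φ Γ ∘ s) (g := pushField Φ Γ ∘ s₁)
    (hG.comp (hs.continuousOn.mono fun c hc => hc.1.1) fun c hc => (hsN c hc.1.1 hc.2).1)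
    (hG.comp (hs₁.continuousOn.mono fun c hc => hc.1.2) fun c hc => (hsN₁ c hc.1.2 hc.2).1)
    (fun c hc hnd => by
      have h2 := hsN c hc.1.1 hc.2
      have h3 := hsN₁ c hc.1.2 hc.2
      exact pushField_eq_of_isNondegenerateAt h hL hD hΓ h2.1 h3.1 (h3.2.trans h2.2.symm)
        (by rw [h2.2]; exact hnd))
    ⟨⟨haN, by rw [hab]; exact hbN₁⟩, totalMap_mem_space hD ha⟩
  simp only [Function.comp_apply] at h1
  rw [hsa, hab, hsb] at h1
  exact h1

/-- A solution of a regular system projects to a solution of the reduced system. -/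
theorem exists_isSolution (h : IsEpimorphism A A' φ Φ) (hreg : C.IsRegular A)
    (hL : ∀ a, C.L a = C'.L (totalMap F F' Φ a)) (hφ : Function.Surjective φ)
    (hD : ∀ x, (C.D x).map (Φ x) = C'.D (φ x))
    {Γ : ∀ a : TotalSpace F E, Pair B a} (hΓ : C.IsSolution A Γ) :
    ∃ Γ' : ∀ a : TotalSpace F' E', Pair B' a, C'.IsSolution A' Γ' ∧
      ∀ a ∈ C.space, prolMap Φ a (Γ a) = Γ' (totalMap F F' Φ a) := by
  have hinj : ∀ (x : M), ∀ d ∈ C.D x, Φ x d = 0 → d = 0 := fun x d =>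
    hreg.eq_zero_of_map_eq_zero h.isMorphism hL hD
  have hg : ∀ c : TotalSpace F' E', ∃ a : TotalSpace F E,
      c ∈ C'.space → a ∈ C.space ∧ totalMap F F' Φ a = c := by
    intro c
    by_cases hc : c ∈ C'.space
    · obtain ⟨a, ha, hac⟩ := exists_totalMap_eq hφ hD hc
      exact ⟨a, fun _ => ⟨ha, hac⟩⟩
    · obtain ⟨x, -⟩ := hφ c.proj
      exact ⟨⟨x, 0⟩, fun h => absurd h hc⟩
  choose g hg using hg
  let X : ∀ c : TotalSpace F' E', TangentSpace (totalModel B' F') c := fun c =>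
    (tangentCoord (pushField (F' := F') (B' := B') Φ Γ (g c)).2 : B' × F')
  have hX : ∀ c ∈ C'.space, (⟨c, X c⟩ : TangentBundle (totalModel B' F') (TotalSpace F' E')) =
      pushField Φ Γ (g c) := fun c hc => mk_tangent_eq_iff.2 ⟨(hg c hc).2.symm, rfl⟩
  have hXa : ∀ c ∈ C'.space, ∀ a ∈ C.space, totalMap F F' Φ a = c →
      (⟨c, X c⟩ : TangentBundle (totalModel B' F') (TotalSpace F' E')) = pushField Φ Γ a :=
    fun c hc a ha hac => (hX c hc).trans
      (pushField_eq h hreg hL hφ hD hΓ (hg c hc).1 ha ((hg c hc).2.trans hac.symm))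
  refine ⟨fun c => (c.snd, X c), ⟨contMDiffOn_id, ?_, ?_⟩, ?_⟩
  -- By independence of the preimage, the field coincides near each point of D' with the pushed
  -- field along a smooth local section.
  · intro c hc
    obtain ⟨a, ha, rfl⟩ := exists_totalMap_eq hφ hD hc
    obtain ⟨N, s, hN, haN, hsa, hs, hsN⟩ := exists_local_section_totalMap h hD hinj ha
    have h1 : ContMDiffOn (totalModel B' F') (totalModel B' F').tangent ∞
        (pushField (F' := F') (B' := B') Φ Γ ∘ s) (C'.space ∩ N) :=
      (hΓ.contMDiffOn_pushField h.isMorphism.contMDiff_total).comp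
        (hs.mono inter_subset_right) fun c hc => (hsN c hc.2 hc.1).1
    have h2 : ContMDiffOn (totalModel B' F') (totalModel B' F').tangent ∞
        (fun c => (⟨c, X c⟩ : TangentBundle (totalModel B' F') (TotalSpace F' E')))
        (C'.space ∩ N) :=
      h1.congr fun c hc => hXa c hc.1 (s c) (hsN c hc.2 hc.1).1 (hsN c hc.2 hc.1).2
    exact (h2 _ ⟨hc, haN⟩).mono_of_mem_nhdsWithin
      (inter_mem_nhdsWithin _ (hN.mem_nhds haN))
  · intro c hc
    exact (ConstrainedSystem.satisfiesLdA_totalMap h hL hD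
      (hΓ.satisfiesLdA (g c) (hg c hc).1)).transport (hg c hc).2
  · intro a ha
    refine Prod.ext (congrArg (Φ a.proj) (hΓ.satisfiesLdA a ha).sode) ?_
    exact (mk_tangent_eq_iff.1 (hXa _ (totalMap_mem_space hD ha) a ha rfl)).2.symm

end

/-! ### Projection of solution curves -/

theorem hasMFDerivWithinAt_totalMap_comp
    (hΦ : ContMDiff (totalModel B F) (totalModel B' F') ∞ (totalMap F F' Φ))
    {γ : ℝ → TotalSpace F E} {J : Set ℝ} {t : ℝ} {v : TangentSpace (totalModel B F) (γ t)}
    (hv : HasMFDerivWithinAt (modelWithCornersSelf ℝ ℝ) (totalModel B F) γ J t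
      ((1 : ℝ →L[ℝ] ℝ).smulRight v)) :
    HasMFDerivWithinAt (modelWithCornersSelf ℝ ℝ) (totalModel B' F') (totalMap F F' Φ ∘ γ) J t
      ((1 : ℝ →L[ℝ] ℝ).smulRight
        (mfderiv (totalModel B F) (totalModel B' F') (totalMap F F' Φ) (γ t) v)) := by
  have h1 := (hΦ.contMDiffAt.mdifferentiableAt (x := γ t) (by simp)).hasMFDerivAt
    |>.comp_hasMFDerivWithinAt t hv
  have h2 : ∀ (T : B × F →L[ℝ] B' × F') (w : B × F), T.comp ((1 : ℝ →L[ℝ] ℝ).smulRight w) =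
      (1 : ℝ →L[ℝ] ℝ).smulRight (T w) := by
    intro T w
    ext1
    simp
  exact h1.congr_mfderiv (h2 _ _)

theorem ConstrainedSystem.IsIntegralCurve.totalMap
    (hΦ : ContMDiff (totalModel B F) (totalModel B' F') ∞ (totalMap F F' Φ))
    (hD : ∀ x, (C.D x).map (Φ x) = C'.D (φ x)) {Γ : ∀ a : TotalSpace F E, Pair B a}
    {Γ' : ∀ a : TotalSpace F' E', Pair B' a}
    (hΓ : ∀ a ∈ C.space, prolMap Φ a (Γ a) = Γ' (totalMap F F' Φ a)) {γ : ℝ → TotalSpace F E}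
    {J : Set ℝ} (hγ : C.IsIntegralCurve Γ γ J) :
    C'.IsIntegralCurve Γ' (LieAlgd.totalMap F F' Φ ∘ γ) J := by
  refine ⟨fun t ht => totalMap_mem_space hD (hγ.1 t ht), fun t ht => ?_⟩
  exact (hasMFDerivWithinAt_totalMap_comp hΦ (hγ.2 t ht)).congr_mfderiv
    (congrArg (fun v : B' × F' => (1 : ℝ →L[ℝ] ℝ).smulRight v)
      (congrArg Prod.snd (hΓ (γ t) (hγ.1 t ht))))

theorem ConstrainedSystem.IsLdACurve.totalMap [FiniteDimensional ℝ B] [T2Space M]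
    [FiniteDimensional ℝ B'] [T2Space M'] (h : IsEpimorphism A A' φ Φ)
    (hL : ∀ a, C.L a = C'.L (totalMap F F' Φ a)) (hD : ∀ x, (C.D x).map (Φ x) = C'.D (φ x))
    {γ : ℝ → TotalSpace F E} {J : Set ℝ} (hγ : C.IsLdACurve A γ J) :
    C'.IsLdACurve A' (LieAlgd.totalMap F F' Φ ∘ γ) J := by
  intro t ht
  obtain ⟨h1, v, hv, hsat⟩ := hγ t ht
  exact ⟨totalMap_mem_space hD h1, _, hasMFDerivWithinAt_totalMap_comp h.isMorphism.contMDiff_total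
    hv, ConstrainedSystem.satisfiesLdA_totalMap h hL hD hsat⟩

end

end BundleMaps

end LieAlgd

end

/-! ### The reduction theorem -/

open LieAlgd in
theorem mainTheorem5
    -- the Lie algebroid `E → M`
    {B : Type*} [NormedAddCommGroup B] [NormedSpace ℝ B] [FiniteDimensional ℝ B]
    {M : Type*} [TopologicalSpace M] [T2Space M] [SecondCountableTopology M]
    [ChartedSpace B M] [IsManifold (modelWithCornersSelf ℝ B) ∞ M]
    {F : Type*} [NormedAddCommGroup F] [NormedSpace ℝ F] [FiniteDimensional ℝ F]
    {E : M → Type*} [TopologicalSpace (TotalSpace F E)]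
    [∀ x, AddCommGroup (E x)] [∀ x, Module ℝ (E x)] [∀ x, TopologicalSpace (E x)]
    [FiberBundle F E] [VectorBundle ℝ F E]
    [ContMDiffVectorBundle ∞ F E (modelWithCornersSelf ℝ B)]
    (A : LieAlgebroid B F E)
    -- the Lie algebroid `E' → M'`
    {B' : Type*} [NormedAddCommGroup B'] [NormedSpace ℝ B'] [FiniteDimensional ℝ B']
    {M' : Type*} [TopologicalSpace M'] [T2Space M'] [SecondCountableTopology M']
    [ChartedSpace B' M'] [IsManifold (modelWithCornersSelf ℝ B') ∞ M']
    {F' : Type*} [NormedAddCommGroup F'] [NormedSpace ℝ F'] [FiniteDimensional ℝ F']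
    {E' : M' → Type*} [TopologicalSpace (TotalSpace F' E')]
    [∀ x, AddCommGroup (E' x)] [∀ x, Module ℝ (E' x)] [∀ x, TopologicalSpace (E' x)]
    [FiberBundle F' E'] [VectorBundle ℝ F' E']
    [ContMDiffVectorBundle ∞ F' E' (modelWithCornersSelf ℝ B')]
    (A' : LieAlgebroid B' F' E')
    -- the constrained Lagrangian systems `(L, D)` and `(L', D')`
    (C : ConstrainedSystem B F E) (C' : ConstrainedSystem B' F' E')
    (hreg : C.IsRegular A)
    -- the epimorphism
    (φ : M → M') (Φ : ∀ x, E x →ₗ[ℝ] E' (φ x)) (hΦ : IsEpimorphism A A' φ Φ)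
    (hL : ∀ a, C.L a = C'.L (totalMap F F' Φ a))
    -- `Φ(D) = D'`: the base map is onto and `Φ(D_x) = D'_{φ(x)}`
    (hφ : Function.Surjective φ) (hD : ∀ x, (C.D x).map (Φ x) = C'.D (φ x)) :
    C'.IsRegular A' ∧
    (∀ (Γ : ∀ a : TotalSpace F E, Pair B a) (Γ' : ∀ a : TotalSpace F' E', Pair B' a),
      C.IsSolution A Γ → C'.IsSolution A' Γ' →
        (∀ a ∈ C.space, prolMap Φ a (Γ a) = Γ' (totalMap F F' Φ a)) ∧
        ∀ (γ : ℝ → TotalSpace F E) (J : Set ℝ), C.IsIntegralCurve Γ γ J →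
          C'.IsIntegralCurve Γ' (totalMap F F' Φ ∘ γ) J) ∧
    ∀ (γ : ℝ → TotalSpace F E) (J : Set ℝ), C.IsLdACurve A γ J →
      C'.IsLdACurve A' (totalMap F F' Φ ∘ γ) J := by
  refine ⟨?_, fun Γ Γ' hΓ hΓ' => ?_, fun γ J hγ => hγ.totalMap hΦ hL hD⟩
  · have ⟨Γ, hΓ, _⟩ := hreg
    obtain ⟨Γ', hΓ', -⟩ := exists_isSolution hΦ hreg hL hφ hD hΓ
    exact ⟨Γ', hΓ', fun Γ₁ hΓ₁ a ha => hΓ₁.eq_on_space hΦ hreg hL hφ hD hΓ' ha⟩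
  · obtain ⟨Γ₁, hΓ₁, hΓΓ₁⟩ := exists_isSolution hΦ hreg hL hφ hD hΓ
    -- An arbitrary solution Γ' is identified with the projected one by uniqueness on D'.
    have h1 : ∀ a ∈ C.space, prolMap Φ a (Γ a) = Γ' (totalMap F F' Φ a) := fun a ha =>
      (hΓΓ₁ a ha).trans (hΓ₁.eq_on_space hΦ hreg hL hφ hD hΓ' (totalMap_mem_space hD ha))
    exact ⟨h1, fun γ J hγ => hγ.totalMap hΦ.isMorphism.contMDiff_total hD h1⟩
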